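/- Let $n\ge 1$ and let $\mathbb X^n$ be Euclidean space $\mathbb E^n$ or hyperbolic space $\mathbb H^n$ (curvature $-1$). Let $P\subset\mathbb X^n$ be a compact convex polyhedron, i.e. a compact intersection of finitely many closed half-spaces, with nonempty interior. Let a number $q(F)>0$ be given for each $(n-1)$-dimensional face $F$ of $P$. For a unit vector $v\in T^1P$ with geodesic $\gamma_v$, let $l(v)$ be the length of the geodesic segment $\gamma_v\cap P$, and let $q(v)=q(F)$, where $F$ is the face through which $\gamma_v$ enters $P$ (the last face that $\gamma_v$ meets before or at time $0$). This determines $q(v)$ for every $v$ based at an interior point of $P$ whose geodesic enters $P$ at a point lying in only one $(n-1)$-dimensional face; on the remaining vectors, which form a null set, $q$ may take any real values. Let $m_L$ be the (unnormalized) Liouville measure on $T^1P$, locally the product of the Riemannian volume on $P$ and the standard angular measure on the unit spheres $T^1_xP$. Let $\operatorname{vol}$ of a subset of $\partial P$ denote its $(n-1)$-dimensional Riemannian volume. Let $$c_n=\int_{S^{n-1}}\max(0,\,w\cdot e)\,dw\qquad (e\in S^{n-1})$$ be the integral of $w\cdot e$ over a hemisphere. Then, for every $e\in S^{n-1}$,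 this integral equals the volume of the unit ball of $\mathbb R^{n-1}$ (which is $1$ when $n=1$). Moreover, $P$ has finitely many $(n-1)$-dimensional faces, they and $\partial P$ have finite $(n-1)$-volume, $\frac{\ln q}{l}$ is $m_L$-integrable, and $$\int_{T^1P}\frac{\ln q}{l}\,dm_L=c_n\sum_F \ln q(F)\,\operatorname{vol}(F),$$ where the sum is over the $(n-1)$-dimensional faces $F$ of $P$. In particular, if $q(F)=q$ is the same for all faces $F$, then $$\int_{T^1P}\frac{\ln q}{l}\,dm_L=c_n\,\ln q\,\operatorname{vol}(\partial P).$$ -/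

import Mathlib

open MeasureTheory
open scoped RealInnerProductSpace

noncomputable section

/-- The two geometries of constant curvature considered: Euclidean space `𝔼ⁿ` (curvature `0`), and
hyperbolic space `ℍⁿ` (curvature `-1`), the latter in the Poincaré ball model. Both are open
subsets of `ℝⁿ` with a Riemannian metric `λ(x)² |dx|²` conformal to the flat one. -/
inductive ModelGeometry where
  | euclidean
  | hyperbolic

namespace ModelGeometry

/-- The underlying set of the space: all of `ℝⁿ`, or the open unit ball. -/
def domain (G : ModelGeometry) (n : ℕ) : Set (EuclideanSpace ℝ (Fin n)) :=
  match G with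
  | euclidean => Set.univ
  | hyperbolic => Metric.ball 0 1

/-- The conformal factor `λ(x)` of the Riemannian metric `λ(x)² |dx|²`. -/
def conformalFactor (G : ModelGeometry) {n : ℕ} (x : EuclideanSpace ℝ (Fin n)) : ℝ :=
  match G with
  | euclidean => 1
  | hyperbolic => 2 / (1 - ‖x‖ ^ 2)

/-- Möbius addition `x ⊕ u` on the unit ball; `u ↦ x ⊕ u` is the hyperbolic isometry of the ball
taking `0` to `x` whose derivative at `0` is a positive multiple of the identity. -/
def mobiusAdd {n : ℕ} (x u : EuclideanSpace ℝ (Fin n)) : EuclideanSpace ℝ (Fin n) :=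
  (1 + 2 * ⟪x, u⟫ + ‖x‖ ^ 2 * ‖u‖ ^ 2)⁻¹ •
    ((1 + 2 * ⟪x, u⟫ + ‖u‖ ^ 2) • x + (1 - ‖x‖ ^ 2) • u)

/-- The unit speed geodesic `γ` with `γ(0) = x` and `γ'(0) = λ(x)⁻¹ w`, where `w` is a vector of
Euclidean norm `1` (so that `λ(x)⁻¹ w` is a unit vector of the Riemannian metric). In the ball, the
geodesic from `0` in the direction `w` is `t ↦ tanh (t / 2) w`; the general one is its image under
the isometry `u ↦ x ⊕ u`. -/
def geodesic (G : ModelGeometry) {n : ℕ} (x w : EuclideanSpace ℝ (Fin n)) (t : ℝ) :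
    EuclideanSpace ℝ (Fin n) :=
  match G with
  | euclidean => x + t • w
  | hyperbolic => mobiusAdd x (Real.tanh (t / 2) • w)

/-- The function whose zero set in the space is a hyperplane (totally geodesic hypersurface), and
whose nonnegativity set is one of the closed half-spaces bounded by it. In the ball it is
`(1 - ‖x‖²) (a X₀ + ⟪b, X⟫)`, where `(X₀, X)` is the point of the hyperboloid `X₀² - ‖X‖² = 1`
corresponding to `x`, namely `X₀ = (1 + ‖x‖²) / (1 - ‖x‖²)` and `X = 2 x / (1 - ‖x‖²)`. -/
def wallFun (G : ModelGeometry) {n : ℕ} (a : ℝ) (b x : EuclideanSpace ℝ (Fin n)) : ℝ :=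
  match G with
  | euclidean => a + ⟪b, x⟫
  | hyperbolic => a * (1 + ‖x‖ ^ 2) + 2 * ⟪b, x⟫

/-- The coefficients `(a, b)` for which `wallFun a b` does define a hyperplane. -/
def IsWall (G : ModelGeometry) {n : ℕ} (a : ℝ) (b : EuclideanSpace ℝ (Fin n)) : Prop :=
  match G with
  | euclidean => b ≠ 0
  | hyperbolic => |a| < ‖b‖

/-- A (full-dimensional, compact) convex polyhedron: a compact set with nonempty interior which is
the intersection of finitely many closed half-spaces. -/
def IsConvexPolyhedron (G : ModelGeometry) {n : ℕ} (P : Set (EuclideanSpace ℝ (Fin n))) : Prop :=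
  IsCompact P ∧ (interior P).Nonempty ∧
    ∃ (m : ℕ) (a : Fin m → ℝ) (b : Fin m → EuclideanSpace ℝ (Fin n)),
      (∀ i, G.IsWall (a i) (b i)) ∧
        P = G.domain n ∩ ⋂ i, {x | 0 ≤ G.wallFun (a i) (b i) x}

/-- The set of `(n-1)`-dimensional faces of `P`: the intersections of `P` with a supporting
hyperplane which have nonempty relative interior in that hyperplane. -/
def facets (G : ModelGeometry) {n : ℕ} (P : Set (EuclideanSpace ℝ (Fin n))) :
    Set (Set (EuclideanSpace ℝ (Fin n))) :=
  {F | ∃ (a : ℝ) (b : EuclideanSpace ℝ (Fin n)), G.IsWall a b ∧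
    (∀ x ∈ P, 0 ≤ G.wallFun a b x) ∧ F = {x ∈ P | G.wallFun a b x = 0} ∧
    ∃ U : Set (EuclideanSpace ℝ (Fin n)), IsOpen U ∧ (U ∩ F).Nonempty ∧
      ∀ x ∈ U, G.wallFun a b x = 0 → x ∈ F}

/-- The Riemannian volume `λⁿ dx`. -/
def volumeMeasure (G : ModelGeometry) (n : ℕ) : Measure (EuclideanSpace ℝ (Fin n)) :=
  volume.withDensity fun x => ENNReal.ofReal (G.conformalFactor x) ^ n

/-- The `(n-1)`-dimensional Riemannian volume: the Euclidean `(n-1)`-dimensional Hausdorff measure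
(normalized so as to be surface area) with density `λⁿ⁻¹`. -/
def areaMeasure (G : ModelGeometry) (n : ℕ) : Measure (EuclideanSpace ℝ (Fin n)) :=
  (Measure.euclideanHausdorffMeasure (n - 1)).withDensity fun x =>
    ENNReal.ofReal (G.conformalFactor x) ^ (n - 1)

/-- The Liouville measure on the unit tangent bundle `T¹P`: Riemannian volume on `P` times the
angular measure on unit tangent vectors (not normalized). The pair `(x, w)`, with `w` in the
Euclidean unit sphere, stands for the Riemannian unit vector `λ(x)⁻¹ w` at `x`; as the metric is
conformal, `w ↦ λ(x)⁻¹ w` is an isometry from the Euclidean unit sphere to that of the tangent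
space at `x`. -/
def liouville (G : ModelGeometry) {n : ℕ} (P : Set (EuclideanSpace ℝ (Fin n))) :
    Measure (EuclideanSpace ℝ (Fin n) × Metric.sphere (0 : EuclideanSpace ℝ (Fin n)) 1) :=
  ((G.volumeMeasure n).restrict P).prod (volume : Measure (EuclideanSpace ℝ (Fin n))).toSphere

/-- The times at which the geodesic of `v` is in `P`. -/
def chordTimes (G : ModelGeometry) {n : ℕ} (P : Set (EuclideanSpace ℝ (Fin n)))
    (v : EuclideanSpace ℝ (Fin n) × Metric.sphere (0 : EuclideanSpace ℝ (Fin n)) 1) : Set ℝ :=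
  {t | G.geodesic v.1 v.2 t ∈ P}

/-- The length `l(v)` of the chord that `P` cuts out of the geodesic of `v`. -/
def chordLength (G : ModelGeometry) {n : ℕ} (P : Set (EuclideanSpace ℝ (Fin n)))
    (v : EuclideanSpace ℝ (Fin n) × Metric.sphere (0 : EuclideanSpace ℝ (Fin n)) 1) : ℝ :=
  sSup (G.chordTimes P v) - sInf (G.chordTimes P v)

/-- The point where the geodesic of `v` enters `P`. -/
def entryPoint (G : ModelGeometry) {n : ℕ} (P : Set (EuclideanSpace ℝ (Fin n)))
    (v : EuclideanSpace ℝ (Fin n) × Metric.sphere (0 : EuclideanSpace ℝ (Fin n)) 1) :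
    EuclideanSpace ℝ (Fin n) :=
  G.geodesic v.1 v.2 (sInf (G.chordTimes P v))

/-- `Q` is an extension to `T¹P` of the face weights `q`: if `v` is based at an interior point
of `P` and its geodesic enters `P` at a point of `F` and of no other `(n-1)`-dimensional face, then
`Q v = q F`. No condition is put on the values of `Q` at the other (exceptional) vectors. -/
def IsFaceWeight (G : ModelGeometry) {n : ℕ} (P : Set (EuclideanSpace ℝ (Fin n)))
    (q : Set (EuclideanSpace ℝ (Fin n)) → ℝ)
    (Q : EuclideanSpace ℝ (Fin n) × Metric.sphere (0 : EuclideanSpace ℝ (Fin n)) 1 → ℝ) : Prop :=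
  ∀ v, v.1 ∈ interior P → ∀ F ∈ G.facets P, G.entryPoint P v ∈ F →
    (∀ F' ∈ G.facets P, G.entryPoint P v ∈ F' → F' = F) → Q v = q F

end ModelGeometry

end

/-! ### Polar coordinates and linear changes of variable on the sphere. -/

section Polar

variable {E : Type*} [NormedAddCommGroup E] [InnerProductSpace ℝ E] [MeasurableSpace E]
  [BorelSpace E] [FiniteDimensional ℝ E]

/-! The integral is computed by Santaló's formula: slice the unit tangent bundle into geodesic
chords. Integrating `1 / l` along a chord of length `l` gives exactly 1, so what remains is the flux
of unit vectors entering through each facet. The flux through an area element, integrated over the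
inward hemisphere, is the constant `c_n` times the area.

To make the slicing elementary, everything is moved to the projective (Klein) model by `flatMap`,
where geodesics are straight segments and polyhedra are Euclidean polytopes. In the Euclidean case
this map is the identity, and `curv` (0 or 1) lets both geometries share the same formulas. Write `n
= k + 1`, `s(y) = flatFactor y`, and let `f(y, u) = flatForm y u` for a Euclidean unit vector `u`.
The Liouville measure becomes `s⁻² f^(-n/2) dy du` (`lintegral_liouville`), while the Riemannian
speed of the line in direction `u` is `f^(1/2) s⁻²`. Hence the measure is `f^(-(n+1)/2) · speed · dy
du`, and `f` is constant along each line.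

Fix `u` and a facet on the hyperplane `⟪ν, y⟫ = p`. Coordinates along lines in the direction `u`,
starting from that hyperplane, give `dy = ⟪ν, u⟫ dz ds`. The integral of the speed over the chord is
`l` and cancels the weight `1 / l` (`IsPolytope.lintegral_entersAt`). There remains the integral
over the facet of `⟪ν, u⟫ f^(-(n+1)/2)` over the directions with `⟪ν, u⟫ > 0`. This integrand is
homogeneous of degree `-n` in `u`, so it can be transported by the derivative of `flatMap` to the
round sphere of the conformal model, where it is a hemisphere integral (`lintegral_flux`). The
resulting factor is the density of Riemannian area on the hyperplane in Klein coordinates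
(`areaMeasure_flatInv_image`).

The remaining points are measure theoretic: almost every vector enters through exactly one facet, so
that `ln q / l` is almost everywhere a finite sum of facet terms, and facets cover the boundary and
overlap only up to zero area. The value of `c_n` comes from a Gaussian integral. -/

theorem lintegral_eq_lintegral_sphere_Ioi [Nontrivial E] {f : E → ENNReal} (hf : Measurable f) :
    ∫⁻ v, f v = ∫⁻ w : Metric.sphere (0 : E) 1, (∫⁻ r in Set.Ioi (0 : ℝ),
      ENNReal.ofReal (r ^ (Module.finrank ℝ E - 1)) * f (r • (w : E)))
        ∂(volume : Measure E).toSphere := by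
  have h := (volume : Measure E).measurePreserving_homeomorphUnitSphereProd
  have h0 : MeasurableSet ({0}ᶜ : Set E) := (measurableSet_singleton _).compl
  have hg : Measurable fun p : Metric.sphere (0 : E) 1 × Set.Ioi (0 : ℝ) ↦
      f ((p.2 : ℝ) • (p.1 : E)) := by fun_prop
  calc ∫⁻ v, f v = ∫⁻ v in ({0}ᶜ : Set E), f v := by
        rw [restrict_compl_singleton]
    _ = ∫⁻ v : ({0}ᶜ : Set E), f v ∂(Measure.comap Subtype.val volume) :=
        (lintegral_subtype_comap h0 f).symm
    _ = ∫⁻ v : ({0}ᶜ : Set E), (fun p : Metric.sphere (0 : E) 1 × Set.Ioi (0 : ℝ) ↦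
          f ((p.2 : ℝ) • (p.1 : E))) (homeomorphUnitSphereProd E v)
            ∂(Measure.comap Subtype.val volume) := by
        refine lintegral_congr fun v ↦ ?_
        conv_lhs => rw [← (homeomorphUnitSphereProd E).symm_apply_apply v]
        rw [homeomorphUnitSphereProd_symm_apply_coe]
    _ = ∫⁻ p, f ((p.2 : ℝ) • (p.1 : E)) ∂((volume : Measure E).toSphere.prod
          (Measure.volumeIoiPow (Module.finrank ℝ E - 1))) := h.lintegral_comp hg
    _ = _ := by
        rw [lintegral_prod _ hg.aemeasurable]
        refine lintegral_congr fun w ↦ ?_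
        rw [Measure.volumeIoiPow, lintegral_withDensity_eq_lintegral_mul _ (by fun_prop)
          (by fun_prop)]
        exact lintegral_subtype_comap measurableSet_Ioi
          (fun r : ℝ ↦ ENNReal.ofReal (r ^ (Module.finrank ℝ E - 1)) * f (r • (w : E)))

theorem lintegral_Ioo_ofReal_inv {a b : ℝ} (ha : 0 < a) (hab : a ≤ b) :
    ∫⁻ r in Set.Ioo a b, ENNReal.ofReal r⁻¹ = ENNReal.ofReal (Real.log (b / a)) := by
  rw [← integral_inv_of_pos ha (ha.trans_le hab), intervalIntegral.integral_of_le hab,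
    ← restrict_Ioo_eq_restrict_Ioc, ofReal_integral_eq_lintegral_ofReal]
  · rw [restrict_Ioo_eq_restrict_Ioc, ← IntegrableOn, ← intervalIntegrable_iff_integrableOn_Ioc_of_le hab]
    apply intervalIntegrable_inv_iff.2
    right
    rw [Set.uIcc_of_le hab]
    exact fun h ↦ absurd h.1 (not_le.2 ha)
  · filter_upwards [ae_restrict_mem measurableSet_Ioo] with r hr
    exact inv_nonneg.2 (ha.trans hr.1).le

/-- A function homogeneous of degree `-dim E` has the same integral over every spherical shell
`1 < N < e` of a gauge `N` as over the unit sphere. -/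
theorem lintegral_shell_eq_lintegral_sphere [Nontrivial E] {g : E → ENNReal} (hg : Measurable g)
    (hgh : ∀ (r : ℝ) (v : E), 0 < r → v ≠ 0 →
      g (r • v) = ENNReal.ofReal (r ^ Module.finrank ℝ E)⁻¹ * g v)
    {N : E → ℝ} (hN : Measurable N) (hNpos : ∀ v, v ≠ 0 → 0 < N v)
    (hNh : ∀ (r : ℝ) (v : E), 0 < r → N (r • v) = r * N v) :
    ∫⁻ v in {v | 1 < N v ∧ N v < Real.exp 1}, g v =
      ∫⁻ w : Metric.sphere (0 : E) 1, g w ∂(volume : Measure E).toSphere := by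
  have hS : MeasurableSet {v | 1 < N v ∧ N v < Real.exp 1} :=
    (measurableSet_lt measurable_const hN).inter (measurableSet_lt hN measurable_const)
  -- On the ray of `w` the shell is the interval from `1 / N w` to `e / N w`, and the integrand is
  -- `r^(d-1) · r^(-d) = 1 / r`. Its integral is `log e = 1` whatever `N w` is, which is why the
  -- ratio of the shell is `e`.
  rw [← lintegral_indicator hS, lintegral_eq_lintegral_sphere_Ioi (hg.indicator hS)]
  refine lintegral_congr fun w ↦ ?_
  have hw : (w : E) ≠ 0 := ne_zero_of_mem_unit_sphere w
  have hNw := hNpos _ hw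
  have hd : 0 < Module.finrank ℝ E := Module.finrank_pos
  have key : ∀ r ∈ Set.Ioi (0 : ℝ), ENNReal.ofReal (r ^ (Module.finrank ℝ E - 1)) *
      ({v | 1 < N v ∧ N v < Real.exp 1}.indicator g (r • (w : E))) =
      (Set.Ioo (N w)⁻¹ (Real.exp 1 * (N w)⁻¹)).indicator
        (fun r ↦ ENNReal.ofReal r⁻¹ * g w) r := by
    intro r hr
    have hr : 0 < r := hr
    by_cases h : r ∈ Set.Ioo (N w)⁻¹ (Real.exp 1 * (N w)⁻¹)
    · have h' : r • (w : E) ∈ {v | 1 < N v ∧ N v < Real.exp 1} := by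
        simp only [Set.mem_ofPred_eq, hNh r _ hr]
        exact ⟨(inv_lt_iff_one_lt_mul₀ hNw).1 h.1, (lt_mul_inv_iff₀ hNw).1 h.2⟩
      rw [Set.indicator_of_mem h, Set.indicator_of_mem h', hgh r _ hr hw, ← mul_assoc,
        ← ENNReal.ofReal_mul (by positivity)]
      congr 2
      obtain ⟨d, hd'⟩ := Nat.exists_eq_succ_of_ne_zero hd.ne'
      rw [hd', Nat.succ_sub_one, Nat.succ_eq_add_one, pow_succ]
      field_simp
    · have h' : r • (w : E) ∉ {v | 1 < N v ∧ N v < Real.exp 1} := by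
        simp only [Set.mem_ofPred_eq, hNh r _ hr]
        exact fun hh ↦ h ⟨(inv_lt_iff_one_lt_mul₀ hNw).2 hh.1, (lt_mul_inv_iff₀ hNw).2 hh.2⟩
      rw [Set.indicator_of_notMem h, Set.indicator_of_notMem h', mul_zero]
  have hsub : Set.Ioo (N w)⁻¹ (Real.exp 1 * (N w)⁻¹) ⊆ Set.Ioi 0 :=
    fun r hr ↦ (inv_pos.2 hNw).trans hr.1
  rw [setLIntegral_congr_fun measurableSet_Ioi key, setLIntegral_indicator measurableSet_Ioo,
    Set.inter_eq_self_of_subset_left hsub, lintegral_mul_const _ (by fun_prop),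
    lintegral_Ioo_ofReal_inv (inv_pos.2 hNw)]
  · rw [mul_div_assoc, div_self (inv_ne_zero hNw.ne'), mul_one, Real.log_exp, ENNReal.ofReal_one,
      one_mul]
  · exact le_mul_of_one_le_left (inv_nonneg.2 hNw.le) (Real.one_le_exp zero_le_one)

/-- Change of variables on the sphere for functions homogeneous of degree `-dim E`. -/
theorem lintegral_sphere_comp_linear [Nontrivial E] {g : E → ENNReal} (hg : Measurable g)
    (hgh : ∀ (r : ℝ) (v : E), 0 < r → v ≠ 0 →
      g (r • v) = ENNReal.ofReal (r ^ Module.finrank ℝ E)⁻¹ * g v)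
    {A : E →L[ℝ] E} (hA : Function.Injective A) :
    ∫⁻ w : Metric.sphere (0 : E) 1, g w ∂(volume : Measure E).toSphere =
      ENNReal.ofReal |A.det| *
        ∫⁻ w : Metric.sphere (0 : E) 1, g (A w) ∂(volume : Measure E).toSphere := by
  have hA0 : ∀ v, v ≠ 0 → A v ≠ 0 := fun v hv ↦ (map_ne_zero_iff A hA).2 hv
  have hsurj : Function.Surjective A := LinearMap.injective_iff_surjective.1 hA
  -- The freedom of gauge is used here: the round shell on the left, and on the right the shell of
  -- `‖A v‖`, which is its preimage under `A`. The claim becomes the linear change of variables in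
  -- `E`.
  rw [← lintegral_shell_eq_lintegral_sphere hg hgh measurable_norm (fun v hv ↦ norm_pos_iff.2 hv)
      (fun r v hr ↦ by rw [norm_smul, Real.norm_of_nonneg hr.le]),
    ← lintegral_shell_eq_lintegral_sphere (g := fun v ↦ g (A v)) (by fun_prop)
      (fun r v hr hv ↦ by rw [map_smul, hgh r _ hr (hA0 v hv)])
      (N := fun v ↦ ‖A v‖) (by fun_prop) (fun v hv ↦ norm_pos_iff.2 (hA0 v hv))
      (fun r v hr ↦ by rw [map_smul, norm_smul, Real.norm_of_nonneg hr.le])]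
  have hS : MeasurableSet {v : E | 1 < ‖A v‖ ∧ ‖A v‖ < Real.exp 1} := by
    have h : Measurable fun v ↦ ‖A v‖ := by fun_prop
    exact (measurableSet_lt measurable_const h).inter (measurableSet_lt h measurable_const)
  have himg : A '' {v : E | 1 < ‖A v‖ ∧ ‖A v‖ < Real.exp 1} =
      {v : E | 1 < ‖v‖ ∧ ‖v‖ < Real.exp 1} := by
    rw [show {v : E | 1 < ‖A v‖ ∧ ‖A v‖ < Real.exp 1} =
      A ⁻¹' {v : E | 1 < ‖v‖ ∧ ‖v‖ < Real.exp 1} from rfl, Set.image_preimage_eq _ hsurj]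
  rw [← himg, lintegral_image_eq_lintegral_abs_det_fderiv_mul volume hS
    (fun x _ ↦ A.hasFDerivAt.hasFDerivWithinAt) hA.injOn,
    lintegral_const_mul _ (by fun_prop)]

end Polar

/-! ### Orthonormal frames adapted to a hyperplane, and integration along parallel lines. -/

section Frame

variable {k : ℕ}

/-- `Φ (s, z)` is the point at height `s` over the hyperplane `νᗮ`, whose points are parametrized
isometrically by `z`. -/
structure IsFrame (ν : EuclideanSpace ℝ (Fin (k + 1)))
    (Φ : (ℝ × EuclideanSpace ℝ (Fin k)) ≃L[ℝ] EuclideanSpace ℝ (Fin (k + 1))) : Prop where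
  inner_map : ∀ p q, ⟪Φ p, Φ q⟫ = p.1 * q.1 + ⟪p.2, q.2⟫
  map_one_zero : Φ (1, 0) = ν
  measurePreserving : MeasurePreserving Φ (volume.prod volume) volume

/-- The splitting of the first coordinate of a Euclidean space. -/
noncomputable def consEquiv (k : ℕ) :
    (ℝ × EuclideanSpace ℝ (Fin k)) ≃L[ℝ] EuclideanSpace ℝ (Fin (k + 1)) :=
  LinearEquiv.toContinuousLinearEquiv
    { toFun := fun p ↦ WithLp.toLp 2 (Fin.cons p.1 p.2.ofLp)
      invFun := fun x ↦ (x 0, WithLp.toLp 2 (Fin.tail x.ofLp))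
      map_add' := fun p q ↦ by
        ext i
        refine Fin.cases ?_ (fun j ↦ ?_) i <;> simp
      map_smul' := fun c p ↦ by
        ext i
        refine Fin.cases ?_ (fun j ↦ ?_) i <;> simp
      left_inv := fun p ↦ by simp
      right_inv := fun x ↦ by simp }

theorem consEquiv_apply (p : ℝ × EuclideanSpace ℝ (Fin k)) :
    consEquiv k p = WithLp.toLp 2 (Fin.cons p.1 p.2.ofLp) := rfl

theorem measurePreserving_consEquiv :
    MeasurePreserving (consEquiv k) (volume.prod volume) volume := by
  have h1 := (volume_preserving_piFinSuccAbove (fun _ : Fin (k + 1) ↦ ℝ) 0).symm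
  have h2 := (EuclideanSpace.volume_preserving_symm_measurableEquiv_toLp (Fin (k + 1))).symm
  have h3 := (EuclideanSpace.volume_preserving_symm_measurableEquiv_toLp (Fin k))
  have h4 := (MeasurePreserving.id (volume : Measure ℝ)).prod h3
  have h5 := h2.comp (h1.comp h4)
  have h6 : ⇑(consEquiv k) = ⇑(MeasurableEquiv.toLp 2 (Fin (k + 1) → ℝ)).symm.symm ∘
      ⇑(MeasurableEquiv.piFinSuccAbove (fun _ ↦ ℝ) 0).symm ∘
        Prod.map id ⇑(MeasurableEquiv.toLp 2 (Fin k → ℝ)).symm := by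
    funext p
    ext i
    refine Fin.cases ?_ (fun j ↦ ?_) i <;>
    simp [consEquiv_apply, MeasurableEquiv.piFinSuccAbove, Fin.insertNthEquiv]
  rw [h6]
  exact h5

theorem exists_isFrame {ν : EuclideanSpace ℝ (Fin (k + 1))} (hν : ‖ν‖ = 1) :
    ∃ Φ, IsFrame ν Φ := by
  set e : EuclideanSpace ℝ (Fin (k + 1)) := EuclideanSpace.single 0 1 with he
  -- The reflection in the hyperplane orthogonal to `e - ν` exchanges the unit vectors `e` and `ν`;
  -- it is the identity if they coincide.
  let R := (ℝ ∙ (e - ν))ᗮ.reflection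
  have hR : R e = ν := Submodule.reflection_sub (by simp [e, hν])
  refine ⟨(consEquiv k).trans R.toContinuousLinearEquiv, fun p q ↦ ?_, ?_, ?_⟩
  · have : ⟪R (consEquiv k p), R (consEquiv k q)⟫ = p.1 * q.1 + ⟪p.2, q.2⟫ := by
      rw [R.inner_map_map, consEquiv_apply, consEquiv_apply, PiLp.inner_apply, Fin.sum_univ_succ,
        PiLp.inner_apply]
      simp [mul_comm]
    exact this
  · have : consEquiv k (1, 0) = e := by
      rw [consEquiv_apply]
      ext i
      refine Fin.cases ?_ (fun j ↦ ?_) i <;> simp [e]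
    change R (consEquiv k (1, 0)) = ν
    rw [this, hR]
  · exact R.measurePreserving.comp measurePreserving_consEquiv

namespace IsFrame

variable {ν : EuclideanSpace ℝ (Fin (k + 1))}
  {Φ : (ℝ × EuclideanSpace ℝ (Fin k)) ≃L[ℝ] EuclideanSpace ℝ (Fin (k + 1))}

theorem inner_left (h : IsFrame ν Φ) (p : ℝ × EuclideanSpace ℝ (Fin k)) : ⟪ν, Φ p⟫ = p.1 := by
  rw [← h.map_one_zero, h.inner_map]
  simp

theorem norm_eq_one (h : IsFrame ν Φ) : ‖ν‖ = 1 := by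
  have : ⟪ν, ν⟫ = 1 := by
    rw [← h.map_one_zero, h.inner_map]; simp
  rw [real_inner_self_eq_norm_sq] at this
  exact (pow_eq_one_iff_of_nonneg (norm_nonneg _) two_ne_zero).1 this

theorem norm_sq (h : IsFrame ν Φ) (p : ℝ × EuclideanSpace ℝ (Fin k)) :
    ‖Φ p‖ ^ 2 = p.1 ^ 2 + ‖p.2‖ ^ 2 := by
  rw [← real_inner_self_eq_norm_sq, h.inner_map, real_inner_self_eq_norm_sq, sq p.1]

theorem exists_eq (h : IsFrame ν Φ) (x : EuclideanSpace ℝ (Fin (k + 1))) :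
    ∃ z, x = Φ (⟪ν, x⟫, z) := by
  obtain ⟨⟨s, z⟩, rfl⟩ := Φ.surjective x
  exact ⟨z, by rw [h.inner_left]⟩

theorem isometry (h : IsFrame ν Φ) (p : ℝ) :
    Isometry fun z : EuclideanSpace ℝ (Fin k) ↦ Φ (p, z) := by
  refine Isometry.of_dist_eq fun z z' ↦ ?_
  rw [dist_eq_norm, dist_eq_norm, ← map_sub, ← sq_eq_sq₀ (norm_nonneg _) (norm_nonneg _),
    h.norm_sq]
  simp

/-- Integration over all of space along the lines in the direction `u`, starting from the
hyperplane at height `p`. -/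
theorem lintegral_eq (h : IsFrame ν Φ) {u : EuclideanSpace ℝ (Fin (k + 1))} (hu : ⟪ν, u⟫ ≠ 0)
    (p : ℝ) {g : EuclideanSpace ℝ (Fin (k + 1)) → ENNReal} (hg : Measurable g) :
    ∫⁻ x, g x = ENNReal.ofReal |⟪ν, u⟫| * ∫⁻ z, ∫⁻ s : ℝ, g (Φ (p, z) + s • u) := by
  obtain ⟨z₀, hz₀⟩ := h.exists_eq u
  set c := ⟪ν, u⟫ with hc
  have hΦ : Measurable Φ := Φ.continuous.measurable
  have e1 : ∀ (z : EuclideanSpace ℝ (Fin k)) (s : ℝ),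
      Φ (p, z) + s • u = Φ (p + c * s, z + s • z₀) := by
    intro z s
    rw [hz₀, ← map_smul, ← map_add]
    congr 1
    simp [mul_comm]
  have hm : Measurable fun q : EuclideanSpace ℝ (Fin k) × ℝ ↦ g (Φ (p + c * q.2, q.1 + q.2 • z₀)) := by
    fun_prop
  have hm' : Measurable fun q : EuclideanSpace ℝ (Fin k) × ℝ ↦ g (Φ (p + c * q.2, q.1)) := by
    fun_prop
  simp_rw [e1]
  -- For fixed `s`, moving along `u` only translates `z` by `s • z₀`, so translation invariance
  -- removes the shear. What remains is the substitution of `p + c * s` for the height, with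
  -- Jacobian `|c|`.
  rw [lintegral_lintegral_swap hm.aemeasurable]
  have e2 : ∀ s : ℝ, ∫⁻ z, g (Φ (p + c * s, z + s • z₀)) = ∫⁻ z, g (Φ (p + c * s, z)) := fun s ↦
    lintegral_add_right_eq_self (fun z ↦ g (Φ (p + c * s, z))) (s • z₀)
  simp_rw [e2]
  have hF : Measurable fun s : ℝ ↦ ∫⁻ z, g (Φ (s, z)) := by
    apply Measurable.lintegral_prod_right'
      (f := fun q : ℝ × EuclideanSpace ℝ (Fin k) ↦ g (Φ (q.1, q.2)))
    fun_prop
  rw [← h.measurePreserving.lintegral_comp hg, lintegral_prod _ (by fun_prop)]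
  have h2 : ∫⁻ s : ℝ, ∫⁻ z, g (Φ (p + c * s, z)) = ENNReal.ofReal |c⁻¹| * ∫⁻ s : ℝ, ∫⁻ z, g (Φ (s, z)) := by
    have hF' : Measurable fun s : ℝ ↦ ∫⁻ z, g (Φ (p + s, z)) :=
      hF.comp (measurable_const_add p)
    have := lintegral_map (μ := volume) hF' (measurable_const_mul c)
    rw [← this, Real.map_volume_mul_left hu, lintegral_smul_measure,
      lintegral_add_left_eq_self (fun s ↦ ∫⁻ z, g (Φ (s, z))) p, smul_eq_mul]
  rw [h2, ← mul_assoc, ← ENNReal.ofReal_mul (abs_nonneg _), ← abs_mul, mul_inv_cancel₀ hu, abs_one,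
    ENNReal.ofReal_one, one_mul]

/-- Lines in a direction transversal to a hyperplane through a null set of it form a null set. -/
theorem ae_of_ae (h : IsFrame ν Φ) {u : EuclideanSpace ℝ (Fin (k + 1))} (hu : ⟪ν, u⟫ ≠ 0)
    (p : ℝ) {N : Set (EuclideanSpace ℝ (Fin k))} (hN : volume N = 0) :
    ∀ᵐ x, ∀ z, ∀ s : ℝ, x = Φ (p, z) + s • u → z ∉ N := by
  obtain ⟨M, hNM, hM, hM0⟩ := exists_measurable_superset_of_null hN
  -- The projection along `u` onto the hyperplane at height `p`, read in the coordinate `z`. It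
  -- remains to see that the preimage of a null set is null.
  let pr : EuclideanSpace ℝ (Fin (k + 1)) → EuclideanSpace ℝ (Fin k) := fun x ↦
    (Φ.symm (x - ((⟪ν, x⟫ - p) / ⟪ν, u⟫) • u)).2
  have hpr : Measurable pr := by fun_prop
  have key : ∀ z, ∀ s : ℝ, pr (Φ (p, z) + s • u) = z := by
    intro z s
    simp only [pr, inner_add_right, h.inner_left, inner_smul_right]
    rw [add_sub_cancel_left, mul_div_cancel_right₀ _ hu, add_sub_cancel_right, Φ.symm_apply_apply]
  have h0 : volume (pr ⁻¹' M) = 0 := by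
    rw [← lintegral_indicator_one (hpr hM), h.lintegral_eq hu p (measurable_one.indicator (hpr hM))]
    change _ * ∫⁻ z, ∫⁻ s : ℝ, (pr ⁻¹' M).indicator (fun _ ↦ (1 : ENNReal)) (Φ (p, z) + s • u) = 0
    have : ∀ z, ∫⁻ s : ℝ, (pr ⁻¹' M).indicator (fun _ ↦ (1 : ENNReal)) (Φ (p, z) + s • u) =
        M.indicator (fun _ ↦ ∫⁻ _ : ℝ, 1) z := by
      intro z
      by_cases hz : z ∈ M
      · rw [Set.indicator_of_mem hz]
        refine lintegral_congr fun s ↦ ?_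
        rw [Set.indicator_of_mem (by rw [Set.mem_preimage, key]; exact hz)]
      · rw [Set.indicator_of_notMem hz, ← lintegral_zero]
        refine lintegral_congr fun s ↦ ?_
        rw [Set.indicator_of_notMem (by rw [Set.mem_preimage, key]; exact hz)]
    simp_rw [this]
    rw [lintegral_indicator hM, Measure.restrict_eq_zero.2 hM0, lintegral_zero_measure, mul_zero]
  filter_upwards [measure_eq_zero_iff_ae_notMem.1 h0] with x hx z s hxz hz
  exact hx (by rw [Set.mem_preimage, hxz, key]; exact hNM hz)

end IsFrame

end Frame

/-! ### The hemisphere integral by Gaussian integration. -/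

section Hemisphere

theorem lintegral_exp_neg_norm_sq {V : Type*} [NormedAddCommGroup V] [InnerProductSpace ℝ V]
    [FiniteDimensional ℝ V] [MeasurableSpace V] [BorelSpace V] :
    ∫⁻ v : V, ENNReal.ofReal (Real.exp (-‖v‖ ^ 2)) =
      ENNReal.ofReal (Real.pi ^ ((Module.finrank ℝ V : ℝ) / 2)) := by
  have h := GaussianFourier.integral_rexp_neg_mul_sq_norm (V := V) (b := 1) one_pos
  simp only [div_one, neg_mul, one_mul] at h
  rw [← h, ofReal_integral_eq_lintegral_ofReal _ (Filter.Eventually.of_forall fun _ ↦ Real.exp_nonneg _)]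
  -- A non-integrable function has Bochner integral 0, so the positive value already known proves
  -- integrability.
  by_contra hi
  rw [integral_undef hi] at h
  exact (Real.rpow_pos_of_pos Real.pi_pos _).ne h

theorem lintegral_Ioi_pow_mul_exp_neg_sq (m : ℕ) :
    ∫⁻ r in Set.Ioi (0 : ℝ), ENNReal.ofReal (r ^ m * Real.exp (-r ^ 2)) =
      ENNReal.ofReal (1 / 2 * Real.Gamma ((m + 1) / 2)) := by
  have h := integral_rpow_mul_exp_neg_mul_rpow (p := 2) (q := m) (b := 1) two_pos
    (by have : (0 : ℝ) ≤ m := Nat.cast_nonneg m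
        linarith) one_pos
  simp only [Real.rpow_natCast, Real.rpow_two, neg_mul, one_mul, Real.one_rpow] at h
  rw [← h, ofReal_integral_eq_lintegral_ofReal]
  · by_contra hi
    rw [integral_undef hi] at h
    have : 0 < Real.Gamma (((m : ℝ) + 1) / 2) := Real.Gamma_pos_of_pos (by positivity)
    linarith
  · filter_upwards [ae_restrict_mem measurableSet_Ioi] with r hr
    have : 0 < r := hr
    simp only [Pi.zero_apply]
    positivity

theorem volume_unitBall_euclideanSpace (k : ℕ) :
    volume (Metric.ball (0 : EuclideanSpace ℝ (Fin k)) 1) =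
      ENNReal.ofReal (√Real.pi ^ k / Real.Gamma (k / 2 + 1)) := by
  rcases k with _ | k
  · have : Metric.ball (0 : EuclideanSpace ℝ (Fin 0)) 1 = Set.univ := by
      ext x
      simp [Subsingleton.elim x 0]
    rw [this, volume_euclideanSpace_eq_dirac]
    simp
  · simp [EuclideanSpace.volume_ball]

/-- The integral of the positive part of a coordinate over the unit sphere. -/
theorem lintegral_sphere_inner {k : ℕ} {e : EuclideanSpace ℝ (Fin (k + 1))} (he : ‖e‖ = 1) :
    ∫⁻ w : Metric.sphere (0 : EuclideanSpace ℝ (Fin (k + 1))) 1,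
        ENNReal.ofReal ⟪e, (w : EuclideanSpace ℝ (Fin (k + 1)))⟫
          ∂(volume : Measure (EuclideanSpace ℝ (Fin (k + 1)))).toSphere =
      volume (Metric.ball (0 : EuclideanSpace ℝ (Fin k)) 1) := by
  obtain ⟨Φ, hΦ⟩ := exists_isFrame he
  have hee : ⟪e, e⟫ = 1 := by rw [real_inner_self_eq_norm_sq, he, one_pow]
  -- The Gaussian integral of `⟪e, v⟫₊ exp(-‖v‖²)` is computed twice. Polar coordinates give `c_n ·
  -- Γ(k/2 + 1) / 2`; splitting off the axis `e` gives `π^(k/2) / 2`.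
  have hG : Measurable fun v : EuclideanSpace ℝ (Fin (k + 1)) ↦
      ENNReal.ofReal ⟪e, v⟫ * ENNReal.ofReal (Real.exp (-‖v‖ ^ 2)) := by fun_prop
  have hpos : (0 : ℝ) < Real.Gamma (((k + 1 : ℕ) + 1) / 2) := Real.Gamma_pos_of_pos (by positivity)
  have h1 := lintegral_eq_lintegral_sphere_Ioi hG
  have h2 := hΦ.lintegral_eq (u := e) (by rw [hee]; exact one_ne_zero) 0 hG
  have hin : ∀ w : Metric.sphere (0 : EuclideanSpace ℝ (Fin (k + 1))) 1,
      ∫⁻ r in Set.Ioi (0 : ℝ), ENNReal.ofReal (r ^ (Module.finrank ℝ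
        (EuclideanSpace ℝ (Fin (k + 1))) - 1)) * (ENNReal.ofReal ⟪e, r • w.1⟫ *
          ENNReal.ofReal (Real.exp (-‖r • w.1‖ ^ 2))) =
      ENNReal.ofReal ⟪e, w.1⟫ * ENNReal.ofReal (1 / 2 * Real.Gamma (((k + 1 : ℕ) + 1) / 2)) := by
    intro w
    rw [← lintegral_Ioi_pow_mul_exp_neg_sq, ← lintegral_const_mul _ (by fun_prop)]
    refine setLIntegral_congr_fun measurableSet_Ioi fun r hr ↦ ?_
    have hr : 0 < r := hr
    simp only [finrank_euclideanSpace, Fintype.card_fin, Nat.add_sub_cancel, inner_smul_right,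
      norm_smul, norm_eq_of_mem_sphere w, mul_one, Real.norm_of_nonneg hr.le]
    rw [ENNReal.ofReal_mul hr.le, pow_succ r k, mul_assoc (r ^ k) r, ENNReal.ofReal_mul (p := r ^ k)
      (by positivity), ENNReal.ofReal_mul (p := r) (by positivity)]
    ring
  have hout : ∀ z : EuclideanSpace ℝ (Fin k), ∫⁻ s : ℝ, ENNReal.ofReal ⟪e, Φ (0, z) + s • e⟫ *
      ENNReal.ofReal (Real.exp (-‖Φ (0, z) + s • e‖ ^ 2)) =
      ENNReal.ofReal (Real.exp (-‖z‖ ^ 2)) * ENNReal.ofReal (1 / 2) := by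
    intro z
    have hs : ∀ s : ℝ, Φ (0, z) + s • e = Φ (s, z) := by
      intro s
      rw [← hΦ.map_one_zero, ← map_smul, ← map_add]
      simp
    have h3 : ∫⁻ s : ℝ, ENNReal.ofReal (s * Real.exp (-s ^ 2)) = ENNReal.ofReal (1 / 2) := by
      have h4 := lintegral_Ioi_pow_mul_exp_neg_sq 1
      simp only [pow_one, Nat.cast_one, one_add_one_eq_two, div_self (two_ne_zero' ℝ),
        Real.Gamma_one, mul_one] at h4
      rw [← h4, ← lintegral_indicator measurableSet_Ioi]
      refine lintegral_congr fun s ↦ ?_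
      by_cases hs : 0 < s
      · rw [Set.indicator_of_mem (Set.mem_Ioi.2 hs)]
      · rw [Set.indicator_of_notMem (by simpa using hs), ENNReal.ofReal_eq_zero]
        exact mul_nonpos_of_nonpos_of_nonneg (not_lt.1 hs) (Real.exp_nonneg _)
    rw [← h3, ← lintegral_const_mul _ (by fun_prop)]
    refine lintegral_congr fun s ↦ ?_
    rw [hs, hΦ.inner_left, hΦ.norm_sq, neg_add, Real.exp_add,
      ENNReal.ofReal_mul (Real.exp_nonneg _), ENNReal.ofReal_mul' (Real.exp_nonneg _)]
    ring
  simp_rw [hin] at h1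
  simp_rw [hout] at h2
  rw [h1, lintegral_mul_const _ (by fun_prop), lintegral_mul_const _ (by fun_prop),
    lintegral_exp_neg_norm_sq, hee, abs_one, ENNReal.ofReal_one, one_mul,
    ← ENNReal.ofReal_mul (by positivity), finrank_euclideanSpace, Fintype.card_fin] at h2
  rw [volume_unitBall_euclideanSpace,
    ← ENNReal.mul_left_inj (c := ENNReal.ofReal (1 / 2 * Real.Gamma (((k + 1 : ℕ) + 1) / 2)))
      (by positivity) ENNReal.ofReal_ne_top, h2, ← ENNReal.ofReal_mul (by positivity)]
  congr 1
  rw [Real.sqrt_eq_rpow, ← Real.rpow_natCast, ← Real.rpow_mul Real.pi_pos.le,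
    show ((k : ℝ) / 2 + 1) = ((k + 1 : ℕ) + 1) / 2 by push_cast; ring]
  field_simp

end Hemisphere

/-! ### Hausdorff measure under conformal maps. -/

section Conformal

theorem LipschitzOnWith.euclideanHausdorffMeasure_image_le {X Y : Type*} [MetricSpace X]
    [MeasurableSpace X] [BorelSpace X] [MetricSpace Y] [MeasurableSpace Y] [BorelSpace Y]
    {f : X → Y} {K : NNReal} {s : Set X} (h : LipschitzOnWith K f s) (k : ℕ) :
    μHE[k] (f '' s) ≤ (K : ENNReal) ^ k * μHE[k] s := by
  have := h.hausdorffMeasure_image_le (d := (k : ℝ)) k.cast_nonneg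
  rw [ENNReal.rpow_natCast] at this
  rw [Measure.euclideanHausdorffMeasure_def, Measure.euclideanHausdorffMeasure_def,
    Measure.smul_apply, Measure.smul_apply, ENNReal.smul_def, ENNReal.smul_def, smul_eq_mul,
    smul_eq_mul, mul_left_comm]
  gcongr

/-- On a piece where `lX` is at least `a` and `lY ∘ f` at most `θ b`, the Lipschitz constant `θ a /
b` compares the two weighted measures. Each dimension loses one factor `θ` from the density and one
from the distances, hence `θ ^ (2 * k)`. -/
theorem setLIntegral_image_le_of_dist_le {X Y : Type*} [MetricSpace X]
    [MeasurableSpace X] [BorelSpace X] [MetricSpace Y] [MeasurableSpace Y] [BorelSpace Y]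
    {f : X → Y} {B : Set X} (hB : MeasurableSet B) (hfB : MeasurableSet (f '' B)) (k : ℕ)
    {lX : X → ℝ} {lY : Y → ℝ} {a b θ : ℝ} (ha : 0 < a) (hb : 0 < b) (hθ : 0 < θ)
    (hdist : ∀ z ∈ B, ∀ z' ∈ B, dist (f z) (f z') ≤ θ * a / b * dist z z')
    (hX : ∀ z ∈ B, a ≤ lX z) (hY : ∀ z ∈ B, lY (f z) ≤ θ * b) :
    ∫⁻ y in f '' B, ENNReal.ofReal (lY y) ^ k ∂μHE[k] ≤
      ENNReal.ofReal θ ^ (2 * k) * ∫⁻ z in B, ENNReal.ofReal (lX z) ^ k ∂μHE[k] := by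
  have hlip : LipschitzOnWith (Real.toNNReal (θ * a / b)) f B := by
    refine LipschitzOnWith.of_dist_le_mul fun z hz z' hz' ↦ ?_
    rw [Real.coe_toNNReal _ (by positivity)]
    exact hdist z hz z' hz'
  calc ∫⁻ y in f '' B, ENNReal.ofReal (lY y) ^ k ∂μHE[k]
      ≤ ∫⁻ _ in f '' B, ENNReal.ofReal (θ * b) ^ k ∂μHE[k] := by
        refine setLIntegral_mono' hfB ?_
        rintro _ ⟨z, hz, rfl⟩
        gcongr
        exact hY z hz
    _ = ENNReal.ofReal (θ * b) ^ k * μHE[k] (f '' B) := setLIntegral_const _ _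
    _ ≤ ENNReal.ofReal (θ * b) ^ k * (ENNReal.ofReal (θ * a / b) ^ k * μHE[k] B) := by
        gcongr
        exact hlip.euclideanHausdorffMeasure_image_le k
    _ = ENNReal.ofReal θ ^ (2 * k) * (ENNReal.ofReal a ^ k * μHE[k] B) := by
        rw [← mul_assoc, ← mul_assoc, ← mul_pow, pow_mul, ← mul_pow,
          ← ENNReal.ofReal_mul (by positivity), ← ENNReal.ofReal_pow hθ.le 2,
          ← ENNReal.ofReal_mul (by positivity)]
        congr 3
        field_simp
    _ = ENNReal.ofReal θ ^ (2 * k) * ∫⁻ _ in B, ENNReal.ofReal a ^ k ∂μHE[k] := by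
        rw [setLIntegral_const]
    _ ≤ _ := by
        refine mul_le_mul_right (setLIntegral_mono' hB fun z hz ↦ ?_) _
        gcongr
        exact hX z hz

/-- Change of variables for the Hausdorff measure under a map which is conformal for the metrics
`lX² |dz|²` and `lY² |dy|²`, in the strong sense satisfied by Möbius maps. -/
theorem setLIntegral_image_of_conformal {X Y : Type*} [MetricSpace X]
    [MeasurableSpace X] [BorelSpace X] [PolishSpace X] [MetricSpace Y] [MeasurableSpace Y]
    [BorelSpace Y] {f : X → Y} (hf : Continuous f) {A : Set X} (hA : MeasurableSet A) (k : ℕ)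
    {lX : X → ℝ} {lY : Y → ℝ} (hlX : Measurable lX) (hlY : Measurable lY)
    (hX : ∀ z ∈ A, 0 < lX z) (hY : ∀ z ∈ A, 0 < lY (f z))
    (hdist : ∀ z ∈ A, ∀ z' ∈ A,
      dist (f z) (f z') ^ 2 * (lY (f z) * lY (f z')) = dist z z' ^ 2 * (lX z * lX z')) :
    ∫⁻ y in f '' A, ENNReal.ofReal (lY y) ^ k ∂μHE[k] =
      ∫⁻ z in A, ENNReal.ofReal (lX z) ^ k ∂μHE[k] := by
  have hinj : Set.InjOn f A := by
    intro z hz z' hz' hzz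
    have := hdist z hz z' hz'
    rw [hzz, dist_self] at this
    have h2 : dist z z' ^ 2 = 0 := by
      have := mul_pos (hX z hz) (hX z' hz')
      by_contra h3
      have : dist z z' ^ 2 * (lX z * lX z') ≠ 0 := mul_ne_zero h3 this.ne'
      simp_all
    exact dist_eq_zero.1 (pow_eq_zero_iff two_ne_zero |>.1 h2)
  have main : ∀ θ : ℝ, 1 < θ →
      ∫⁻ y in f '' A, ENNReal.ofReal (lY y) ^ k ∂μHE[k] ≤
        ENNReal.ofReal θ ^ (2 * k) * ∫⁻ z in A, ENNReal.ofReal (lX z) ^ k ∂μHE[k] ∧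
      ∫⁻ z in A, ENNReal.ofReal (lX z) ^ k ∂μHE[k] ≤
        ENNReal.ofReal θ ^ (2 * k) * ∫⁻ y in f '' A, ENNReal.ofReal (lY y) ^ k ∂μHE[k] := by
    intro θ hθ
    have hθ0 : 0 < θ := one_pos.trans hθ
    -- Cut `A` into countably many pieces on each of which both densities vary by a factor less than
    -- `θ`. There the distance identity makes `f` and its inverse Lipschitz with nearly optimal
    -- constants.
    let B : ℤ × ℤ → Set X := fun p ↦ A ∩ (lX ⁻¹' Set.Ico (θ ^ p.1) (θ ^ (p.1 + 1)) ∩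
      (lY ∘ f) ⁻¹' Set.Ico (θ ^ p.2) (θ ^ (p.2 + 1)))
    have hBm : ∀ p, MeasurableSet (B p) := fun p ↦
      hA.inter ((hlX measurableSet_Ico).inter ((hlY.comp hf.measurable) measurableSet_Ico))
    have hBA : ∀ p, B p ⊆ A := fun p ↦ Set.inter_subset_left
    have hfBm : ∀ p, MeasurableSet (f '' B p) := fun p ↦
      (hBm p).image_of_continuousOn_injOn hf.continuousOn (hinj.mono (hBA p))
    have hdisj : Pairwise (Function.onFun Disjoint B) := by
      intro p q hpq
      refine Set.disjoint_left.2 fun z hp hq ↦ hpq ?_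
      have huniq : ∀ (x : ℝ) (i j : ℤ), x ∈ Set.Ico (θ ^ i) (θ ^ (i + 1)) →
          x ∈ Set.Ico (θ ^ j) (θ ^ (j + 1)) → i = j := by
        intro x i j hi hj
        have h1 := (zpow_lt_zpow_iff_right₀ hθ).1 (hi.1.trans_lt hj.2)
        have h2 := (zpow_lt_zpow_iff_right₀ hθ).1 (hj.1.trans_lt hi.2)
        omega
      exact Prod.ext (huniq _ _ _ hp.2.1 hq.2.1) (huniq _ _ _ hp.2.2 hq.2.2)
    have hfdisj : Pairwise (Function.onFun Disjoint fun p ↦ f '' B p) := by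
      intro p q hpq
      exact Set.disjoint_image_image fun z hz z' hz' hzz ↦
        Set.disjoint_left.1 (hdisj hpq) hz (hinj (hBA p hz) (hBA q hz') hzz ▸ hz')
    have hU : A = ⋃ p, B p := by
      refine Set.Subset.antisymm (fun z hz ↦ ?_) (Set.iUnion_subset hBA)
      obtain ⟨i, hi⟩ := exists_mem_Ico_zpow (hX z hz) hθ
      obtain ⟨j, hj⟩ := exists_mem_Ico_zpow (hY z hz) hθ
      exact Set.mem_iUnion.2 ⟨(i, j), hz, hi, hj⟩
    have e1 : ∫⁻ y in f '' A, ENNReal.ofReal (lY y) ^ k ∂μHE[k] =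
        ∑' p, ∫⁻ y in f '' B p, ENNReal.ofReal (lY y) ^ k ∂μHE[k] := by
      rw [← lintegral_iUnion hfBm hfdisj, ← Set.image_iUnion, ← hU]
    have e2 : ∫⁻ z in A, ENNReal.ofReal (lX z) ^ k ∂μHE[k] =
        ∑' p, ∫⁻ z in B p, ENNReal.ofReal (lX z) ^ k ∂μHE[k] := by
      rw [← lintegral_iUnion hBm hdisj, ← hU]
    have hd : ∀ p, ∀ z ∈ B p, ∀ z' ∈ B p,
        dist (f z) (f z') ≤ θ * θ ^ p.1 / θ ^ p.2 * dist z z' ∧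
        dist z z' ≤ θ * θ ^ p.2 / θ ^ p.1 * dist (f z) (f z') := by
      intro p z hz z' hz'
      have ha : 0 < θ ^ p.1 := zpow_pos hθ0 _
      have hb : 0 < θ ^ p.2 := zpow_pos hθ0 _
      have hkey := hdist z (hBA p hz) z' (hBA p hz')
      have hz1 := hz.2.1
      have hz2 := hz.2.2
      have hz1' := hz'.2.1
      have hz2' := hz'.2.2
      simp only [Set.mem_preimage, Set.mem_Ico, Function.comp_apply, zpow_add_one₀ hθ0.ne']
        at hz1 hz2 hz1' hz2'
      generalize θ ^ p.1 = a at *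
      generalize θ ^ p.2 = b at *
      have m1 : a * a ≤ lX z * lX z' := mul_le_mul hz1.1 hz1'.1 ha.le (ha.le.trans hz1.1)
      have m2 : b * b ≤ lY (f z) * lY (f z') := mul_le_mul hz2.1 hz2'.1 hb.le (hb.le.trans hz2.1)
      have m3 : lX z * lX z' ≤ (a * θ) * (a * θ) :=
        mul_le_mul hz1.2.le hz1'.2.le (ha.le.trans hz1'.1) (by positivity)
      have m4 : lY (f z) * lY (f z') ≤ (b * θ) * (b * θ) :=
        mul_le_mul hz2.2.le hz2'.2.le (hb.le.trans hz2'.1) (by positivity)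
      constructor
      · rw [div_mul_eq_mul_div, le_div_iff₀ hb]
        refine (sq_le_sq₀ (by positivity) (by positivity)).1 ?_
        calc (dist (f z) (f z') * b) ^ 2 = dist (f z) (f z') ^ 2 * (b * b) := by ring
          _ ≤ dist (f z) (f z') ^ 2 * (lY (f z) * lY (f z')) := by gcongr
          _ = dist z z' ^ 2 * (lX z * lX z') := hkey
          _ ≤ dist z z' ^ 2 * ((a * θ) * (a * θ)) := by gcongr
          _ = _ := by ring
      · rw [div_mul_eq_mul_div, le_div_iff₀ ha]
        refine (sq_le_sq₀ (by positivity) (by positivity)).1 ?_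
        calc (dist z z' * a) ^ 2 = dist z z' ^ 2 * (a * a) := by ring
          _ ≤ dist z z' ^ 2 * (lX z * lX z') := by gcongr
          _ = dist (f z) (f z') ^ 2 * (lY (f z) * lY (f z')) := hkey.symm
          _ ≤ dist (f z) (f z') ^ 2 * ((b * θ) * (b * θ)) := by gcongr
          _ = _ := by ring
    rw [e1, e2, ← ENNReal.tsum_mul_left, ← ENNReal.tsum_mul_left]
    refine ⟨ENNReal.tsum_le_tsum fun p ↦ ?_, ENNReal.tsum_le_tsum fun p ↦ ?_⟩
    · refine setLIntegral_image_le_of_dist_le (hBm p) (hfBm p) k (zpow_pos hθ0 p.1)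
        (zpow_pos hθ0 p.2) hθ0 (fun z hz z' hz' ↦ (hd p z hz z' hz').1) (fun z hz ↦ hz.2.1.1)
        (fun z hz ↦ ?_)
      rw [mul_comm, ← zpow_add_one₀ hθ0.ne']
      exact hz.2.2.2.le
    -- The reverse bound is the same estimate for the inverse of `f` on the piece. Choosing that
    -- inverse needs a point of `X`; without one, the piece is empty.
    · by_cases hne : Nonempty X
      swap
      · have : B p = ∅ := Set.eq_empty_of_forall_notMem fun z _ ↦ hne ⟨z⟩
        simp [this]
      have hinv : Set.LeftInvOn (Function.invFunOn f (B p)) f (B p) :=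
        (hinj.mono (hBA p)).leftInvOn_invFunOn
      have himg : Function.invFunOn f (B p) '' (f '' B p) = B p := hinv.image_image
      conv_lhs => rw [← himg]
      refine setLIntegral_image_le_of_dist_le (hfBm p) (by rw [himg]; exact hBm p) k
        (zpow_pos hθ0 p.2) (zpow_pos hθ0 p.1) hθ0 ?_ ?_ ?_
      · rintro _ ⟨z, hz, rfl⟩ _ ⟨z', hz', rfl⟩
        rw [hinv hz, hinv hz']
        exact (hd p z hz z' hz').2
      · rintro _ ⟨z, hz, rfl⟩
        exact hz.2.2.1
      · rintro _ ⟨z, hz, rfl⟩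
        rw [hinv hz, mul_comm, ← zpow_add_one₀ hθ0.ne']
        exact hz.2.1.2.le
  -- Letting `θ` decrease to 1 turns the two bounds into an equality.
  have hlim : ∀ a b : ENNReal, (∀ θ : ℝ, 1 < θ → a ≤ ENNReal.ofReal θ ^ (2 * k) * b) → a ≤ b := by
    intro a b hab
    have ht : Filter.Tendsto (fun θ : ℝ ↦ ENNReal.ofReal θ ^ (2 * k) * b) (nhdsWithin 1 (Set.Ioi 1))
        (nhds (ENNReal.ofReal 1 ^ (2 * k) * b)) := by
      refine ENNReal.Tendsto.mul_const ?_ (Or.inl (by simp))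
      exact (((ENNReal.continuous_pow _).comp ENNReal.continuous_ofReal).tendsto 1).mono_left
        nhdsWithin_le_nhds
    rw [ENNReal.ofReal_one, one_pow, one_mul] at ht
    exact ge_of_tendsto ht (by filter_upwards [self_mem_nhdsWithin] with θ hθ using hab θ hθ)
  exact le_antisymm (hlim _ _ fun θ hθ ↦ (main θ hθ).1) (hlim _ _ fun θ hθ ↦ (main θ hθ).2)

end Conformal

/-! ### Euclidean polytopes: interior, facets and generic points of hyperplanes. -/

section Polytope

variable {k : ℕ}

/-- `P` is the compact full-dimensional polytope cut out by the inequalities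
`0 ≤ a i + ⟪b i, x⟫`. -/
structure IsPolytope {ι : Type*} (P : Set (EuclideanSpace ℝ (Fin (k + 1)))) (a : ι → ℝ)
    (b : ι → EuclideanSpace ℝ (Fin (k + 1))) : Prop where
  isCompact : IsCompact P
  nonempty_interior : (interior P).Nonempty
  ne_zero : ∀ i, b i ≠ 0
  mem_iff : ∀ x, x ∈ P ↔ ∀ i, 0 ≤ a i + ⟪b i, x⟫

/-- `F` is the facet of `P` lying on the supporting hyperplane `⟪ν, x⟫ = p`, where `ν` is a unit
vector pointing to the side of `P`. -/
structure IsFacetOn (P F : Set (EuclideanSpace ℝ (Fin (k + 1))))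
    (ν : EuclideanSpace ℝ (Fin (k + 1))) (p : ℝ) : Prop where
  norm_eq_one : ‖ν‖ = 1
  le_inner : ∀ x ∈ P, p ≤ ⟪ν, x⟫
  mem_iff : ∀ x, x ∈ F ↔ x ∈ P ∧ ⟪ν, x⟫ = p
  exists_isOpen : ∃ U : Set (EuclideanSpace ℝ (Fin (k + 1))), IsOpen U ∧ (U ∩ F).Nonempty ∧
    ∀ x ∈ U, ⟪ν, x⟫ = p → x ∈ F

theorem exists_isFacetOn {P F : Set (EuclideanSpace ℝ (Fin (k + 1)))}
    (hF : F ∈ ModelGeometry.euclidean.facets P) : ∃ ν p, IsFacetOn P F ν p := by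
  obtain ⟨a, b, hb, hP, rfl, U, hU, hUF, hUm⟩ := hF
  have hb : b ≠ 0 := hb
  have hn : 0 < ‖b‖ := norm_pos_iff.2 hb
  have key : ∀ x, a + ⟪b, x⟫ = ‖b‖ * (⟪‖b‖⁻¹ • b, x⟫ - -a / ‖b‖) := by
    intro x
    rw [real_inner_smul_left]
    field_simp
    ring
  have key0 : ∀ x, ModelGeometry.euclidean.wallFun a b x = 0 ↔ ⟪‖b‖⁻¹ • b, x⟫ = -a / ‖b‖ := by
    intro x
    change a + ⟪b, x⟫ = 0 ↔ _
    rw [key, mul_eq_zero, sub_eq_zero]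
    simp [hn.ne']
  refine ⟨‖b‖⁻¹ • b, -a / ‖b‖, ?_, fun x hx ↦ ?_, fun x ↦ ?_, U, hU, hUF, fun x hx h ↦ ?_⟩
  · rw [norm_smul, norm_inv, norm_norm, inv_mul_cancel₀ hn.ne']
  · have := hP x hx
    change 0 ≤ a + ⟪b, x⟫ at this
    rw [key] at this
    exact sub_nonneg.1 (nonneg_of_mul_nonneg_right this hn)
  · rw [← key0 x]
    rfl
  · exact hUm x hx ((key0 x).2 h)

namespace IsFrame

variable {ν : EuclideanSpace ℝ (Fin (k + 1))}
  {Φ : (ℝ × EuclideanSpace ℝ (Fin k)) ≃L[ℝ] EuclideanSpace ℝ (Fin (k + 1))}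

/-- An affine function vanishing on a hyperplane is proportional to its equation. -/
theorem exists_eq_mul (h : IsFrame ν Φ) {p c : ℝ} {d : EuclideanSpace ℝ (Fin (k + 1))}
    (hd : d ≠ 0) (h0 : ∀ z, c + ⟪d, Φ (p, z)⟫ = 0) :
    ∃ t, t ≠ 0 ∧ ∀ x, c + ⟪d, x⟫ = t * (⟪ν, x⟫ - p) := by
  have key : ∀ x, c + ⟪d, x⟫ = ⟪d, ν⟫ * (⟪ν, x⟫ - p) := by
    intro x
    obtain ⟨z, hz⟩ := h.exists_eq x
    have : x = Φ (p, z) + (⟪ν, x⟫ - p) • ν := by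
      rw [← h.map_one_zero, ← map_smul, ← map_add, h.map_one_zero]
      conv_lhs => rw [hz]
      simp
    conv_lhs => rw [this]
    rw [inner_add_right, inner_smul_right, ← add_assoc, h0]
    ring
  refine ⟨⟪d, ν⟫, fun ht ↦ hd ?_, key⟩
  have h1 := key d
  have h2 := key 0
  rw [ht] at h1 h2
  simp only [inner_zero_right, zero_mul, add_zero] at h1 h2
  rw [h2, zero_add] at h1
  exact inner_self_eq_zero.1 h1

/-- The zero set is an affine subspace of the parameter space, proper by hypothesis, hence null. -/
theorem volume_affine_eq_zero {p c : ℝ} {d : EuclideanSpace ℝ (Fin (k + 1))}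
    (h0 : ¬ ∀ z, c + ⟪d, Φ (p, z)⟫ = 0) :
    volume {z | c + ⟪d, Φ (p, z)⟫ = 0} = 0 := by
  let S : AffineSubspace ℝ (EuclideanSpace ℝ (Fin k)) :=
    { carrier := {z | c + ⟪d, Φ (p, z)⟫ = 0}
      smul_vsub_vadd_mem' := by
        intro r z₁ z₂ z₃ h₁ h₂ h₃
        simp only [Set.mem_ofPred_eq, vsub_eq_sub, vadd_eq_add] at *
        have : Φ (p, r • (z₁ - z₂) + z₃) = r • (Φ (p, z₁) - Φ (p, z₂)) + Φ (p, z₃) := by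
          rw [← map_sub, ← map_smul, ← map_add]
          simp
        rw [this, inner_add_right, inner_smul_right, inner_sub_right]
        linear_combination r * (h₁ - h₂) + h₃ }
  refine Measure.addHaar_affineSubspace volume S fun hS ↦ h0 fun z ↦ ?_
  have : z ∈ S := hS ▸ AffineSubspace.mem_top ℝ _ z
  exact this

/-- This is the notion of generic point of a hyperplane: a wall either contains the whole
hyperplane, and then its equation is proportional, or cuts it in a null set. -/
theorem ae_ne_zero_or (h : IsFrame ν Φ) (p : ℝ) {ι : Type*} [Countable ι] {a : ι → ℝ}
    {b : ι → EuclideanSpace ℝ (Fin (k + 1))} (hb : ∀ i, b i ≠ 0) :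
    ∀ᵐ z, ∀ i, a i + ⟪b i, Φ (p, z)⟫ ≠ 0 ∨
      ∃ t, t ≠ 0 ∧ ∀ x, a i + ⟪b i, x⟫ = t * (⟪ν, x⟫ - p) := by
  refine ae_all_iff.2 fun i ↦ ?_
  by_cases h0 : ∀ z, a i + ⟪b i, Φ (p, z)⟫ = 0
  · exact Filter.Eventually.of_forall fun z ↦ Or.inr (h.exists_eq_mul (hb i) h0)
  · filter_upwards [measure_eq_zero_iff_ae_notMem.1 (volume_affine_eq_zero h0)] with z hz
    exact Or.inl hz

end IsFrame

namespace IsPolytope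

variable {ι : Type*} {P F F' : Set (EuclideanSpace ℝ (Fin (k + 1)))} {a : ι → ℝ}
  {b : ι → EuclideanSpace ℝ (Fin (k + 1))} {ν ν' : EuclideanSpace ℝ (Fin (k + 1))} {p p' : ℝ}
  {Φ : (ℝ × EuclideanSpace ℝ (Fin k)) ≃L[ℝ] EuclideanSpace ℝ (Fin (k + 1))}

theorem mem_interior_of_forall_pos [Finite ι] (h : IsPolytope P a b) {x : EuclideanSpace ℝ (Fin (k + 1))}
    (hx : ∀ i, 0 < a i + ⟪b i, x⟫) : x ∈ interior P := by
  have ho : IsOpen {x | ∀ i, 0 < a i + ⟪b i, x⟫} := by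
    rw [Set.ofPred_forall]
    exact isOpen_iInter_of_finite fun i ↦ isOpen_lt continuous_const (by fun_prop)
  exact interior_maximal (fun y hy ↦ (h.mem_iff y).2 fun i ↦ (hy i).le) ho hx

/-- A small step from an interior point in the direction `-d` stays in `P` and strictly lowers `⟪d,
·⟫`. -/
theorem pos_of_mem_interior {P : Set (EuclideanSpace ℝ (Fin (k + 1)))} {c : ℝ}
    {d : EuclideanSpace ℝ (Fin (k + 1))} (hd : d ≠ 0) (hP : ∀ x ∈ P, c ≤ ⟪d, x⟫)
    {x : EuclideanSpace ℝ (Fin (k + 1))} (hx : x ∈ interior P) : c < ⟪d, x⟫ := by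
  have ht : Filter.Tendsto (fun t : ℝ ↦ x - t • d) (nhdsWithin 0 (Set.Ioi 0)) (nhds x) := by
    have : Continuous fun t : ℝ ↦ x - t • d := by fun_prop
    have h := this.tendsto 0
    rw [zero_smul, sub_zero] at h
    exact h.mono_left nhdsWithin_le_nhds
  obtain ⟨t, ht1, ht2⟩ := ((ht.eventually (mem_interior_iff_mem_nhds.1 hx)).and
    self_mem_nhdsWithin).exists
  have h1 := hP _ ht1
  have ht2 : 0 < t := ht2
  rw [inner_sub_right, inner_smul_right, real_inner_self_eq_norm_sq] at h1
  have : 0 < t * ‖d‖ ^ 2 := by positivity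
  linarith

theorem mem_interior_iff [Finite ι] (h : IsPolytope P a b) {x : EuclideanSpace ℝ (Fin (k + 1))} :
    x ∈ interior P ↔ ∀ i, 0 < a i + ⟪b i, x⟫ := by
  refine ⟨fun hx i ↦ ?_, h.mem_interior_of_forall_pos⟩
  have := pos_of_mem_interior (c := -a i) (h.ne_zero i)
    (fun x hx ↦ by linarith [(h.mem_iff x).1 hx i]) hx
  linarith

theorem lt_inner (hF : IsFacetOn P F ν p) {x : EuclideanSpace ℝ (Fin (k + 1))}
    (hx : x ∈ interior P) : p < ⟪ν, x⟫ :=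
  pos_of_mem_interior (norm_ne_zero_iff.1 (by rw [hF.norm_eq_one]; exact one_ne_zero)) hF.le_inner hx

theorem isClosed_facet (h : IsPolytope P a b) (hF : IsFacetOn P F ν p) : IsClosed F := by
  have : F = P ∩ {x | ⟪ν, x⟫ = p} := Set.ext hF.mem_iff
  rw [this]
  exact h.isCompact.isClosed.inter (isClosed_eq (by fun_prop) continuous_const)

/-- The multiplier between the equation of a facet and a proportional defining inequality is
positive. -/
theorem multiplier_pos [Finite ι] (h : IsPolytope P a b) (hF : IsFacetOn P F ν p) {i : ι} {t : ℝ}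
    (ht : ∀ x, a i + ⟪b i, x⟫ = t * (⟪ν, x⟫ - p)) : 0 < t := by
  obtain ⟨x, hx⟩ := h.nonempty_interior
  have h1 := h.mem_interior_iff.1 hx i
  rw [ht] at h1
  exact pos_of_mul_pos_left h1 (sub_pos.2 (lt_inner hF hx)).le

/-- The hyperplane of a facet is one of the defining walls. -/
theorem exists_wall [Finite ι] (h : IsPolytope P a b) (hF : IsFacetOn P F ν p) :
    ∃ i t, 0 < t ∧ ∀ x, a i + ⟪b i, x⟫ = t * (⟪ν, x⟫ - p) := by
  obtain ⟨Φ, hΦ⟩ := exists_isFrame hF.norm_eq_one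
  obtain ⟨U, hU, ⟨y, hyU, hyF⟩, hUF⟩ := hF.exists_isOpen
  have hc : Continuous fun z ↦ Φ (p, z) := by fun_prop
  have hne : ((fun z ↦ Φ (p, z)) ⁻¹' U).Nonempty := by
    obtain ⟨z, hz⟩ := hΦ.exists_eq y
    rw [((hF.mem_iff y).1 hyF).2] at hz
    exact ⟨z, by rw [Set.mem_preimage, ← hz]; exact hyU⟩
  -- A facet contains a relatively open piece of its hyperplane, hence a generic point. That point
  -- is not interior, so some wall vanishes there, and by genericity this wall is the hyperplane of
  -- the facet.
  have hpos := (hU.preimage hc).measure_pos volume hne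
  obtain ⟨z, hzU, hz⟩ := ((frequently_ae_mem_iff.2 hpos.ne').and_eventually
    (hΦ.ae_ne_zero_or p (a := a) h.ne_zero)).exists
  have hzF : Φ (p, z) ∈ F := hUF _ hzU (by rw [hΦ.inner_left])
  have hzP := ((hF.mem_iff _).1 hzF).1
  have hni : Φ (p, z) ∉ interior P := fun hi ↦ by
    have := lt_inner hF hi
    rw [hΦ.inner_left] at this
    exact lt_irrefl _ this
  rw [h.mem_interior_iff] at hni
  push Not at hni
  obtain ⟨i, hi⟩ := hni
  rcases hz i with h1 | ⟨t, -, ht⟩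
  · exact absurd (le_antisymm hi ((h.mem_iff _).1 hzP i)) h1
  · exact ⟨i, t, h.multiplier_pos hF ht, ht⟩

theorem finite_facets [Finite ι] (h : IsPolytope P a b) : (ModelGeometry.euclidean.facets P).Finite := by
  refine (Set.finite_range fun i ↦ {x | x ∈ P ∧ a i + ⟪b i, x⟫ = 0}).subset fun F hF ↦ ?_
  obtain ⟨ν, p, hF⟩ := exists_isFacetOn hF
  obtain ⟨i, t, ht, hi⟩ := h.exists_wall hF
  refine ⟨i, Set.ext fun x ↦ ?_⟩
  rw [hF.mem_iff, Set.mem_ofPred_eq, hi, mul_eq_zero, sub_eq_zero]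
  simp [ht.ne']

/-- A wall of `P` which does not carry a facet meets `P` in a null set. -/
theorem volume_wall_eq_zero [Finite ι] (h : IsPolytope P a b) (hΦ : IsFrame ν Φ) {i : ι} {t : ℝ} (ht : 0 < t)
    (hi : ∀ x, a i + ⟪b i, x⟫ = t * (⟪ν, x⟫ - p))
    (hn : {x | x ∈ P ∧ ⟪ν, x⟫ = p} ∉ ModelGeometry.euclidean.facets P) :
    volume {z | Φ (p, z) ∈ P} = 0 := by
  by_contra h0
  obtain ⟨z, hzP, hz⟩ := ((frequently_ae_mem_iff.2 h0).and_eventually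
    (hΦ.ae_ne_zero_or p (a := a) h.ne_zero)).exists
  have hiff : ∀ x, ModelGeometry.euclidean.wallFun (a i) (b i) x = 0 ↔ ⟪ν, x⟫ = p := by
    intro x
    change a i + ⟪b i, x⟫ = 0 ↔ _
    rw [hi, mul_eq_zero, sub_eq_zero]
    simp [ht.ne']
  -- Positive measure yields a generic point of the section. Near it, the walls not passing through
  -- it stay positive, and the others vanish on the hyperplane; so the nearby points of the
  -- hyperplane lie in `P`, and the section is a facet.
  refine hn ⟨a i, b i, h.ne_zero i, fun x hx ↦ (h.mem_iff x).1 hx i, ?_,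
    {x | ∀ j, a j + ⟪b j, Φ (p, z)⟫ ≠ 0 → 0 < a j + ⟪b j, x⟫}, ?_, ⟨Φ (p, z), ?_, ?_⟩, ?_⟩
  · ext x
    exact and_congr_right fun _ ↦ (hiff x).symm
  · simp only [Set.ofPred_forall]
    exact isOpen_iInter_of_finite fun j ↦ isOpen_iInter_of_finite fun _ ↦
      isOpen_lt continuous_const (by fun_prop)
  · exact fun j hj ↦ lt_of_le_of_ne ((h.mem_iff _).1 hzP j) hj.symm
  · exact ⟨hzP, by rw [hΦ.inner_left]⟩
  · intro x hx hx0
    have hx0 := (hiff x).1 hx0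
    refine ⟨(h.mem_iff x).2 fun j ↦ ?_, hx0⟩
    rcases hz j with hj | ⟨s, -, hs⟩
    · exact (hx j hj).le
    · rw [hs, hx0, sub_self, mul_zero]

/-- Two facets on the same hyperplane coincide, both being its intersection with `P`. Otherwise the
second hyperplane meets the first in a null set. -/
theorem volume_inter_eq_zero (hΦ : IsFrame ν Φ) (hF : IsFacetOn P F ν p)
    (hF' : IsFacetOn P F' ν' p') (hne : F ≠ F') :
    volume {z | Φ (p, z) ∈ F'} = 0 := by
  have hν' : ν' ≠ 0 := norm_ne_zero_iff.1 (by rw [hF'.norm_eq_one]; exact one_ne_zero)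
  have h0 : ¬ ∀ z, -p' + ⟪ν', Φ (p, z)⟫ = 0 := by
    intro h0
    obtain ⟨t, ht, hx⟩ := hΦ.exists_eq_mul hν' h0
    refine hne (Set.ext fun x ↦ ?_)
    rw [hF.mem_iff, hF'.mem_iff]
    refine and_congr_right fun _ ↦ ?_
    rw [← sub_eq_zero (a := ⟪ν', x⟫), sub_eq_neg_add, hx, mul_eq_zero, sub_eq_zero]
    simp [ht]
  refine measure_mono_null (fun z hz ↦ ?_) (IsFrame.volume_affine_eq_zero h0)
  rw [Set.mem_ofPred_eq, ((hF'.mem_iff _).1 hz).2, neg_add_cancel]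

end IsPolytope

end Polytope

/-! ### Entry points of parallel lines, and integration over their chords. -/

section Entry

variable {k : ℕ}

/-- The parameters at which a line is in `P`. -/
def lineTimes {V : Type*} [AddCommGroup V] [Module ℝ V] (P : Set V) (y u : V) : Set ℝ :=
  {s | y + s • u ∈ P}

theorem isCompact_lineTimes {V : Type*} [NormedAddCommGroup V] [NormedSpace ℝ V] {P : Set V}
    (hP : IsCompact P) (y : V) {u : V} (hu : ‖u‖ = 1) : IsCompact (lineTimes P y u) := by
  have h : Isometry fun s : ℝ ↦ y + s • u := by
    refine Isometry.of_dist_eq fun s s' ↦ ?_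
    rw [dist_add_left, dist_eq_norm, ← sub_smul, norm_smul, hu, mul_one, dist_eq_norm]
  exact h.isClosedEmbedding.isCompact_preimage hP

/-- The line through `y` in the direction `u` enters `P` at a point of `F`. -/
def EntersAt {V : Type*} [AddCommGroup V] [Module ℝ V] (P F : Set V) (y u : V) : Prop :=
  y + sInf (lineTimes P y u) • u ∈ F

namespace IsPolytope

variable {ι : Type*} {P F F' : Set (EuclideanSpace ℝ (Fin (k + 1)))} {a : ι → ℝ}
  {b : ι → EuclideanSpace ℝ (Fin (k + 1))} {ν ν' : EuclideanSpace ℝ (Fin (k + 1))} {p p' : ℝ}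
  {Φ : (ℝ × EuclideanSpace ℝ (Fin k)) ≃L[ℝ] EuclideanSpace ℝ (Fin (k + 1))}
  {y u : EuclideanSpace ℝ (Fin (k + 1))}

theorem sInf_mem_lineTimes (h : IsPolytope P a b) (hy : y ∈ P) (hu : ‖u‖ = 1) :
    sInf (lineTimes P y u) ∈ lineTimes P y u ∧ sInf (lineTimes P y u) ≤ 0 := by
  have hc := isCompact_lineTimes h.isCompact y hu
  have h0 : (0 : ℝ) ∈ lineTimes P y u := by simpa [lineTimes] using hy
  exact ⟨hc.sInf_mem ⟨0, h0⟩, csInf_le hc.bddBelow h0⟩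

/-- From an interior point, a line entering at `F` must cross the hyperplane of `F` towards the
positive side, and the crossing time is explicit. This replaces the infimum by a formula, from which
measurability follows. -/
theorem entersAt_iff (h : IsPolytope P a b) (hF : IsFacetOn P F ν p) (hy : y ∈ interior P)
    (hu : ‖u‖ = 1) :
    EntersAt P F y u ↔ 0 < ⟪ν, u⟫ ∧ y + ((p - ⟪ν, y⟫) / ⟪ν, u⟫) • u ∈ F := by
  obtain ⟨hm, hle⟩ := h.sInf_mem_lineTimes (interior_subset hy) hu
  have hlt := lt_inner hF hy
  constructor
  · intro hE
    have h1 := ((hF.mem_iff _).1 hE).2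
    rw [inner_add_right, inner_smul_right] at h1
    have hpos : 0 < ⟪ν, u⟫ := by
      by_contra hn
      have := mul_nonneg_of_nonpos_of_nonpos hle (not_lt.1 hn)
      linarith
    refine ⟨hpos, ?_⟩
    have : (p - ⟪ν, y⟫) / ⟪ν, u⟫ = sInf (lineTimes P y u) := by
      rw [div_eq_iff hpos.ne']
      linarith
    rw [this]
    exact hE
  · rintro ⟨hpos, hmem⟩
    have hleast : IsLeast (lineTimes P y u) ((p - ⟪ν, y⟫) / ⟪ν, u⟫) := by
      refine ⟨((hF.mem_iff _).1 hmem).1, fun s hs ↦ ?_⟩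
      have := hF.le_inner _ hs
      rw [inner_add_right, inner_smul_right] at this
      rw [div_le_iff₀ hpos]
      linarith
    rw [EntersAt, hleast.csInf_eq]
    exact hmem

/-- The entry point is not interior, since otherwise the line would be in `P` earlier; so a wall
vanishes there. As its equation is positive at `y`, at a later time, it increases along `u`. -/
theorem exists_wall_of_entry [Finite ι] (h : IsPolytope P a b) (hy : y ∈ interior P) (hu : ‖u‖ = 1) :
    ∃ i, a i + ⟪b i, y + sInf (lineTimes P y u) • u⟫ = 0 ∧ 0 < ⟪b i, u⟫ := by
  obtain ⟨hm, hle⟩ := h.sInf_mem_lineTimes (interior_subset hy) hu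
  have hc := isCompact_lineTimes h.isCompact y hu
  have hni : y + sInf (lineTimes P y u) • u ∉ interior P := by
    intro hi
    have ho : IsOpen (lineTimes (interior P) y u) :=
      isOpen_interior.preimage (f := fun s : ℝ ↦ y + s • u) (by fun_prop)
    obtain ⟨s, hs, hs'⟩ := (Filter.Eventually.and
      (nhdsWithin_le_nhds (s := Set.Iio (sInf (lineTimes P y u))) (ho.mem_nhds hi))
      self_mem_nhdsWithin).exists
    exact absurd (csInf_le hc.bddBelow (interior_subset hs : y + s • u ∈ P)) (not_le.2 hs')
  rw [h.mem_interior_iff] at hni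
  push Not at hni
  obtain ⟨i, hi⟩ := hni
  have h0 := le_antisymm hi ((h.mem_iff _).1 hm i)
  have hpos := h.mem_interior_iff.1 hy i
  refine ⟨i, h0, ?_⟩
  rw [inner_add_right, inner_smul_right] at h0
  by_contra hn
  have := mul_nonneg_of_nonpos_of_nonpos hle (not_lt.1 hn)
  linarith

/-- In every direction, almost every line enters `P` at a point of exactly one facet. -/
theorem ae_existsUnique_entersAt [Finite ι] (h : IsPolytope P a b) (hu : ‖u‖ = 1) :
    ∀ᵐ y, y ∈ interior P → ∃! F, F ∈ ModelGeometry.euclidean.facets P ∧ EntersAt P F y u := by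
  classical
  have hn : ∀ i, 0 < ‖b i‖ := fun i ↦ norm_pos_iff.2 (h.ne_zero i)
  have hν : ∀ i, ‖‖b i‖⁻¹ • b i‖ = 1 := fun i ↦ by
    rw [norm_smul, norm_inv, norm_norm, inv_mul_cancel₀ (hn i).ne']
  choose Φ hΦ using fun i ↦ exists_isFrame (hν i)
  have hprop : ∀ i x, a i + ⟪b i, x⟫ = ‖b i‖ * (⟪‖b i‖⁻¹ • b i, x⟫ - -a i / ‖b i‖) := by
    intro i x
    rw [real_inner_smul_left]
    have := (hn i).ne'
    field_simp
    ring
  -- First exceptional set: lines entering through a wall that carries no facet. Such a wall meets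
  -- `P` in a null set, and transversal lines through a null set are negligible.
  have A1 : ∀ᵐ y, ∀ i, {x | x ∈ P ∧ ⟪‖b i‖⁻¹ • b i, x⟫ = -a i / ‖b i‖} ∉
      ModelGeometry.euclidean.facets P → 0 < ⟪b i, u⟫ → ∀ z, ∀ s : ℝ,
        y = Φ i (-a i / ‖b i‖, z) + s • u → Φ i (-a i / ‖b i‖, z) ∉ P := by
    refine ae_all_iff.2 fun i ↦ ?_
    by_cases h1 : {x | x ∈ P ∧ ⟪‖b i‖⁻¹ • b i, x⟫ = -a i / ‖b i‖} ∉
      ModelGeometry.euclidean.facets P ∧ 0 < ⟪b i, u⟫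
    · have h2 : ⟪‖b i‖⁻¹ • b i, u⟫ ≠ 0 := by
        rw [real_inner_smul_left]
        exact (mul_pos (inv_pos.2 (hn i)) h1.2).ne'
      filter_upwards [(hΦ i).ae_of_ae h2 _ (h.volume_wall_eq_zero (hΦ i) (hn i) (hprop i) h1.1)]
        with y hy _ _ z s hyz using hy z s hyz
    · exact Filter.Eventually.of_forall fun y h2 h3 ↦ absurd ⟨h2, h3⟩ h1
  have hfin := h.finite_facets
  -- Second exceptional set: lines entering at a common point of two distinct facets.
  have A2 : ∀ᵐ y, ∀ F ∈ ModelGeometry.euclidean.facets P,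
      ∀ F' ∈ ModelGeometry.euclidean.facets P, F ≠ F' → y ∈ interior P → EntersAt P F y u →
        ¬ EntersAt P F' y u := by
    refine (ae_ball_iff hfin.countable).2 fun F hF ↦ (ae_ball_iff hfin.countable).2 fun F' hF' ↦ ?_
    obtain ⟨ν, p, hν⟩ := exists_isFacetOn hF
    obtain ⟨ν', p', hν'⟩ := exists_isFacetOn hF'
    obtain ⟨Φ, hΦ⟩ := exists_isFrame hν.norm_eq_one
    by_cases h1 : F ≠ F' ∧ 0 < ⟪ν, u⟫
    · filter_upwards [hΦ.ae_of_ae h1.2.ne' p (volume_inter_eq_zero hΦ hν hν' h1.1)]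
        with y hy _ hyi hE hE'
      obtain ⟨z, hz⟩ := hΦ.exists_eq (y + sInf (lineTimes P y u) • u)
      rw [((hν.mem_iff _).1 hE).2] at hz
      refine hy z (-sInf (lineTimes P y u)) ?_ ?_
      · rw [← hz]
        module
      · rw [← hz]
        exact hE'
    · refine Filter.Eventually.of_forall fun y h2 hyi hE ↦ absurd ⟨h2, ?_⟩ h1
      exact ((h.entersAt_iff hν hyi hu).1 hE).1
  filter_upwards [A1, A2] with y h1 h2 hy
  obtain ⟨i, hi0, hiu⟩ := h.exists_wall_of_entry hy hu
  have hm := (h.sInf_mem_lineTimes (interior_subset hy) hu).1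
  have hi1 : ⟪‖b i‖⁻¹ • b i, y + sInf (lineTimes P y u) • u⟫ = -a i / ‖b i‖ := by
    rw [hprop, mul_eq_zero, sub_eq_zero] at hi0
    exact hi0.resolve_left (hn i).ne'
  have hfac : {x | x ∈ P ∧ ⟪‖b i‖⁻¹ • b i, x⟫ = -a i / ‖b i‖} ∈
      ModelGeometry.euclidean.facets P := by
    by_contra hnf
    obtain ⟨z, hz⟩ := (hΦ i).exists_eq (y + sInf (lineTimes P y u) • u)
    rw [hi1] at hz
    refine h1 i hnf hiu z (-sInf (lineTimes P y u)) ?_ ?_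
    · rw [← hz]
      module
    · rw [← hz]
      exact hm
  refine ⟨_, ⟨hfac, hm, hi1⟩, fun F' hF' ↦ ?_⟩
  by_contra hne
  exact h2 F' hF'.1 _ hfac hne hy hF'.2 ⟨hm, hi1⟩

theorem measurableSet_entersAt (h : IsPolytope P a b) (hF : IsFacetOn P F ν p) :
    MeasurableSet {v : EuclideanSpace ℝ (Fin (k + 1)) ×
      Metric.sphere (0 : EuclideanSpace ℝ (Fin (k + 1))) 1 |
        v.1 ∈ interior P ∧ EntersAt P F v.1 v.2} := by
  have : {v : EuclideanSpace ℝ (Fin (k + 1)) ×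
      Metric.sphere (0 : EuclideanSpace ℝ (Fin (k + 1))) 1 |
        v.1 ∈ interior P ∧ EntersAt P F v.1 v.2} =
      (Prod.fst ⁻¹' interior P) ∩ ({v : EuclideanSpace ℝ (Fin (k + 1)) ×
      Metric.sphere (0 : EuclideanSpace ℝ (Fin (k + 1))) 1 | 0 < ⟪ν, (v.2 : EuclideanSpace ℝ (Fin (k + 1)))⟫} ∩
        (fun v : EuclideanSpace ℝ (Fin (k + 1)) ×
      Metric.sphere (0 : EuclideanSpace ℝ (Fin (k + 1))) 1 ↦ v.1 + ((p - ⟪ν, v.1⟫) / ⟪ν, (v.2 : EuclideanSpace ℝ (Fin (k + 1)))⟫) •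
          (v.2 : EuclideanSpace ℝ (Fin (k + 1)))) ⁻¹' F) := by
    ext v
    exact and_congr_right fun hv ↦ h.entersAt_iff hF hv (norm_eq_of_mem_sphere v.2)
  rw [this]
  refine (measurable_fst isOpen_interior.measurableSet).inter
    ((measurableSet_lt measurable_const (by fun_prop)).inter
      (measurableSet_preimage ?_ (h.isClosed_facet hF).measurableSet))
  fun_prop

/-- A line crossing a facet transversally, at a point on no other wall, meets the interior. -/
theorem exists_pos_mem_interior [Finite ι] (h : IsPolytope P a b) (hF : IsFacetOn P F ν p)
    {x : EuclideanSpace ℝ (Fin (k + 1))} (hx : x ∈ F) (hνu : 0 < ⟪ν, u⟫)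
    (hgen : ∀ i, a i + ⟪b i, x⟫ ≠ 0 ∨ ∃ t, t ≠ 0 ∧ ∀ x, a i + ⟪b i, x⟫ = t * (⟪ν, x⟫ - p)) :
    ∃ s : ℝ, x + s • u ∈ interior P := by
  obtain ⟨hxP, hxp⟩ := (hF.mem_iff x).1 hx
  have : ∀ᶠ s : ℝ in nhdsWithin 0 (Set.Ioi 0), ∀ i, 0 < a i + ⟪b i, x + s • u⟫ := by
    refine Filter.eventually_all.2 fun i ↦ ?_
    rcases hgen i with h1 | ⟨t, -, ht⟩
    · have hpos := lt_of_le_of_ne ((h.mem_iff x).1 hxP i) h1.symm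
      have hc : Continuous fun s : ℝ ↦ a i + ⟪b i, x + s • u⟫ := by fun_prop
      have h0 := hc.tendsto 0
      simp only [zero_smul, add_zero] at h0
      exact (h0.mono_left nhdsWithin_le_nhds).eventually (lt_mem_nhds hpos)
    · filter_upwards [self_mem_nhdsWithin] with s hs
      have hs : 0 < s := hs
      rw [ht, inner_add_right, inner_smul_right, hxp, add_sub_cancel_left]
      exact mul_pos (h.multiplier_pos hF ht) (mul_pos hs hνu)
  obtain ⟨s, hs⟩ := this.exists
  exact ⟨s, h.mem_interior_of_forall_pos hs⟩

/-- A line meeting the interior of a polytope is in its boundary at finitely many times only. -/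
theorem finite_lineTimes_sdiff [Finite ι] (h : IsPolytope P a b)
    {x : EuclideanSpace ℝ (Fin (k + 1))} {s₀ : ℝ} (hs₀ : x + s₀ • u ∈ interior P) :
    (lineTimes P x u \ lineTimes (interior P) x u).Finite := by
  refine (Set.finite_range fun i ↦ -(a i + ⟪b i, x⟫) / ⟪b i, u⟫).subset fun s hs ↦ ?_
  have hni : x + s • u ∉ interior P := hs.2
  rw [h.mem_interior_iff] at hni
  push Not at hni
  obtain ⟨i, hi⟩ := hni
  have h0 := le_antisymm hi ((h.mem_iff _).1 hs.1 i)
  have hpos := h.mem_interior_iff.1 hs₀ i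
  rw [inner_add_right, inner_smul_right] at h0 hpos
  refine ⟨i, ?_⟩
  -- A wall function constant along the line could not vanish at `s` and be positive at `s₀`.
  have hne : ⟪b i, u⟫ ≠ 0 := by
    intro hz
    rw [hz] at h0 hpos
    linarith
  simp only
  rw [div_eq_iff hne]
  linarith

/-- The core of Santaló's formula, in one direction `u`: with `g` as speed, the quotient of `g` by
its integral over the chord has integral 1 along that chord. A weight `w` constant on lines is thus
integrated over the facet, seen from `u` with the factor `⟪ν, u⟫`. -/
theorem lintegral_entersAt [Finite ι] (h : IsPolytope P a b) (hF : IsFacetOn P F ν p)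
    (hΦ : IsFrame ν Φ) (hu : ‖u‖ = 1) (hνu : 0 < ⟪ν, u⟫)
    {g w : EuclideanSpace ℝ (Fin (k + 1)) → ℝ} (hg : Measurable g) (hw : Measurable w)
    (hgc : ContinuousOn g P) (hgpos : ∀ x ∈ P, 0 < g x)
    (hwu : ∀ x, ∀ s : ℝ, w (x + s • u) = w x) (hEm : MeasurableSet {y | y ∈ interior P ∧ EntersAt P F y u}) :
    ∫⁻ y in {y | y ∈ interior P ∧ EntersAt P F y u},
        ENNReal.ofReal (w y) * (ENNReal.ofReal (g y) /
          ∫⁻ s in lineTimes P y u, ENNReal.ofReal (g (y + s • u))) =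
      ENNReal.ofReal ⟪ν, u⟫ * ∫⁻ z in {z | Φ (p, z) ∈ F}, ENNReal.ofReal (w (Φ (p, z))) := by
  have hFm := (h.isClosed_facet hF).measurableSet
  have hPm := h.isCompact.isClosed.measurableSet
  have hΦm : Measurable fun z ↦ Φ (p, z) := by
    have : Continuous fun z ↦ Φ (p, z) := by fun_prop
    exact this.measurable
  have hlm : Measurable fun y : EuclideanSpace ℝ (Fin (k + 1)) ↦
      ∫⁻ s in lineTimes P y u, ENNReal.ofReal (g (y + s • u)) := by
    have e : ∀ y, ∫⁻ s in lineTimes P y u, ENNReal.ofReal (g (y + s • u)) =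
        ∫⁻ s : ℝ, P.indicator (fun x ↦ ENNReal.ofReal (g x)) (y + s • u) := by
      intro y
      have : Measurable fun s : ℝ ↦ y + s • u := by fun_prop
      have hm : MeasurableSet (lineTimes P y u) := this hPm
      rw [← lintegral_indicator hm]
      rfl
    simp_rw [e]
    refine Measurable.lintegral_prod_right' (f := fun q : EuclideanSpace ℝ (Fin (k + 1)) × ℝ ↦
      P.indicator (fun x ↦ ENNReal.ofReal (g x)) (q.1 + q.2 • u)) ?_
    exact (Measurable.indicator (by fun_prop) hPm).comp (by fun_prop)
  have hFz : MeasurableSet {z | Φ (p, z) ∈ F} := hΦm hFm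
  rw [← lintegral_indicator hEm, hΦ.lintegral_eq hνu.ne' p (Measurable.indicator (by fun_prop) hEm),
    abs_of_pos hνu, ← lintegral_indicator hFz]
  congr 1
  refine lintegral_congr_ae ?_
  -- Only generic feet `z` matter: the line through such a point of `F` meets the interior, so its
  -- chord integral is nonzero and it is on the boundary at finitely many times only.
  filter_upwards [hΦ.ae_ne_zero_or p (a := a) h.ne_zero] with z hz
  have hfoot : ∀ s : ℝ, Φ (p, z) + s • u ∈ interior P →
      (EntersAt P F (Φ (p, z) + s • u) u ↔ Φ (p, z) ∈ F) := by
    intro s hs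
    rw [h.entersAt_iff hF hs hu]
    have : Φ (p, z) + s • u + ((p - ⟪ν, Φ (p, z) + s • u⟫) / ⟪ν, u⟫) • u = Φ (p, z) := by
      rw [inner_add_right, inner_smul_right, hΦ.inner_left]
      rw [show (p - (p + s * ⟪ν, u⟫)) / ⟪ν, u⟫ = -s by field_simp; ring]
      module
    rw [this]
    exact and_iff_right hνu
  by_cases hzF : Φ (p, z) ∈ F
  swap
  · rw [Set.indicator_of_notMem (by exact hzF), ← lintegral_zero]
    refine lintegral_congr fun s ↦ Set.indicator_of_notMem ?_ _
    rintro ⟨h1, h2⟩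
    exact hzF ((hfoot s h1).1 h2)
  rw [Set.indicator_of_mem (by exact hzF)]
  set x := Φ (p, z) with hx
  obtain ⟨s₀, hs₀⟩ := h.exists_pos_mem_interior hF hzF hνu hz
  have hT : MeasurableSet (lineTimes P x u) :=
    (isCompact_lineTimes h.isCompact x hu).isClosed.measurableSet
  set l := ∫⁻ s in lineTimes P x u, ENNReal.ofReal (g (x + s • u)) with hl
  have hl0 : l ≠ 0 := by
    have ho : IsOpen (lineTimes (interior P) x u) :=
      isOpen_interior.preimage (f := fun s : ℝ ↦ x + s • u) (by fun_prop)
    have hv := ho.measure_pos volume ⟨s₀, hs₀⟩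
    refine ((setLIntegral_pos_iff (by fun_prop)).2 (hv.trans_le (measure_mono fun s hs ↦ ?_))).ne'
    have hs' : x + s • u ∈ P := interior_subset hs
    exact ⟨(ENNReal.ofReal_pos.2 (hgpos _ hs')).ne', hs'⟩
  have hl1 : l ≠ ⊤ := by
    obtain ⟨C, hC⟩ := h.isCompact.bddAbove_image hgc
    refine ne_top_of_le_ne_top (b := ENNReal.ofReal C * volume (lineTimes P x u)) ?_ ?_
    · exact ENNReal.mul_ne_top ENNReal.ofReal_ne_top
        (isCompact_lineTimes h.isCompact x hu).measure_lt_top.ne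
    · rw [← setLIntegral_const]
      exact setLIntegral_mono' hT fun s hs ↦
        ENNReal.ofReal_le_ofReal (hC ⟨x + s • u, hs, rfl⟩)
  -- The chord integral depends on the line only, not on its base point, by translation invariance
  -- in the parameter.
  have hls : ∀ s : ℝ, ∫⁻ s' in lineTimes P (x + s • u) u,
      ENNReal.ofReal (g (x + s • u + s' • u)) = l := by
    intro s
    have hT' : MeasurableSet (lineTimes P (x + s • u) u) :=
      (isCompact_lineTimes h.isCompact _ hu).isClosed.measurableSet
    rw [hl, ← lintegral_indicator hT, ← lintegral_indicator hT']
    refine (lintegral_congr fun s' ↦ ?_).trans (lintegral_add_left_eq_self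
      ((lineTimes P x u).indicator fun s ↦ ENNReal.ofReal (g (x + s • u))) s)
    have e : x + (s + s') • u = x + s • u + s' • u := by module
    have hiff : s' ∈ lineTimes P (x + s • u) u ↔ s + s' ∈ lineTimes P x u := by
      change _ ∈ P ↔ _ ∈ P
      rw [e]
    by_cases hm : s + s' ∈ lineTimes P x u
    · rw [Set.indicator_of_mem hm, Set.indicator_of_mem (hiff.2 hm), e]
    · rw [Set.indicator_of_notMem hm, Set.indicator_of_notMem (mt hiff.1 hm)]
  have hae : ∀ᵐ s : ℝ, {y | y ∈ interior P ∧ EntersAt P F y u}.indicator (fun y ↦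
      ENNReal.ofReal (w y) * (ENNReal.ofReal (g y) /
          ∫⁻ s in lineTimes P y u, ENNReal.ofReal (g (y + s • u)))) (x + s • u) =
      (lineTimes P x u).indicator (fun s ↦ ENNReal.ofReal (w x) *
        (ENNReal.ofReal (g (x + s • u)) / l)) s := by
    filter_upwards [measure_eq_zero_iff_ae_notMem.1
      ((h.finite_lineTimes_sdiff hs₀).measure_zero volume)] with s hs
    by_cases hsP : s ∈ lineTimes P x u
    · have hsi : x + s • u ∈ interior P := by
        by_contra hn
        exact hs ⟨hsP, hn⟩
      rw [Set.indicator_of_mem hsP, Set.indicator_of_mem (show x + s • u ∈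
        {y | y ∈ interior P ∧ EntersAt P F y u} from ⟨hsi, (hfoot s hsi).2 hzF⟩), hls, hwu]
    · rw [Set.indicator_of_notMem hsP, Set.indicator_of_notMem]
      exact fun hm ↦ hsP (show x + s • u ∈ P from interior_subset hm.1)
  rw [lintegral_congr_ae hae, lintegral_indicator hT, lintegral_const_mul _ (by fun_prop)]
  simp_rw [div_eq_mul_inv]
  rw [lintegral_mul_const _ (by fun_prop), ← hl, ENNReal.mul_inv_cancel hl0 hl1, mul_one]

end IsPolytope

end Entry

/-! ### The projective model and the derivative of the chart. -/

noncomputable section FlatModel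

namespace ModelGeometry

variable (G : ModelGeometry) {n : ℕ}

/-- Minus the curvature. -/
def curv : ℝ :=
  match G with
  | euclidean => 0
  | hyperbolic => 1

/-- The ratio between a point of the model and its image in the projective model. -/
def chartScale (x : EuclideanSpace ℝ (Fin n)) : ℝ :=
  match G with
  | euclidean => 1
  | hyperbolic => 2 / (1 + ‖x‖ ^ 2)

/-- The map to the projective (Beltrami–Klein) model, in which geodesics are straight. -/
def flatMap (x : EuclideanSpace ℝ (Fin n)) : EuclideanSpace ℝ (Fin n) := G.chartScale x • x

/-- The inverse of `flatMap`. -/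
def flatInv (y : EuclideanSpace ℝ (Fin n)) : EuclideanSpace ℝ (Fin n) :=
  match G with
  | euclidean => y
  | hyperbolic => (1 + √(1 - ‖y‖ ^ 2))⁻¹ • y

/-- The derivative of `flatMap`. -/
def flatDeriv (x : EuclideanSpace ℝ (Fin n)) :
    EuclideanSpace ℝ (Fin n) →L[ℝ] EuclideanSpace ℝ (Fin n) :=
  G.chartScale x • (ContinuousLinearMap.id ℝ _ -
    (G.curv * G.chartScale x) • (innerSL ℝ x).smulRight x)

/-- `flatFactor y ^ (-4)` times this quadratic form is the metric of the projective model. -/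
def flatForm (y v : EuclideanSpace ℝ (Fin n)) : ℝ :=
  (1 - G.curv * ‖y‖ ^ 2) * ‖v‖ ^ 2 + G.curv * ⟪y, v⟫ ^ 2

/-- The factor `√(1 - ‖y‖²)` of the projective model. -/
def flatFactor (y : EuclideanSpace ℝ (Fin n)) : ℝ := √(1 - G.curv * ‖y‖ ^ 2)

theorem curv_nonneg : 0 ≤ G.curv := by cases G <;> simp [curv]

theorem mem_domain_iff {x : EuclideanSpace ℝ (Fin n)} :
    x ∈ G.domain n ↔ 0 < 1 - G.curv * ‖x‖ ^ 2 := by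
  cases G
  · simp [domain, curv]
  · simp [domain, curv]

theorem isOpen_domain : IsOpen (G.domain n) := by
  cases G
  · exact isOpen_univ
  · exact Metric.isOpen_ball

theorem convex_domain : Convex ℝ (G.domain n) := by
  cases G
  · exact convex_univ
  · exact convex_ball _ _

theorem chartScale_pos (x : EuclideanSpace ℝ (Fin n)) : 0 < G.chartScale x := by
  cases G
  · exact one_pos
  · simp only [chartScale]
    positivity

theorem continuous_chartScale : Continuous (G.chartScale : EuclideanSpace ℝ (Fin n) → ℝ) := by
  cases G
  · exact continuous_const
  · exact continuous_const.div (by fun_prop) fun x ↦ by positivity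

theorem continuous_flatMap : Continuous (G.flatMap : EuclideanSpace ℝ (Fin n) → _) :=
  G.continuous_chartScale.smul continuous_id

theorem continuous_flatInv : Continuous (G.flatInv : EuclideanSpace ℝ (Fin n) → _) := by
  cases G
  · exact continuous_id
  · have h : Continuous fun y : EuclideanSpace ℝ (Fin n) ↦ 1 + √(1 - ‖y‖ ^ 2) := by fun_prop
    exact (h.inv₀ fun y ↦ by positivity).smul continuous_id

theorem continuous_flatFactor : Continuous (G.flatFactor : EuclideanSpace ℝ (Fin n) → ℝ) := by
  unfold flatFactor
  fun_prop

theorem flatFactor_pos {y : EuclideanSpace ℝ (Fin n)} (hy : y ∈ G.domain n) :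
    0 < G.flatFactor y :=
  Real.sqrt_pos.2 (G.mem_domain_iff.1 hy)

theorem flatFactor_sq {y : EuclideanSpace ℝ (Fin n)} (hy : y ∈ G.domain n) :
    G.flatFactor y ^ 2 = 1 - G.curv * ‖y‖ ^ 2 :=
  Real.sq_sqrt (G.mem_domain_iff.1 hy).le

theorem one_sub_norm_sq_flatMap (x : EuclideanSpace ℝ (Fin n)) :
    1 - ‖hyperbolic.flatMap x‖ ^ 2 = ((1 - ‖x‖ ^ 2) / (1 + ‖x‖ ^ 2)) ^ 2 := by
  have : (1 + ‖x‖ ^ 2) ≠ 0 := by positivity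
  rw [flatMap, norm_smul, mul_pow, Real.norm_eq_abs, sq_abs, chartScale]
  field_simp
  ring

theorem flatMap_mem_domain {x : EuclideanSpace ℝ (Fin n)} (hx : x ∈ G.domain n) :
    G.flatMap x ∈ G.domain n := by
  cases G
  · trivial
  · rw [mem_domain_iff] at *
    simp only [curv, one_mul] at *
    rw [one_sub_norm_sq_flatMap]
    positivity

theorem flatFactor_flatMap_hyperbolic {x : EuclideanSpace ℝ (Fin n)} (hx : x ∈ hyperbolic.domain n) :
    hyperbolic.flatFactor (hyperbolic.flatMap x) = (1 - ‖x‖ ^ 2) / (1 + ‖x‖ ^ 2) := by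
  rw [mem_domain_iff] at hx
  simp only [curv, one_mul] at hx
  rw [flatFactor, curv, one_mul, one_sub_norm_sq_flatMap, Real.sqrt_sq (by positivity)]

/-- The conformal factor expressed in the projective model. -/
theorem conformalFactor_mul_flatFactor {x : EuclideanSpace ℝ (Fin n)} (hx : x ∈ G.domain n) :
    G.conformalFactor x * G.flatFactor (G.flatMap x) = G.chartScale x := by
  cases G
  · simp [conformalFactor, flatFactor, curv, chartScale]
  · have h := hx
    rw [mem_domain_iff] at h
    simp only [curv, one_mul] at h
    rw [flatFactor_flatMap_hyperbolic hx, conformalFactor, chartScale]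
    field_simp

theorem flatInv_mem_domain {y : EuclideanSpace ℝ (Fin n)} (hy : y ∈ G.domain n) :
    G.flatInv y ∈ G.domain n := by
  cases G
  · trivial
  · rw [mem_domain_iff] at *
    simp only [curv, one_mul] at *
    rw [flatInv, norm_smul, mul_pow, norm_inv, Real.norm_of_nonneg (by positivity), inv_pow,
      inv_mul_eq_div, sub_pos, div_lt_one (by positivity)]
    have := Real.sqrt_nonneg (1 - ‖y‖ ^ 2)
    nlinarith [Real.sq_sqrt hy.le]

theorem flatMap_flatInv {y : EuclideanSpace ℝ (Fin n)} (hy : y ∈ G.domain n) :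
    G.flatMap (G.flatInv y) = y := by
  cases G
  · exact one_smul _ _
  · rw [mem_domain_iff] at hy
    simp only [curv, one_mul] at hy
    have h0 := Real.sqrt_nonneg (1 - ‖y‖ ^ 2)
    rw [flatMap, chartScale, flatInv, smul_smul, norm_smul, mul_pow, norm_inv,
      Real.norm_of_nonneg (by positivity)]
    have h1 := Real.sq_sqrt hy.le
    set s := √(1 - ‖y‖ ^ 2)
    rw [show ‖y‖ ^ 2 = 1 - s ^ 2 by linarith]
    have : 2 / (1 + (1 + s)⁻¹ ^ 2 * (1 - s ^ 2)) * (1 + s)⁻¹ = 1 := by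
      have e : (1 : ℝ) + (1 + s)⁻¹ ^ 2 * (1 - s ^ 2) = 2 / (1 + s) := by
        field_simp
        ring
      rw [e]
      field_simp
    rw [this, one_smul]

theorem flatInv_flatMap {x : EuclideanSpace ℝ (Fin n)} (hx : x ∈ G.domain n) :
    G.flatInv (G.flatMap x) = x := by
  cases G
  · exact one_smul _ _
  · have h := flatFactor_flatMap_hyperbolic hx
    simp only [flatFactor, curv, one_mul] at h
    rw [flatInv, h, flatMap, chartScale, smul_smul]
    have : (1 + (1 - ‖x‖ ^ 2) / (1 + ‖x‖ ^ 2))⁻¹ * (2 / (1 + ‖x‖ ^ 2)) = 1 := by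
      have : (1 + ‖x‖ ^ 2) ≠ 0 := by positivity
      rw [show (1 + (1 - ‖x‖ ^ 2) / (1 + ‖x‖ ^ 2)) = 2 / (1 + ‖x‖ ^ 2) by field_simp; ring]
      exact inv_mul_cancel₀ (by positivity)
    rw [this, one_smul]

theorem injOn_flatMap : Set.InjOn G.flatMap (G.domain n) := fun x hx x' hx' h ↦ by
  rw [← G.flatInv_flatMap hx, h, G.flatInv_flatMap hx']

theorem flatDeriv_apply (x w : EuclideanSpace ℝ (Fin n)) :
    G.flatDeriv x w = G.chartScale x • (w - (G.curv * G.chartScale x * ⟪x, w⟫) • x) := by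
  simp [flatDeriv, smul_smul]

theorem hasFDerivAt_flatMap (x : EuclideanSpace ℝ (Fin n)) :
    HasFDerivAt G.flatMap (G.flatDeriv x) x := by
  cases G
  · have : (euclidean.flatMap : EuclideanSpace ℝ (Fin n) → _) = id := by
      funext x
      exact one_smul _ _
    rw [this]
    convert hasFDerivAt_id (𝕜 := ℝ) x using 1
    ext1 w
    rw [flatDeriv_apply]
    simp [curv, chartScale]
  · have h1 : HasFDerivAt (fun x : EuclideanSpace ℝ (Fin n) ↦ 1 + ‖x‖ ^ 2) (2 • innerSL ℝ x) x :=
      (hasStrictFDerivAt_norm_sq x).hasFDerivAt.const_add 1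
    have hne : (1 + ‖x‖ ^ 2) ≠ 0 := by positivity
    have h2 := (((hasDerivAt_inv hne).comp_hasFDerivAt x h1).const_mul 2).smul (hasFDerivAt_id x)
    refine h2.congr_fderiv ?_
    ext1 w
    rw [flatDeriv_apply]
    simp only [add_apply, smul_apply,
      ContinuousLinearMap.smulRight_apply, ContinuousLinearMap.id_apply, innerSL_apply_apply,
      Function.comp_apply, id, chartScale, curv, nsmul_eq_mul, smul_eq_mul]
    rw [smul_sub, smul_smul, sub_eq_add_neg, ← neg_smul]
    congr 2
    push_cast
    field_simp

theorem norm_sq_flatMap_le (x : EuclideanSpace ℝ (Fin n)) :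
    G.curv * G.chartScale x * ‖x‖ ^ 2 = G.curv * (2 - G.chartScale x) := by
  cases G
  · simp [curv]
  · have hne : (1 + ‖x‖ ^ 2) ≠ 0 := by positivity
    simp only [curv, chartScale]
    field_simp
    ring

theorem flatFactor_flatMap {x : EuclideanSpace ℝ (Fin n)} (hx : x ∈ G.domain n) :
    G.flatFactor (G.flatMap x) = 1 - G.curv * G.chartScale x * ‖x‖ ^ 2 := by
  cases G
  · simp [curv, flatFactor]
  · have hne : (1 + ‖x‖ ^ 2) ≠ 0 := by positivity
    rw [flatFactor_flatMap_hyperbolic hx]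
    simp only [curv, chartScale]
    field_simp
    ring

/-- The derivative is a scalar times a rank-one perturbation of the identity, whose determinant is 1
plus the functional evaluated at the vector. -/
theorem det_flatDeriv {x : EuclideanSpace ℝ (Fin n)} (hx : x ∈ G.domain n) :
    (G.flatDeriv x).det = G.chartScale x ^ n * G.flatFactor (G.flatMap x) := by
  have : (G.flatDeriv x : EuclideanSpace ℝ (Fin n) →ₗ[ℝ] EuclideanSpace ℝ (Fin n)) =
      G.chartScale x • LinearMap.transvection
        (innerSL ℝ x : EuclideanSpace ℝ (Fin n) →ₗ[ℝ] ℝ) (-(G.curv * G.chartScale x) • x) := by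
    ext1 w
    simp only [ContinuousLinearMap.coe_coe, flatDeriv_apply, LinearMap.smul_apply,
      LinearMap.transvection.apply, innerSL_apply_apply, smul_smul]
    rw [sub_eq_add_neg, ← neg_smul]
    congr 3
    ring
  rw [ContinuousLinearMap.det, this, LinearMap.det_smul, LinearMap.transvection.det,
    G.flatFactor_flatMap hx, finrank_euclideanSpace, Fintype.card_fin]
  simp [inner_smul_right]
  ring_nf
  simp

/-- The derivative is self-adjoint, being built from the identity and `x ⊗ x`. The flux computation
uses this to move it onto the normal vector. -/
theorem inner_flatDeriv (x v w : EuclideanSpace ℝ (Fin n)) :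
    ⟪v, G.flatDeriv x w⟫ = ⟪G.flatDeriv x v, w⟫ := by
  rw [flatDeriv_apply, flatDeriv_apply, inner_smul_right, real_inner_smul_left, inner_sub_right,
    inner_sub_left, inner_smul_right, real_inner_smul_left, real_inner_comm x v]
  ring

theorem norm_sq_flatDeriv (x v : EuclideanSpace ℝ (Fin n)) :
    ‖G.flatDeriv x v‖ ^ 2 =
      G.chartScale x ^ 2 * (‖v‖ ^ 2 - G.curv * ⟪G.flatMap x, v⟫ ^ 2) := by
  have h := G.norm_sq_flatMap_le x
  have hc : G.curv ^ 2 = G.curv := by cases G <;> simp [curv]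
  rw [flatDeriv_apply, norm_smul, mul_pow, Real.norm_eq_abs, sq_abs, norm_sub_sq_real,
    inner_smul_right, norm_smul, mul_pow, Real.norm_eq_abs, sq_abs, flatMap, real_inner_smul_left,
    real_inner_comm x v]
  congr 1
  linear_combination G.curv * G.chartScale x * ⟪x, v⟫ ^ 2 * h +
    (2 - G.chartScale x) * G.chartScale x * ⟪x, v⟫ ^ 2 * hc

/-- Since `chartScale = conformalFactor * flatFactor`, dividing by `flatFactor ^ 4` shows that the
Klein metric pulls back to the conformal one. In particular the form is constant on the image of the
unit sphere. -/
theorem flatForm_flatDeriv {x : EuclideanSpace ℝ (Fin n)} (hx : x ∈ G.domain n)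
    (w : EuclideanSpace ℝ (Fin n)) :
    G.flatForm (G.flatMap x) (G.flatDeriv x w) =
      (G.chartScale x * G.flatFactor (G.flatMap x)) ^ 2 * ‖w‖ ^ 2 := by
  have h1 := G.norm_sq_flatMap_le x
  have h2 := G.flatFactor_flatMap hx
  have h3 := G.flatFactor_sq (G.flatMap_mem_domain hx)
  have h4 : ⟪G.flatMap x, G.flatDeriv x w⟫ =
      G.chartScale x * G.flatFactor (G.flatMap x) * ⟪G.flatMap x, w⟫ := by
    rw [h2, flatDeriv_apply, flatMap, inner_smul_right, real_inner_smul_left, inner_sub_right,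
      inner_smul_right, real_inner_self_eq_norm_sq, real_inner_smul_left]
    ring
  rw [flatForm, h4, norm_sq_flatDeriv, ← h3]
  ring

theorem flatForm_smul (y v : EuclideanSpace ℝ (Fin n)) (r : ℝ) :
    G.flatForm y (r • v) = r ^ 2 * G.flatForm y v := by
  rw [flatForm, flatForm, norm_smul, inner_smul_right, mul_pow, mul_pow, Real.norm_eq_abs, sq_abs]
  ring

theorem flatForm_pos {y v : EuclideanSpace ℝ (Fin n)} (hy : y ∈ G.domain n) (hv : v ≠ 0) :
    0 < G.flatForm y v := by
  have h1 := G.mem_domain_iff.1 hy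
  have h2 : 0 < ‖v‖ := norm_pos_iff.2 hv
  have h3 := G.curv_nonneg
  rw [flatForm]
  positivity

/-- The form is constant along lines. -/
theorem flatForm_add_smul (y u : EuclideanSpace ℝ (Fin n)) (s : ℝ) :
    G.flatForm (y + s • u) u = G.flatForm y u := by
  -- Apart from `‖u‖²`, the form is minus `curv` times the Gram determinant of `y` and `u`, which
  -- does not change when a multiple of `u` is added to `y`.
  rw [flatForm, flatForm, inner_add_left, real_inner_smul_left, real_inner_self_eq_norm_sq,
    norm_add_sq_real, inner_smul_right, norm_smul, mul_pow, Real.norm_eq_abs, sq_abs]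
  ring

theorem injective_flatDeriv {x : EuclideanSpace ℝ (Fin n)} (hx : x ∈ G.domain n) :
    Function.Injective (G.flatDeriv x) := by
  refine (injective_iff_map_eq_zero _).2 fun w hw ↦ ?_
  have h := G.flatForm_flatDeriv hx w
  have h1 := G.chartScale_pos x
  have h2 := G.flatFactor_pos (G.flatMap_mem_domain hx)
  rw [hw, flatForm, norm_zero, inner_zero_right] at h
  have h3 : ‖w‖ ^ 2 = 0 := by
    have : (G.chartScale x * G.flatFactor (G.flatMap x)) ^ 2 ≠ 0 := by positivity
    simpa [this] using h.symm
  simpa using h3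

end ModelGeometry

end FlatModel

/-! ### Angular measure, Liouville measure and flux in the projective model. -/

noncomputable section FlatMeasure

/-- The radial projection of `v ≠ 0` to the unit sphere; `e` is the value at `0`. -/
def sphereProj {V : Type*} [NormedAddCommGroup V] [NormedSpace ℝ V] (e : Metric.sphere (0 : V) 1)
    (v : V) : Metric.sphere (0 : V) 1 :=
  open scoped Classical in
  ⟨if v = 0 then (e : V) else ‖v‖⁻¹ • v, by
    split_ifs with h
    · exact e.2
    · rw [mem_sphere_zero_iff_norm, norm_smul, norm_inv, norm_norm,
        inv_mul_cancel₀ (norm_ne_zero_iff.2 h)]⟩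

theorem coe_sphereProj {V : Type*} [NormedAddCommGroup V] [NormedSpace ℝ V]
    (e : Metric.sphere (0 : V) 1) {v : V} (hv : v ≠ 0) : (sphereProj e v : V) = ‖v‖⁻¹ • v :=
  if_neg hv

theorem sphereProj_smul {V : Type*} [NormedAddCommGroup V] [NormedSpace ℝ V]
    (e : Metric.sphere (0 : V) 1) {v : V} (hv : v ≠ 0) {r : ℝ} (hr : 0 < r) :
    sphereProj e (r • v) = sphereProj e v := by
  apply Subtype.ext
  rw [coe_sphereProj e hv, coe_sphereProj e (smul_ne_zero hr.ne' hv), norm_smul, smul_smul,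
    Real.norm_of_nonneg hr.le]
  congr 1
  field_simp

theorem sphereProj_coe {V : Type*} [NormedAddCommGroup V] [NormedSpace ℝ V]
    (e w : Metric.sphere (0 : V) 1) : sphereProj e (w : V) = w := by
  apply Subtype.ext
  have := norm_eq_of_mem_sphere w
  rw [coe_sphereProj e (ne_zero_of_mem_unit_sphere w), this, inv_one, one_smul]

theorem sphereProj_eq {V : Type*} [NormedAddCommGroup V] [NormedSpace ℝ V]
    (e e' : Metric.sphere (0 : V) 1) {v : V} (hv : v ≠ 0) : sphereProj e v = sphereProj e' v :=
  Subtype.ext ((coe_sphereProj e hv).trans (coe_sphereProj e' hv).symm)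

theorem measurable_sphereProj {V : Type*} [NormedAddCommGroup V] [NormedSpace ℝ V]
    [MeasurableSpace V] [BorelSpace V] [SecondCountableTopology V] :
    Measurable fun q : Metric.sphere (0 : V) 1 × V ↦ sphereProj q.1 q.2 := by
  classical
  refine Measurable.subtype_mk ?_
  exact Measurable.ite (measurable_snd (measurableSet_singleton 0)) (by fun_prop) (by fun_prop)

namespace ModelGeometry

variable (G : ModelGeometry) {k : ℕ}

/-- The Euclidean direction, in the projective model, of the geodesic of `(x, w)`. -/
def flatDir (x : EuclideanSpace ℝ (Fin (k + 1)))
    (w : Metric.sphere (0 : EuclideanSpace ℝ (Fin (k + 1))) 1) :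
    Metric.sphere (0 : EuclideanSpace ℝ (Fin (k + 1))) 1 :=
  sphereProj w (G.flatDeriv x w)

theorem measurable_conformalFactor {n : ℕ} :
    Measurable (G.conformalFactor : EuclideanSpace ℝ (Fin n) → ℝ) := by
  cases G
  · exact measurable_const
  · change Measurable fun x : EuclideanSpace ℝ (Fin n) ↦ 2 / (1 - ‖x‖ ^ 2)
    fun_prop

theorem measurable_flatDir : Measurable fun v : EuclideanSpace ℝ (Fin (k + 1)) ×
    Metric.sphere (0 : EuclideanSpace ℝ (Fin (k + 1))) 1 ↦ G.flatDir v.1 v.2 := by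
  have hc := (G.continuous_chartScale (n := k + 1)).measurable
  have : Measurable fun v : EuclideanSpace ℝ (Fin (k + 1)) ×
      Metric.sphere (0 : EuclideanSpace ℝ (Fin (k + 1))) 1 ↦ G.flatDeriv v.1 v.2 := by
    simp_rw [flatDeriv_apply]
    fun_prop
  exact measurable_sphereProj.comp (measurable_snd.prodMk this)

theorem measurable_flatDir_right (x : EuclideanSpace ℝ (Fin (k + 1))) : Measurable (G.flatDir x) :=
  Measurable.of_uncurry_left (f := G.flatDir) G.measurable_flatDir

theorem coe_flatDir {x : EuclideanSpace ℝ (Fin (k + 1))} (hx : x ∈ G.domain (k + 1))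
    (w : Metric.sphere (0 : EuclideanSpace ℝ (Fin (k + 1))) 1) :
    (G.flatDir x w : EuclideanSpace ℝ (Fin (k + 1))) =
      ‖G.flatDeriv x w‖⁻¹ • G.flatDeriv x w :=
  coe_sphereProj _ ((map_ne_zero_iff _ (G.injective_flatDeriv hx)).2 (ne_zero_of_mem_unit_sphere w))

theorem measurable_flatForm {n : ℕ} :
    Measurable fun q : EuclideanSpace ℝ (Fin n) × EuclideanSpace ℝ (Fin n) ↦
      G.flatForm q.1 q.2 := by
  unfold flatForm
  fun_prop

theorem measurable_flatForm_right {n : ℕ} (y : EuclideanSpace ℝ (Fin n)) :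
    Measurable fun v : EuclideanSpace ℝ (Fin n) ↦ G.flatForm y v := by
  unfold flatForm
  fun_prop

theorem sqrt_flatForm_smul {n : ℕ} (y v : EuclideanSpace ℝ (Fin n)) {r : ℝ} (hr : 0 < r) :
    √(G.flatForm y (r • v)) = r * √(G.flatForm y v) := by
  rw [flatForm_smul, Real.sqrt_mul (sq_nonneg r), Real.sqrt_sq hr.le]

theorem sqrt_flatForm_flatDeriv {x : EuclideanSpace ℝ (Fin (k + 1))} (hx : x ∈ G.domain (k + 1))
    (w : Metric.sphere (0 : EuclideanSpace ℝ (Fin (k + 1))) 1) :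
    √(G.flatForm (G.flatMap x) (G.flatDeriv x w)) =
      G.chartScale x * G.flatFactor (G.flatMap x) := by
  rw [G.flatForm_flatDeriv hx, norm_eq_of_mem_sphere w, one_pow, mul_one, Real.sqrt_sq]
  exact (mul_pos (G.chartScale_pos x) (G.flatFactor_pos (G.flatMap_mem_domain hx))).le

/-- The angular measure at a point, in the projective model. -/
theorem lintegral_flatDir {x : EuclideanSpace ℝ (Fin (k + 1))} (hx : x ∈ G.domain (k + 1))
    {H : Metric.sphere (0 : EuclideanSpace ℝ (Fin (k + 1))) 1 → ENNReal} (hH : Measurable H) :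
    ∫⁻ u : Metric.sphere (0 : EuclideanSpace ℝ (Fin (k + 1))) 1,
        H u * ENNReal.ofReal (√(G.flatForm (G.flatMap x) u) ^ (k + 1))⁻¹
          ∂(volume : Measure (EuclideanSpace ℝ (Fin (k + 1)))).toSphere =
      ENNReal.ofReal (G.chartScale x ^ (k + 1) * G.flatFactor (G.flatMap x) *
        ((G.chartScale x * G.flatFactor (G.flatMap x)) ^ (k + 1))⁻¹) *
      ∫⁻ w, H (G.flatDir x w) ∂(volume : Measure (EuclideanSpace ℝ (Fin (k + 1)))).toSphere := by
  obtain ⟨e⟩ : Nonempty (Metric.sphere (0 : EuclideanSpace ℝ (Fin (k + 1))) 1) :=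
    ⟨⟨EuclideanSpace.single 0 1, by simp⟩⟩
  have hc := G.chartScale_pos x
  have hs := G.flatFactor_pos (G.flatMap_mem_domain hx)
  -- The homogeneous extension of degree `-(k + 1)`, to which the linear change of variables on the
  -- sphere applies. After substituting `flatDeriv x` the form is constant on the sphere and leaves
  -- the integral.
  let g : EuclideanSpace ℝ (Fin (k + 1)) → ENNReal := fun v ↦
    H (sphereProj e v) * ENNReal.ofReal (√(G.flatForm (G.flatMap x) v) ^ (k + 1))⁻¹
  have hpr : Measurable (sphereProj e) := measurable_sphereProj.comp
    (measurable_const.prodMk measurable_id)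
  have hfm := G.measurable_flatForm_right (G.flatMap x)
  have hg : Measurable g := by fun_prop
  have hgh : ∀ (r : ℝ) (v : EuclideanSpace ℝ (Fin (k + 1))), 0 < r → v ≠ 0 →
      g (r • v) = ENNReal.ofReal (r ^ Module.finrank ℝ (EuclideanSpace ℝ (Fin (k + 1))))⁻¹ * g v := by
    intro r v hr hv
    simp only [g]
    rw [sphereProj_smul e hv hr, G.sqrt_flatForm_smul _ _ hr, mul_pow, mul_inv,
      ENNReal.ofReal_mul (by positivity), finrank_euclideanSpace, Fintype.card_fin]
    ring
  have h := lintegral_sphere_comp_linear hg hgh (G.injective_flatDeriv hx)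
  simp only [g, sphereProj_coe, sqrt_flatForm_flatDeriv G hx] at h
  have hfd : ∀ w : Metric.sphere (0 : EuclideanSpace ℝ (Fin (k + 1))) 1,
      sphereProj e (G.flatDeriv x w) = G.flatDir x w := fun w ↦
    sphereProj_eq e w ((map_ne_zero_iff _ (G.injective_flatDeriv hx)).2
      (ne_zero_of_mem_unit_sphere w))
  have hm : Measurable fun w ↦ H (G.flatDir x w) :=
    hH.comp (G.measurable_flatDir_right x)
  simp_rw [hfd] at h
  rw [h, lintegral_mul_const _ hm, G.det_flatDeriv hx, abs_of_pos (by positivity),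
    ENNReal.ofReal_mul (p := G.chartScale x ^ (k + 1) * _) (by positivity)]
  ring

/-- The Liouville measure in the projective model. -/
theorem lintegral_liouville {P : Set (EuclideanSpace ℝ (Fin (k + 1)))} (hP : MeasurableSet P)
    (hPd : P ⊆ G.domain (k + 1))
    {H : EuclideanSpace ℝ (Fin (k + 1)) × Metric.sphere (0 : EuclideanSpace ℝ (Fin (k + 1))) 1 →
      ENNReal} (hH : Measurable H) :
    ∫⁻ v, H (G.flatMap v.1, G.flatDir v.1 v.2) ∂(G.liouville P) =
      ∫⁻ y in G.flatMap '' P, ENNReal.ofReal (G.flatFactor y ^ 2)⁻¹ *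
        ∫⁻ u : Metric.sphere (0 : EuclideanSpace ℝ (Fin (k + 1))) 1,
          H (y, u) * ENNReal.ofReal (√(G.flatForm y u) ^ (k + 1))⁻¹
            ∂(volume : Measure (EuclideanSpace ℝ (Fin (k + 1)))).toSphere := by
  have hdir := G.measurable_flatDir (k := k)
  have hfm := (G.continuous_flatMap (n := k + 1)).measurable
  have hcf := G.measurable_conformalFactor (n := k + 1)
  have hm : Measurable fun v : EuclideanSpace ℝ (Fin (k + 1)) ×
      Metric.sphere (0 : EuclideanSpace ℝ (Fin (k + 1))) 1 ↦
        H (G.flatMap v.1, G.flatDir v.1 v.2) := by fun_prop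
  rw [liouville, lintegral_prod _ hm.aemeasurable, volumeMeasure,
    restrict_withDensity hP, lintegral_withDensity_eq_lintegral_mul _ (by fun_prop)
      hm.lintegral_prod_right',
    lintegral_image_eq_lintegral_abs_det_fderiv_mul volume hP
      (fun x _ ↦ (G.hasFDerivAt_flatMap x).hasFDerivWithinAt) (G.injOn_flatMap.mono hPd)]
  refine setLIntegral_congr_fun hP fun x hx ↦ ?_
  have hxd := hPd hx
  have hc := G.chartScale_pos x
  have hs := G.flatFactor_pos (G.flatMap_mem_domain hxd)
  have hl := G.conformalFactor_mul_flatFactor hxd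
  have hl' : G.conformalFactor x = G.chartScale x / G.flatFactor (G.flatMap x) := by
    rw [← hl]
    field_simp
  simp only [Pi.mul_apply]
  rw [G.lintegral_flatDir hxd (H := fun u ↦ H (G.flatMap x, u)) (by fun_prop), ← mul_assoc,
    ← mul_assoc, ← ENNReal.ofReal_mul (abs_nonneg _), ← ENNReal.ofReal_mul (by positivity),
    ← ENNReal.ofReal_pow (by rw [hl']; positivity), hl', G.det_flatDeriv hxd,
    abs_of_pos (by positivity)]
  congr 2
  -- With `λ = c / s` for the chart scale `c` and the flat factor `s`, the determinant `c^n s`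
  -- occurs twice, once for `dy` and once for `du`. All powers of `c` but `c^n` cancel, and the
  -- leftover is `s⁻²`.
  simp only [div_pow, mul_pow]
  field_simp

/-- The density, relative to the Euclidean one, of the area measure of the hyperplane with unit
normal `ν` in the projective model. -/
def flatAreaDensity {n : ℕ} (ν y : EuclideanSpace ℝ (Fin n)) : ℝ :=
  √(1 - G.curv * ⟪ν, y⟫ ^ 2) / G.flatFactor y ^ n

/-- The flux of the Liouville measure through a hyperplane, in the projective model. -/
theorem lintegral_flux {y ν : EuclideanSpace ℝ (Fin (k + 1))} (hy : y ∈ G.domain (k + 1))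
    (hν : ‖ν‖ = 1) :
    ∫⁻ u : Metric.sphere (0 : EuclideanSpace ℝ (Fin (k + 1))) 1,
        ENNReal.ofReal ⟪ν, (u : EuclideanSpace ℝ (Fin (k + 1)))⟫ *
          ENNReal.ofReal (√(G.flatForm y u) ^ (k + 2))⁻¹
          ∂(volume : Measure (EuclideanSpace ℝ (Fin (k + 1)))).toSphere =
      volume (Metric.ball (0 : EuclideanSpace ℝ (Fin k)) 1) *
        ENNReal.ofReal (G.flatAreaDensity ν y) := by
  obtain ⟨x, hx, rfl⟩ : ∃ x ∈ G.domain (k + 1), G.flatMap x = y :=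
    ⟨_, G.flatInv_mem_domain hy, G.flatMap_flatInv hy⟩
  have hc := G.chartScale_pos x
  have hs := G.flatFactor_pos hy
  -- The inner product has degree 1, so the exponent `k + 2` is the one giving total degree `-(k +
  -- 1)`. After the substitution, the integral is a hemisphere integral about the image of `ν`,
  -- whose norm supplies the square root in `flatAreaDensity`.
  let g : EuclideanSpace ℝ (Fin (k + 1)) → ENNReal := fun v ↦
    ENNReal.ofReal ⟪ν, v⟫ * ENNReal.ofReal (√(G.flatForm (G.flatMap x) v) ^ (k + 2))⁻¹
  have hfm := G.measurable_flatForm_right (G.flatMap x)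
  have hg : Measurable g := by fun_prop
  have hgh : ∀ (r : ℝ) (v : EuclideanSpace ℝ (Fin (k + 1))), 0 < r → v ≠ 0 →
      g (r • v) = ENNReal.ofReal (r ^ Module.finrank ℝ (EuclideanSpace ℝ (Fin (k + 1))))⁻¹ * g v := by
    intro r v hr hv
    simp only [g]
    rw [inner_smul_right, ENNReal.ofReal_mul hr.le, G.sqrt_flatForm_smul _ _ hr, mul_pow, mul_inv,
      ENNReal.ofReal_mul (by positivity), finrank_euclideanSpace, Fintype.card_fin,
      show (r ^ (k + 1))⁻¹ = r * (r ^ (k + 2))⁻¹ by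
        rw [pow_succ r (k + 1)]; field_simp, ENNReal.ofReal_mul hr.le]
    ring
  have h := lintegral_sphere_comp_linear hg hgh (G.injective_flatDeriv hx)
  simp only [g, sqrt_flatForm_flatDeriv G hx, inner_flatDeriv] at h
  set N := ‖G.flatDeriv x ν‖ with hN
  have hN0 : 0 < N := norm_pos_iff.2 ((map_ne_zero_iff _ (G.injective_flatDeriv hx)).2
    (norm_ne_zero_iff.1 (by rw [hν]; exact one_ne_zero)))
  have hNe : N = G.chartScale x * √(1 - G.curv * ⟪ν, G.flatMap x⟫ ^ 2) := by
    rw [hN, ← Real.sqrt_sq (norm_nonneg _), norm_sq_flatDeriv, hν, one_pow, real_inner_comm,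
      Real.sqrt_mul (by positivity), Real.sqrt_sq hc.le]
  have he : ∀ w : Metric.sphere (0 : EuclideanSpace ℝ (Fin (k + 1))) 1,
      ENNReal.ofReal ⟪G.flatDeriv x ν, w⟫ =
        ENNReal.ofReal N * ENNReal.ofReal ⟪N⁻¹ • G.flatDeriv x ν, w⟫ := by
    intro w
    rw [← ENNReal.ofReal_mul hN0.le, real_inner_smul_left, mul_inv_cancel_left₀ hN0.ne']
  simp_rw [he] at h
  rw [h, lintegral_mul_const _ (by fun_prop), lintegral_const_mul _ (by fun_prop),
    lintegral_sphere_inner (by rw [norm_smul, norm_inv, norm_norm, inv_mul_cancel₀ hN0.ne']),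
    G.det_flatDeriv hx, abs_of_pos (by positivity), flatAreaDensity,
    show ∀ a b c d : ENNReal, a * (b * c * d) = c * (a * b * d) by intros; ring,
    ← ENNReal.ofReal_mul (by positivity), ← ENNReal.ofReal_mul (by positivity), hNe]
  congr 2
  field_simp
  ring

end ModelGeometry

end FlatMeasure

/-! ### Hyperbolic geodesics as straight lines. -/

noncomputable section FlatGeodesic

namespace ModelGeometry

variable (G : ModelGeometry) {k : ℕ}

/-- The Riemannian norm of `u` at `y` in the projective model, for `u` in a line through `y`. -/
def flatSpeed {n : ℕ} (y u : EuclideanSpace ℝ (Fin n)) : ℝ :=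
  √(G.flatForm y u) / G.flatFactor y ^ 2

theorem flatSpeed_pos {n : ℕ} {y u : EuclideanSpace ℝ (Fin n)} (hy : y ∈ G.domain n) (hu : u ≠ 0) :
    0 < G.flatSpeed y u :=
  div_pos (Real.sqrt_pos.2 (G.flatForm_pos hy hu)) (pow_pos (G.flatFactor_pos hy) 2)

section Hyperbolic

/-- The denominator in the parametrization of a geodesic in the projective model. -/
def geodesicDenom {n : ℕ} (x w : EuclideanSpace ℝ (Fin n)) (t : ℝ) : ℝ :=
  (1 + ‖x‖ ^ 2) * Real.cosh t + 2 * ⟪x, w⟫ * Real.sinh t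

theorem le_geodesicDenom {n : ℕ} {x w : EuclideanSpace ℝ (Fin n)} (hw : ‖w‖ = 1) (t : ℝ) :
    (1 - ‖x‖) ^ 2 * Real.cosh t ≤ geodesicDenom x w t := by
  have h1 : |⟪x, w⟫| ≤ ‖x‖ := by simpa [hw] using abs_real_inner_le_norm x w
  have h2 : |Real.sinh t| ≤ Real.cosh t := by
    rw [Real.abs_sinh]
    exact (Real.sinh_lt_cosh _).le.trans (Real.cosh_abs t).le
  have h3 : |⟪x, w⟫ * Real.sinh t| ≤ ‖x‖ * Real.cosh t := by
    rw [abs_mul]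
    exact mul_le_mul h1 h2 (abs_nonneg _) (norm_nonneg _)
  have h4 := (abs_le.1 h3).1
  rw [geodesicDenom]
  linarith

theorem geodesicDenom_pos {n : ℕ} {x w : EuclideanSpace ℝ (Fin n)} (hx : ‖x‖ < 1) (hw : ‖w‖ = 1)
    (t : ℝ) : 0 < geodesicDenom x w t := by
  refine lt_of_lt_of_le ?_ (le_geodesicDenom hw t)
  have := Real.cosh_pos t
  have : 0 < 1 - ‖x‖ := by linarith
  positivity

/-- On the hyperboloid a geodesic is a combination of its initial point and velocity with
coefficients `cosh t` and `sinh t`. `geodesicDenom` is its time coordinate up to the factor `1 -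
‖x‖²`, and projecting from the origin gives a line. -/
theorem geodesic_hyperbolic_formulas {n : ℕ} {x w : EuclideanSpace ℝ (Fin n)} (hx : ‖x‖ < 1)
    (hw : ‖w‖ = 1) (t : ℝ) :
    (1 - ‖hyperbolic.geodesic x w t‖ ^ 2) / (1 + ‖hyperbolic.geodesic x w t‖ ^ 2) =
        (1 - ‖x‖ ^ 2) / geodesicDenom x w t ∧
      ‖hyperbolic.geodesic x w t‖ ^ 2 < 1 ∧
      hyperbolic.flatMap (hyperbolic.geodesic x w t) = hyperbolic.flatMap x +
        ((1 - ‖x‖ ^ 2) * (1 + ‖x‖ ^ 2) / 2 * Real.sinh t / geodesicDenom x w t) •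
          hyperbolic.flatDeriv x w := by
  have hq := geodesicDenom_pos hx hw t
  have hr : ‖x‖ ^ 2 < 1 := by
    rw [sq_lt_one_iff₀ (norm_nonneg _)]
    exact hx
  have hr0 : 0 ≤ ‖x‖ ^ 2 := sq_nonneg _
  have hβ : ⟪x, w⟫ ^ 2 ≤ ‖x‖ ^ 2 := by
    have := abs_real_inner_le_norm x w
    rw [hw, mul_one] at this
    exact sq_le_sq.2 (by rwa [abs_norm])
  have hC := Real.cosh_pos (t / 2)
  have ht : t = 2 * (t / 2) := by ring
  -- Everything is rewritten in `a = tanh (t / 2)` and `C = cosh (t / 2)`, linked by `C² = 1 / (1 -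
  -- a²)`, so that the claims become rational identities.
  have hq' : geodesicDenom x w t = Real.cosh (t / 2) ^ 2 *
      ((1 + ‖x‖ ^ 2) * (1 + Real.tanh (t / 2) ^ 2) + 4 * Real.tanh (t / 2) * ⟪x, w⟫) := by
    rw [geodesicDenom, Real.tanh_eq_sinh_div_cosh]
    conv_lhs => rw [ht, Real.cosh_two_mul, Real.sinh_two_mul]
    field_simp
    ring
  have hsinh : Real.sinh t = 2 * Real.tanh (t / 2) * Real.cosh (t / 2) ^ 2 := by
    rw [Real.tanh_eq_sinh_div_cosh]
    conv_lhs => rw [ht, Real.sinh_two_mul]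
    field_simp
  have ha2 : 1 - Real.tanh (t / 2) ^ 2 = (Real.cosh (t / 2) ^ 2)⁻¹ := by
    rw [Real.tanh_eq_sinh_div_cosh]
    field_simp
    rw [Real.cosh_sq]
    ring
  rw [hq'] at hq ⊢
  rw [hsinh]
  generalize Real.cosh (t / 2) = C at *
  have hC2 : 0 < C ^ 2 := by positivity
  have hgeo : hyperbolic.geodesic x w t = mobiusAdd x (Real.tanh (t / 2) • w) := rfl
  have haw : ‖Real.tanh (t / 2) • w‖ ^ 2 = Real.tanh (t / 2) ^ 2 := by
    rw [norm_smul, hw, mul_one, Real.norm_eq_abs, sq_abs]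
  rw [hgeo, mobiusAdd, haw, inner_smul_right]
  generalize Real.tanh (t / 2) = a at *
  have hM : 0 < (1 + ‖x‖ ^ 2) * (1 + a ^ 2) + 4 * a * ⟪x, w⟫ := pos_of_mul_pos_right hq hC2.le
  have ha1 : 0 < 1 - a ^ 2 := by rw [ha2]; positivity
  have hCa : C ^ 2 = (1 - a ^ 2)⁻¹ := by rw [ha2, inv_inv]
  set β := ⟪x, w⟫ with hβ'
  set R := ‖x‖ ^ 2 with hR
  -- By Cauchy–Schwarz the Möbius denominator is at least `(1 + a β)²`, and `a β > -1`.
  have hN : 0 < 1 + 2 * (a * β) + R * a ^ 2 := by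
    have : (a * β) ^ 2 ≤ R * a ^ 2 := by
      rw [mul_pow, mul_comm]
      gcongr
    have h1 : R * a ^ 2 < 1 := by nlinarith
    have h2 : 0 ≤ R * a ^ 2 := by positivity
    have h3 : -1 < a * β := by nlinarith
    nlinarith [sq_nonneg (1 + a * β)]
  have hnorm : ‖(1 + 2 * (a * β) + a ^ 2) • x + (1 - R) • a • w‖ ^ 2 =
      (1 + 2 * (a * β) + a ^ 2) ^ 2 * R +
        2 * ((1 + 2 * (a * β) + a ^ 2) * ((1 - R) * a) * β) + ((1 - R) * a) ^ 2 := by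
    rw [smul_smul, norm_add_sq_real, norm_smul, norm_smul, inner_smul_right, real_inner_smul_left,
      hw, mul_pow, mul_pow, Real.norm_eq_abs, Real.norm_eq_abs, sq_abs, sq_abs, ← hβ', ← hR]
    ring
  set N := 1 + 2 * (a * β) + R * a ^ 2 with hNdef
  set M := (1 + R) * (1 + a ^ 2) + 4 * a * β with hMdef
  have hm : ‖N⁻¹ • ((1 + 2 * (a * β) + a ^ 2) • x + (1 - R) • a • w)‖ ^ 2 =
      1 - (1 - R) * (1 - a ^ 2) / N := by
    rw [norm_smul, mul_pow, hnorm, norm_inv, Real.norm_of_nonneg hN.le, inv_pow]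
    field_simp
    rw [hNdef]
    ring
  have hm1 : 1 + ‖N⁻¹ • ((1 + 2 * (a * β) + a ^ 2) • x + (1 - R) • a • w)‖ ^ 2 = M / N := by
    rw [hm]
    field_simp
    rw [hNdef, hMdef]
    ring
  have hR1 : 0 < 1 - R := by linarith
  refine ⟨?_, ?_, ?_⟩
  · rw [hm1, hm, hCa]
    field_simp
    ring
  · rw [hm]
    have : 0 < (1 - R) * (1 - a ^ 2) / N := by positivity
    linarith
  · rw [flatMap, chartScale, hm1, flatDeriv_apply, flatMap, chartScale, curv, ← hR, ← hβ']
    have h1R : 1 + R ≠ 0 := by positivity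
    simp only [smul_smul, smul_add, smul_sub]
    rw [← add_sub_assoc, add_sub_right_comm, ← sub_smul]
    congr 2
    · field_simp
      rw [hMdef]
      ring
    · field_simp

/-- `σ t` is the signed Euclidean distance travelled along the Klein line at hyperbolic time `t`, so
its derivative is the inverse of the Riemannian speed. That every point of the line in the ball is
reached expresses completeness of the geodesic. -/
theorem exists_flat_param_hyperbolic {x : EuclideanSpace ℝ (Fin (k + 1))}
    (hx : x ∈ hyperbolic.domain (k + 1))
    (w : Metric.sphere (0 : EuclideanSpace ℝ (Fin (k + 1))) 1) :
    ∃ σ : ℝ → ℝ, (∀ t, hyperbolic.geodesic x w t ∈ hyperbolic.domain (k + 1)) ∧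
      (∀ t, hyperbolic.flatMap (hyperbolic.geodesic x w t) =
        hyperbolic.flatMap x + σ t • (hyperbolic.flatDir x w : EuclideanSpace ℝ (Fin (k + 1)))) ∧
      (∀ t, HasDerivAt σ (hyperbolic.flatSpeed (hyperbolic.flatMap x +
        σ t • (hyperbolic.flatDir x w : EuclideanSpace ℝ (Fin (k + 1))))
          (hyperbolic.flatDir x w))⁻¹ t) ∧
      ∀ s : ℝ, hyperbolic.flatMap x + s • (hyperbolic.flatDir x w : EuclideanSpace ℝ (Fin (k + 1))) ∈
        hyperbolic.domain (k + 1) → ∃ t, σ t = s := by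
  have hw := norm_eq_of_mem_sphere w
  have hx1 : ‖x‖ < 1 := by simpa [domain] using hx
  have hr : 0 < 1 - ‖x‖ ^ 2 := by simpa [curv] using hyperbolic.mem_domain_iff.1 hx
  have hq := geodesicDenom_pos hx1 hw
  have hA0 : hyperbolic.flatDeriv x w ≠ 0 :=
    (map_ne_zero_iff _ (hyperbolic.injective_flatDeriv hx)).2 (ne_zero_of_mem_unit_sphere w)
  have hA : 0 < ‖hyperbolic.flatDeriv x w‖ := norm_pos_iff.2 hA0
  have hu := hyperbolic.coe_flatDir hx w
  set A := hyperbolic.flatDeriv x w with hAdef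
  let σ : ℝ → ℝ := fun t ↦
    ‖A‖ * ((1 - ‖x‖ ^ 2) * (1 + ‖x‖ ^ 2) / 2 * Real.sinh t / geodesicDenom x w t)
  have hdom : ∀ t, hyperbolic.geodesic x w t ∈ hyperbolic.domain (k + 1) := by
    intro t
    rw [mem_domain_iff, curv, one_mul]
    linarith [(geodesic_hyperbolic_formulas hx1 hw t).2.1]
  have hmap : ∀ t, hyperbolic.flatMap (hyperbolic.geodesic x w t) = hyperbolic.flatMap x +
      σ t • (hyperbolic.flatDir x w : EuclideanSpace ℝ (Fin (k + 1))) := by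
    intro t
    rw [(geodesic_hyperbolic_formulas hx1 hw t).2.2, hu, smul_smul]
    congr 2
    simp only [σ]
    field_simp
  have hfac : ∀ t, hyperbolic.flatFactor (hyperbolic.flatMap x +
      σ t • (hyperbolic.flatDir x w : EuclideanSpace ℝ (Fin (k + 1)))) =
        (1 - ‖x‖ ^ 2) / geodesicDenom x w t := by
    intro t
    rw [← hmap, flatFactor_flatMap_hyperbolic (hdom t), (geodesic_hyperbolic_formulas hx1 hw t).1]
  have hform : √(hyperbolic.flatForm (hyperbolic.flatMap x) (hyperbolic.flatDir x w)) =
      ‖A‖⁻¹ * (2 / (1 + ‖x‖ ^ 2) * ((1 - ‖x‖ ^ 2) / (1 + ‖x‖ ^ 2))) := by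
    rw [hu, sqrt_flatForm_smul _ _ _ (inv_pos.2 hA), hAdef, sqrt_flatForm_flatDeriv _ hx,
      flatFactor_flatMap_hyperbolic hx]
    rfl
  have hderiv : ∀ t, HasDerivAt σ (hyperbolic.flatSpeed (hyperbolic.flatMap x +
        σ t • (hyperbolic.flatDir x w : EuclideanSpace ℝ (Fin (k + 1))))
          (hyperbolic.flatDir x w))⁻¹ t := by
    intro t
    have hq' : HasDerivAt (geodesicDenom x w)
        ((1 + ‖x‖ ^ 2) * Real.sinh t + 2 * ⟪x, (w : EuclideanSpace ℝ (Fin (k + 1)))⟫ * Real.cosh t)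
        t :=
      ((Real.hasDerivAt_cosh t).const_mul _).add ((Real.hasDerivAt_sinh t).const_mul _)
    have h1 := (((Real.hasDerivAt_sinh t).const_mul
      ((1 - ‖x‖ ^ 2) * (1 + ‖x‖ ^ 2) / 2)).div hq' (hq t).ne').const_mul ‖A‖
    refine h1.congr_deriv ?_
    rw [flatSpeed, flatForm_add_smul, hform, hfac]
    have hqt := hq t
    have hcs := Real.cosh_sq t
    -- The numerator of the derivative is a Wronskian of solutions of `y'' = y`, hence constant.
    have : Real.cosh t * geodesicDenom x w t - Real.sinh t * ((1 + ‖x‖ ^ 2) * Real.sinh t +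
        2 * ⟪x, (w : EuclideanSpace ℝ (Fin (k + 1)))⟫ * Real.cosh t) = 1 + ‖x‖ ^ 2 := by
      rw [geodesicDenom]
      linear_combination (1 + ‖x‖ ^ 2) * hcs
    have h2 : (1 - ‖x‖ ^ 2) * (1 + ‖x‖ ^ 2) / 2 * Real.cosh t * geodesicDenom x w t -
        (1 - ‖x‖ ^ 2) * (1 + ‖x‖ ^ 2) / 2 * Real.sinh t * ((1 + ‖x‖ ^ 2) * Real.sinh t +
          2 * ⟪x, (w : EuclideanSpace ℝ (Fin (k + 1)))⟫ * Real.cosh t) =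
        (1 - ‖x‖ ^ 2) * (1 + ‖x‖ ^ 2) / 2 * (1 + ‖x‖ ^ 2) := by
      linear_combination (1 - ‖x‖ ^ 2) * (1 + ‖x‖ ^ 2) / 2 * this
    rw [h2]
    field_simp
  refine ⟨σ, hdom, hmap, hderiv, fun s hs ↦ ?_⟩
  -- If `s` is missed, `σ` never passes it, so the geodesic stays over the segment from 0 to `s` for
  -- all times of the sign of `s`. The flat factor has a positive minimum `δ` there, yet along the
  -- geodesic it is `(1 - ‖x‖²) / geodesicDenom`, which tends to 0 like `1 / cosh t`.
  by_contra hns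
  have hcont : Continuous σ := continuous_iff_continuousAt.2 fun t ↦ (hderiv t).continuousAt
  have hoc : (Set.range σ).OrdConnected := (isPreconnected_range hcont).ordConnected
  have h00 : σ 0 = 0 := by simp [σ]
  have hseg : IsCompact ((fun s : ℝ ↦ hyperbolic.flatMap x +
      s • (hyperbolic.flatDir x w : EuclideanSpace ℝ (Fin (k + 1)))) '' Set.uIcc 0 s) :=
    isCompact_uIcc.image (by fun_prop)
  obtain ⟨y₀, ⟨s₀, hs₀, rfl⟩, hmin⟩ := hseg.exists_isMinOn
    (Set.nonempty_uIcc.image _) hyperbolic.continuous_flatFactor.continuousOn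
  have hδ : 0 < hyperbolic.flatFactor (hyperbolic.flatMap x +
      s₀ • (hyperbolic.flatDir x w : EuclideanSpace ℝ (Fin (k + 1)))) := by
    refine hyperbolic.flatFactor_pos ?_
    have h0 := hyperbolic.flatMap_mem_domain hx
    rw [← segment_eq_uIcc] at hs₀
    obtain ⟨c, d, hc, hd, hcd, rfl⟩ := hs₀
    have := hyperbolic.convex_domain h0 hs hc hd hcd
    convert this using 1
    simp only [smul_eq_mul, mul_zero, zero_add, smul_add, ← add_assoc, ← add_smul, hcd, one_smul,
      smul_smul]
  set δ := hyperbolic.flatFactor (hyperbolic.flatMap x +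
      s₀ • (hyperbolic.flatDir x w : EuclideanSpace ℝ (Fin (k + 1))))
  have hub : ∀ t, σ t ∈ Set.uIcc 0 s →
      Real.cosh t ≤ (1 - ‖x‖ ^ 2) / δ / (1 - ‖x‖) ^ 2 := by
    intro t ht
    have h1 : δ ≤ _ := hmin ⟨σ t, ht, rfl⟩
    simp only [hfac] at h1
    have h2 := le_geodesicDenom (x := x) hw t
    have h3 : 0 < 1 - ‖x‖ := by linarith
    rw [le_div_iff₀ (hq t)] at h1
    rw [le_div_iff₀ (by positivity), le_div_iff₀ hδ]
    calc Real.cosh t * (1 - ‖x‖) ^ 2 * δ = δ * ((1 - ‖x‖) ^ 2 * Real.cosh t) := by ring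
      _ ≤ δ * geodesicDenom x w t := by gcongr
      _ ≤ _ := h1
  obtain ⟨T, hT0, hT⟩ : ∃ T : ℝ, 0 ≤ T ∧ (1 - ‖x‖ ^ 2) / δ / (1 - ‖x‖) ^ 2 < Real.cosh T := by
    have h1 : ∀ᶠ T in Filter.atTop, (1 - ‖x‖ ^ 2) / δ / (1 - ‖x‖) ^ 2 < Real.exp T / 2 :=
      (Real.tendsto_exp_atTop.atTop_div_const two_pos).eventually_gt_atTop _
    obtain ⟨T, hT1, hT2⟩ := (h1.and (Filter.eventually_ge_atTop 0)).exists
    refine ⟨T, hT2, hT1.trans ?_⟩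
    rw [Real.cosh_eq]
    have := Real.exp_pos (-T)
    linarith
  have hsgn : ∀ t, 0 ≤ ‖A‖ * ((1 - ‖x‖ ^ 2) * (1 + ‖x‖ ^ 2) / 2) / geodesicDenom x w t := by
    intro t
    have := hq t
    positivity
  have hσ : ∀ t, σ t =
      ‖A‖ * ((1 - ‖x‖ ^ 2) * (1 + ‖x‖ ^ 2) / 2) / geodesicDenom x w t * Real.sinh t := by
    intro t
    simp only [σ]
    ring
  rcases le_total 0 s with h0s | h0s
  · have hlt : σ T < s := by
      by_contra hge
      exact hns (hoc.out ⟨0, h00⟩ ⟨T, rfl⟩ ⟨h0s, not_lt.1 hge⟩)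
    have hT1 : 0 ≤ σ T := by
      rw [hσ]
      exact mul_nonneg (hsgn T) (Real.sinh_nonneg_iff.2 hT0)
    exact absurd (hub T (Set.mem_uIcc_of_le hT1 hlt.le)) (not_le.2 hT)
  · have hlt : s < σ (-T) := by
      by_contra hge
      exact hns (hoc.out ⟨-T, rfl⟩ ⟨0, h00⟩ ⟨not_lt.1 hge, h0s⟩)
    have hT1 : σ (-T) ≤ 0 := by
      rw [hσ]
      exact mul_nonpos_of_nonneg_of_nonpos (hsgn _)
        (Real.sinh_nonpos_iff.2 (neg_nonpos.2 hT0))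
    have := hub (-T) (Set.mem_uIcc_of_ge hlt.le hT1)
    rw [Real.cosh_neg] at this
    exact absurd this (not_le.2 hT)

end Hyperbolic

/-- In the projective model geodesics are straight lines, of known speed. -/
theorem exists_flat_param {x : EuclideanSpace ℝ (Fin (k + 1))} (hx : x ∈ G.domain (k + 1))
    (w : Metric.sphere (0 : EuclideanSpace ℝ (Fin (k + 1))) 1) :
    ∃ σ : ℝ → ℝ, (∀ t, G.geodesic x w t ∈ G.domain (k + 1)) ∧
      (∀ t, G.flatMap (G.geodesic x w t) =
        G.flatMap x + σ t • (G.flatDir x w : EuclideanSpace ℝ (Fin (k + 1)))) ∧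
      (∀ t, HasDerivAt σ (G.flatSpeed (G.flatMap x +
        σ t • (G.flatDir x w : EuclideanSpace ℝ (Fin (k + 1)))) (G.flatDir x w))⁻¹ t) ∧
      ∀ s : ℝ, G.flatMap x + s • (G.flatDir x w : EuclideanSpace ℝ (Fin (k + 1))) ∈
        G.domain (k + 1) → ∃ t, σ t = s := by
  cases G
  · have hd : euclidean.flatDir x w = w := by
      rw [flatDir, flatDeriv_apply]
      simp [chartScale, curv, sphereProj_coe]
    refine ⟨id, fun _ ↦ trivial, fun t ↦ ?_, fun t ↦ ?_, fun s _ ↦ ⟨s, rfl⟩⟩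
    · rw [hd]
      simp [flatMap, chartScale, geodesic]
    · rw [hd]
      simpa [flatSpeed, flatForm, flatFactor, curv] using hasDerivAt_id t
  · exact exists_flat_param_hyperbolic hx w

end ModelGeometry

end FlatGeodesic

/-! ### Riemannian area of hyperplanes in the projective model. -/

section FlatArea

namespace ModelGeometry

variable (G : ModelGeometry) {k n : ℕ}

/-- Both sides are `2 (cosh d - 1)` for the hyperbolic distance `d`, in the ball model and in the
Klein model. This makes a distance-preserving map conformal in the strong sense of
`setLIntegral_image_of_conformal`. -/
theorem dist_sq_mul_conformalFactor {x x' : EuclideanSpace ℝ (Fin n)}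
    (hx : x ∈ hyperbolic.domain n) (hx' : x' ∈ hyperbolic.domain n) :
    dist x x' ^ 2 * (hyperbolic.conformalFactor x * hyperbolic.conformalFactor x') =
      2 * ((1 - ⟪hyperbolic.flatMap x, hyperbolic.flatMap x'⟫) /
        (hyperbolic.flatFactor (hyperbolic.flatMap x) *
          hyperbolic.flatFactor (hyperbolic.flatMap x')) - 1) := by
  rw [flatFactor_flatMap_hyperbolic hx, flatFactor_flatMap_hyperbolic hx']
  rw [mem_domain_iff, curv, one_mul] at hx hx'
  rw [dist_eq_norm, norm_sub_sq_real, conformalFactor, conformalFactor, flatMap, flatMap,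
    chartScale, chartScale, real_inner_smul_left, inner_smul_right]
  have h1 : (1 + ‖x‖ ^ 2) ≠ 0 := by positivity
  have h2 : (1 + ‖x'‖ ^ 2) ≠ 0 := by positivity
  field_simp
  ring

theorem conformalFactor_pos {x : EuclideanSpace ℝ (Fin n)} (hx : x ∈ G.domain n) :
    0 < G.conformalFactor x := by
  have h1 := G.conformalFactor_mul_flatFactor hx
  have h2 := G.flatFactor_pos (G.flatMap_mem_domain hx)
  exact pos_of_mul_pos_left (by rw [h1]; exact G.chartScale_pos x) h2.le

variable {ν : EuclideanSpace ℝ (Fin (k + 1))}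
  {Φ : (ℝ × EuclideanSpace ℝ (Fin k)) ≃L[ℝ] EuclideanSpace ℝ (Fin (k + 1))}

/-- A hyperplane of hyperbolic space is a copy of the space of one dimension less. Parametrizing it
isometrically by the `k`-dimensional ball reduces Hausdorff measure to Lebesgue measure, and a
second change of variables passes to the Klein coordinate `z`. -/
theorem lintegral_conformalFactor_hyperbolic (hΦ : IsFrame ν Φ) {p : ℝ}
    {A : Set (EuclideanSpace ℝ (Fin k))} (hA : MeasurableSet A)
    (hAd : ∀ z ∈ A, Φ (p, z) ∈ hyperbolic.domain (k + 1)) :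
    ∫⁻ x in hyperbolic.flatInv '' ((fun z ↦ Φ (p, z)) '' A),
        ENNReal.ofReal (hyperbolic.conformalFactor x) ^ k ∂μHE[k] =
      ∫⁻ z in A, ENNReal.ofReal (hyperbolic.flatAreaDensity ν (Φ (p, z))) := by
  rcases A.eq_empty_or_nonempty with rfl | ⟨z₀, hz₀⟩
  · simp
  have hdom : ∀ z, Φ (p, z) ∈ hyperbolic.domain (k + 1) ↔ ‖z‖ ^ 2 < 1 - p ^ 2 := by
    intro z
    rw [mem_domain_iff, curv, one_mul, hΦ.norm_sq]
    constructor <;> intro h <;> simp only at * <;> linarith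
  have hp : 0 < 1 - p ^ 2 := (sq_nonneg ‖z₀‖).trans_lt ((hdom z₀).1 (hAd z₀ hz₀))
  set R := √(1 - p ^ 2) with hRdef
  have hR : 0 < R := Real.sqrt_pos.2 hp
  have hR2 : R ^ 2 = 1 - p ^ 2 := Real.sq_sqrt hp.le
  -- The slice of the ball at height `p` is a ball of radius `R`: `κ` is the `k`-dimensional Klein
  -- chart scaled to fill it. In the formula for `cosh d`, numerator and denominator both acquire
  -- `R²`, so `f` preserves distances.
  let κ : EuclideanSpace ℝ (Fin k) → EuclideanSpace ℝ (Fin k) := fun z ↦ R • hyperbolic.flatMap z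
  have hκc : Continuous κ := (hyperbolic.continuous_flatMap).const_smul R
  let f : EuclideanSpace ℝ (Fin k) → EuclideanSpace ℝ (Fin (k + 1)) := fun z ↦
    hyperbolic.flatInv (Φ (p, κ z))
  have hf : Continuous f := hyperbolic.continuous_flatInv.comp (by fun_prop)
  let A' : Set (EuclideanSpace ℝ (Fin k)) := hyperbolic.domain k ∩ κ ⁻¹' A
  have hA' : MeasurableSet A' :=
    hyperbolic.isOpen_domain.measurableSet.inter (hκc.measurable hA)
  have himg : κ '' A' = A := by
    refine Set.Subset.antisymm (by rintro _ ⟨z, hz, rfl⟩; exact hz.2) fun y hy ↦ ?_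
    have h1 := (hdom y).1 (hAd y hy)
    have h2 : R⁻¹ • y ∈ hyperbolic.domain k := by
      rw [mem_domain_iff, curv, one_mul, norm_smul, mul_pow, norm_inv,
        Real.norm_of_nonneg hR.le, inv_pow, hR2, inv_mul_eq_div, sub_pos, div_lt_one hp]
      exact h1
    have h3 : κ (hyperbolic.flatInv (R⁻¹ • y)) = y := by
      simp only [κ]
      rw [hyperbolic.flatMap_flatInv h2, smul_smul, mul_inv_cancel₀ hR.ne', one_smul]
    exact ⟨_, ⟨hyperbolic.flatInv_mem_domain h2, by rw [Set.mem_preimage, h3]; exact hy⟩, h3⟩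
  have himg2 : f '' A' = hyperbolic.flatInv '' ((fun z ↦ Φ (p, z)) '' A) := by
    rw [← himg, Set.image_image, Set.image_image]
  have hyd : ∀ z ∈ A', Φ (p, κ z) ∈ hyperbolic.domain (k + 1) := fun z hz ↦ hAd _ hz.2
  have hfd : ∀ z ∈ A', f z ∈ hyperbolic.domain (k + 1) := fun z hz ↦
    hyperbolic.flatInv_mem_domain (hyd z hz)
  have hfac : ∀ z ∈ A', hyperbolic.flatFactor (Φ (p, κ z)) =
      R * hyperbolic.flatFactor (hyperbolic.flatMap z) := by
    intro z hz
    rw [flatFactor, flatFactor, hΦ.norm_sq, curv, one_mul, one_mul, norm_smul, mul_pow,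
      Real.norm_of_nonneg hR.le, ← Real.sqrt_sq hR.le, ← Real.sqrt_mul (sq_nonneg _),
      Real.sqrt_sq hR.le, hR2]
    congr 1
    ring
  have hconf := setLIntegral_image_of_conformal hf hA' k
    (lX := hyperbolic.conformalFactor) (lY := hyperbolic.conformalFactor)
    hyperbolic.measurable_conformalFactor hyperbolic.measurable_conformalFactor
    (fun z hz ↦ hyperbolic.conformalFactor_pos hz.1)
    (fun z hz ↦ hyperbolic.conformalFactor_pos (hfd z hz)) ?_
  swap
  · intro z hz z' hz'
    have hs := hyperbolic.flatFactor_pos (hyperbolic.flatMap_mem_domain hz.1)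
    have hs' := hyperbolic.flatFactor_pos (hyperbolic.flatMap_mem_domain hz'.1)
    rw [dist_sq_mul_conformalFactor (hfd z hz) (hfd z' hz'),
      dist_sq_mul_conformalFactor hz.1 hz'.1]
    simp only [f]
    rw [hyperbolic.flatMap_flatInv (hyd z hz), hyperbolic.flatMap_flatInv (hyd z' hz'),
      hfac z hz, hfac z' hz', hΦ.inner_map]
    simp only [κ]
    rw [real_inner_smul_left, inner_smul_right]
    have : 1 - (p * p + R * (R * ⟪hyperbolic.flatMap z, hyperbolic.flatMap z'⟫)) =
        R ^ 2 * (1 - ⟪hyperbolic.flatMap z, hyperbolic.flatMap z'⟫) := by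
      linear_combination -hR2
    rw [this]
    field_simp
  have hder : ∀ z ∈ A', HasFDerivWithinAt κ (R • hyperbolic.flatDeriv z) A' z := fun z _ ↦
    ((hyperbolic.hasFDerivAt_flatMap z).const_smul R).hasFDerivWithinAt
  have hinj : Set.InjOn κ A' := fun z hz z' hz' h ↦
    hyperbolic.injOn_flatMap hz.1 hz'.1 (smul_right_injective _ hR.ne' h)
  rw [← himg2, hconf, EuclideanSpace.euclideanHausdorffMeasure_eq_volume, ← himg,
    lintegral_image_eq_lintegral_abs_det_fderiv_mul volume hA' hder hinj]
  refine setLIntegral_congr_fun hA' fun z hz ↦ ?_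
  have hs := hyperbolic.flatFactor_pos (hyperbolic.flatMap_mem_domain hz.1)
  have hc := hyperbolic.chartScale_pos z
  have hl := hyperbolic.conformalFactor_mul_flatFactor hz.1
  have hl' : hyperbolic.conformalFactor z =
      hyperbolic.chartScale z / hyperbolic.flatFactor (hyperbolic.flatMap z) := by
    rw [← hl]
    field_simp
  have hdet : (R • hyperbolic.flatDeriv z).det = R ^ k * (hyperbolic.flatDeriv z).det := by
    rw [ContinuousLinearMap.det, ContinuousLinearMap.toLinearMap_smul, LinearMap.det_smul,
      finrank_euclideanSpace, Fintype.card_fin]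
  rw [hdet, hyperbolic.det_flatDeriv hz.1, abs_of_pos (by positivity),
    ← ENNReal.ofReal_mul (by positivity), ← ENNReal.ofReal_pow (by rw [hl']; positivity),
    flatAreaDensity, hfac z hz, hΦ.inner_left, hl', curv, one_mul, ← hRdef]
  congr 1
  simp only [div_pow, mul_pow, pow_succ]
  field_simp

theorem measurableSet_flatInv_image {S : Set (EuclideanSpace ℝ (Fin n))} (hS : MeasurableSet S)
    (hSd : S ⊆ G.domain n) : MeasurableSet (G.flatInv '' S) :=
  hS.image_of_continuousOn_injOn G.continuous_flatInv.continuousOn fun x hx y hy h ↦ by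
    rw [← G.flatMap_flatInv (hSd hx), h, G.flatMap_flatInv (hSd hy)]

/-- The area of a subset of a hyperplane, computed in the projective model. -/
theorem areaMeasure_flatInv_image (hΦ : IsFrame ν Φ) {p : ℝ}
    {A : Set (EuclideanSpace ℝ (Fin k))} (hA : MeasurableSet A)
    (hAd : ∀ z ∈ A, Φ (p, z) ∈ G.domain (k + 1)) :
    G.areaMeasure (k + 1) (G.flatInv '' ((fun z ↦ Φ (p, z)) '' A)) =
      ∫⁻ z in A, ENNReal.ofReal (G.flatAreaDensity ν (Φ (p, z))) := by
  have hi := hΦ.isometry p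
  have hm1 : MeasurableSet ((fun z ↦ Φ (p, z)) '' A) :=
    hi.isClosedEmbedding.measurableEmbedding.measurableSet_image.2 hA
  have hm : MeasurableSet (G.flatInv '' ((fun z ↦ Φ (p, z)) '' A)) :=
    G.measurableSet_flatInv_image hm1 (by rintro _ ⟨z, hz, rfl⟩; exact hAd z hz)
  rw [areaMeasure, withDensity_apply _ hm]
  cases G
  · have : (euclidean.flatInv : EuclideanSpace ℝ (Fin (k + 1)) → _) = id := rfl
    rw [this, Set.image_id]
    simp only [conformalFactor, flatAreaDensity, flatFactor, curv, ENNReal.ofReal_one, one_pow,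
      zero_mul, sub_zero, Real.sqrt_one, div_one]
    rw [setLIntegral_const, setLIntegral_const, one_mul, one_mul, Nat.add_sub_cancel,
      hi.euclideanHausdorffMeasure_image, EuclideanSpace.euclideanHausdorffMeasure_eq_volume]
  · exact lintegral_conformalFactor_hyperbolic hΦ hA hAd

end ModelGeometry

end FlatArea

/-! ### Polyhedra and their facets in the projective model. -/

section FlatPolyhedron

namespace ModelGeometry

variable (G : ModelGeometry) {k n : ℕ} {P : Set (EuclideanSpace ℝ (Fin n))}

theorem flatMap_image_eq {S : Set (EuclideanSpace ℝ (Fin n))} (hS : S ⊆ G.domain n) :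
    G.flatMap '' S = G.domain n ∩ G.flatInv ⁻¹' S := by
  ext y
  constructor
  · rintro ⟨x, hx, rfl⟩
    exact ⟨G.flatMap_mem_domain (hS hx), by rw [Set.mem_preimage, G.flatInv_flatMap (hS hx)]; exact hx⟩
  · rintro ⟨hy, hx⟩
    exact ⟨_, hx, G.flatMap_flatInv hy⟩

theorem isOpen_flatMap_image {S : Set (EuclideanSpace ℝ (Fin n))} (hS : S ⊆ G.domain n)
    (ho : IsOpen S) : IsOpen (G.flatMap '' S) := by
  rw [G.flatMap_image_eq hS]
  exact G.isOpen_domain.inter (ho.preimage G.continuous_flatInv)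

theorem flatMap_mem_interior_iff (hP : P ⊆ G.domain n) {x : EuclideanSpace ℝ (Fin n)}
    (hx : x ∈ G.domain n) : G.flatMap x ∈ interior (G.flatMap '' P) ↔ x ∈ interior P := by
  constructor
  · intro h
    refine mem_interior.2 ⟨G.domain n ∩ G.flatMap ⁻¹' interior (G.flatMap '' P), ?_,
      G.isOpen_domain.inter (isOpen_interior.preimage G.continuous_flatMap), hx, h⟩
    rintro z ⟨hz, hzi⟩
    obtain ⟨z', hz', hzz⟩ := interior_subset hzi
    rwa [← G.injOn_flatMap (hP hz') hz hzz]
  · intro h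
    exact mem_interior.2 ⟨G.flatMap '' interior P, Set.image_mono interior_subset,
      G.isOpen_flatMap_image (interior_subset.trans hP) isOpen_interior, ⟨x, h, rfl⟩⟩

/-- The positive factor is common to all walls, so signs and zeros of `wallFun` are those of affine
functions in the projective model. -/
theorem exists_wallFun_eq (x : EuclideanSpace ℝ (Fin n)) :
    ∃ c, 0 < c ∧ ∀ a b, G.wallFun a b x = c * (a + ⟪b, G.flatMap x⟫) := by
  cases G
  · refine ⟨1, one_pos, fun a b ↦ ?_⟩
    simp [wallFun, flatMap, chartScale]
  · refine ⟨1 + ‖x‖ ^ 2, by positivity, fun a b ↦ ?_⟩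
    have : (1 + ‖x‖ ^ 2) ≠ 0 := by positivity
    rw [wallFun, flatMap, chartScale, inner_smul_right]
    field_simp

theorem wallFun_nonneg_iff (a : ℝ) (b x : EuclideanSpace ℝ (Fin n)) :
    0 ≤ G.wallFun a b x ↔ 0 ≤ a + ⟪b, G.flatMap x⟫ := by
  obtain ⟨c, hc, h⟩ := G.exists_wallFun_eq x
  rw [h, mul_nonneg_iff_of_pos_left hc]

theorem wallFun_eq_zero_iff (a : ℝ) (b x : EuclideanSpace ℝ (Fin n)) :
    G.wallFun a b x = 0 ↔ a + ⟪b, G.flatMap x⟫ = 0 := by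
  obtain ⟨c, hc, h⟩ := G.exists_wallFun_eq x
  simp [h, hc.ne']

variable {G} in
theorem IsWall.ne_zero {a : ℝ} {b : EuclideanSpace ℝ (Fin n)} (h : G.IsWall a b) : b ≠ 0 := by
  cases G
  · exact h
  · rintro rfl
    have h : |a| < ‖(0 : EuclideanSpace ℝ (Fin n))‖ := h
    rw [norm_zero] at h
    exact absurd h (not_lt.2 (abs_nonneg a))

theorem isWall_of_mem {a : ℝ} {b y : EuclideanSpace ℝ (Fin n)} (hb : b ≠ 0)
    (hy : y ∈ G.domain n) (h : a + ⟪b, y⟫ = 0) : G.IsWall a b := by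
  cases G
  · exact hb
  · have hy1 : ‖y‖ < 1 := by simpa [domain] using hy
    change |a| < ‖b‖
    rw [eq_neg_of_add_eq_zero_left h, abs_neg]
    exact (abs_real_inner_le_norm b y).trans_lt
      (mul_lt_of_lt_one_right (norm_pos_iff.2 hb) hy1)

variable {G} in
theorem IsConvexPolyhedron.subset_domain (hP : G.IsConvexPolyhedron P) : P ⊆ G.domain n := by
  obtain ⟨-, -, m, a, b, -, rfl⟩ := hP
  exact Set.inter_subset_left

/-- In the projective model a convex polyhedron is a Euclidean polytope. -/
theorem exists_isPolytope {P : Set (EuclideanSpace ℝ (Fin (k + 1)))} (hP : G.IsConvexPolyhedron P) :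
    ∃ (m : ℕ) (a : Fin m → ℝ) (b : Fin m → EuclideanSpace ℝ (Fin (k + 1))),
      IsPolytope (G.flatMap '' P) a b := by
  have hPd := hP.subset_domain
  obtain ⟨hc, hi, m, a, b, hw, hPe⟩ := hP
  have hKc : IsCompact (G.flatMap '' P) := hc.image G.continuous_flatMap
  have hKi : (interior (G.flatMap '' P)).Nonempty := by
    obtain ⟨x, hx⟩ := hi
    exact ⟨_, (G.flatMap_mem_interior_iff hPd (hPd (interior_subset hx))).2 hx⟩
  have hKe : ∀ y, y ∈ G.flatMap '' P ↔ y ∈ G.domain (k + 1) ∧ ∀ i, 0 ≤ a i + ⟪b i, y⟫ := by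
    intro y
    constructor
    · rintro ⟨x, hx, rfl⟩
      rw [hPe] at hx
      exact ⟨G.flatMap_mem_domain hx.1, fun i ↦
        (G.wallFun_nonneg_iff _ _ _).1 (Set.mem_iInter.1 hx.2 i)⟩
    · rintro ⟨hy, h⟩
      refine ⟨G.flatInv y, ?_, G.flatMap_flatInv hy⟩
      rw [hPe]
      refine ⟨G.flatInv_mem_domain hy, Set.mem_iInter.2 fun i ↦
        (G.wallFun_nonneg_iff _ _ _).2 ?_⟩
      rw [G.flatMap_flatInv hy]
      exact h i
  refine ⟨m, a, b, hKc, hKi, fun i ↦ (hw i).ne_zero, fun y ↦ (hKe y).trans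
    (and_iff_right_of_imp fun hy ↦ ?_)⟩
  -- The inequalities alone already confine `y` to the open domain. Their solution set is convex,
  -- hence connected, and is covered by the domain and the complement of the compact image; were it
  -- to leave the domain, some solution would lie in both open sets, which is absurd.
  have hconv : Convex ℝ {y : EuclideanSpace ℝ (Fin (k + 1)) | ∀ i, 0 ≤ a i + ⟪b i, y⟫} := by
    intro y hy z hz s t hs ht hst i
    rw [inner_add_right, inner_smul_right, inner_smul_right]
    have h1 := mul_nonneg hs (hy i)
    have h2 := mul_nonneg ht (hz i)
    have h3 : a i = s * a i + t * a i := by rw [← add_mul, hst, one_mul]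
    linarith
  by_contra hyd
  obtain ⟨y₀, hy₀⟩ := hKi
  have hy₀ := (hKe y₀).1 (interior_subset hy₀)
  have hcov : {y : EuclideanSpace ℝ (Fin (k + 1)) | ∀ i, 0 ≤ a i + ⟪b i, y⟫} ⊆
      G.domain (k + 1) ∪ (G.flatMap '' P)ᶜ := by
    intro z _
    by_cases hzd : z ∈ G.domain (k + 1)
    · exact Or.inl hzd
    · exact Or.inr fun h ↦ hzd ((hKe z).1 h).1
  obtain ⟨z, hz, hzd, hzK⟩ := hconv.isPreconnected (G.domain (k + 1)) (G.flatMap '' P)ᶜ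
    G.isOpen_domain hKc.isClosed.isOpen_compl hcov ⟨y₀, hy₀.2, hy₀.1⟩
    ⟨y, hy, fun h ↦ hyd ((hKe y).1 h).1⟩
  exact hzK ((hKe z).2 ⟨hzd, hz⟩)

theorem subset_of_mem_facets {F : Set (EuclideanSpace ℝ (Fin n))} (hF : F ∈ G.facets P) : F ⊆ P := by
  obtain ⟨a, b, -, -, rfl, -⟩ := hF
  exact fun x hx ↦ hx.1

/-- The facets correspond to those in the projective model. -/
theorem image_facets (hP : P ⊆ G.domain n) :
    (fun F ↦ G.flatMap '' F) '' G.facets P = euclidean.facets (G.flatMap '' P) := by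
  refine Set.Subset.antisymm ?_ ?_
  · rintro _ ⟨_, ⟨a, b, hw, hs, rfl, U, hU, ⟨x₀, hx₀U, hx₀⟩, hUF⟩, rfl⟩
    refine ⟨a, b, hw.ne_zero, ?_, ?_, G.flatMap '' (U ∩ G.domain n),
      G.isOpen_flatMap_image Set.inter_subset_right (hU.inter G.isOpen_domain),
      ⟨_, ⟨x₀, ⟨hx₀U, hP hx₀.1⟩, rfl⟩, ⟨x₀, hx₀, rfl⟩⟩, ?_⟩
    · rintro _ ⟨x, hx, rfl⟩
      exact (G.wallFun_nonneg_iff a b x).1 (hs x hx)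
    · ext y
      constructor
      · rintro ⟨x, hx, rfl⟩
        exact ⟨⟨x, hx.1, rfl⟩, (G.wallFun_eq_zero_iff a b x).1 hx.2⟩
      · rintro ⟨⟨x, hx, rfl⟩, hx0⟩
        exact ⟨x, ⟨hx, (G.wallFun_eq_zero_iff a b x).2 hx0⟩, rfl⟩
    · rintro _ ⟨x, hx, rfl⟩ hx0
      exact ⟨x, hUF x hx.1 ((G.wallFun_eq_zero_iff a b x).2 hx0), rfl⟩
  · rintro _ ⟨a, b, hw, hs, rfl, U, hU, ⟨_, hy₀U, ⟨x₀, hx₀, rfl⟩, hy₀⟩, hUF⟩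
    refine ⟨{x ∈ P | G.wallFun a b x = 0}, ⟨a, b,
      G.isWall_of_mem hw (G.flatMap_mem_domain (hP hx₀)) hy₀, fun x hx ↦
        (G.wallFun_nonneg_iff a b x).2 (hs _ ⟨x, hx, rfl⟩), rfl, G.domain n ∩ G.flatMap ⁻¹' U,
        G.isOpen_domain.inter (hU.preimage G.continuous_flatMap),
        ⟨x₀, ⟨hP hx₀, hy₀U⟩, hx₀, (G.wallFun_eq_zero_iff a b x₀).2 hy₀⟩, ?_⟩, ?_⟩
    · rintro x ⟨hxd, hxU⟩ hx0
      obtain ⟨⟨x', hx', hxx⟩, -⟩ := hUF _ hxU ((G.wallFun_eq_zero_iff a b x).1 hx0)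
      rw [G.injOn_flatMap (hP hx') hxd hxx] at hx'
      exact ⟨hx', hx0⟩
    · ext y
      constructor
      · rintro ⟨x, hx, rfl⟩
        exact ⟨⟨x, hx.1, rfl⟩, (G.wallFun_eq_zero_iff a b x).1 hx.2⟩
      · rintro ⟨⟨x, hx, rfl⟩, hx0⟩
        exact ⟨x, ⟨hx, (G.wallFun_eq_zero_iff a b x).2 hx0⟩, rfl⟩

theorem injOn_image_facets (hP : P ⊆ G.domain n) :
    Set.InjOn (fun F ↦ G.flatMap '' F) (G.facets P) := by
  intro F hF F' hF' h
  have h1 := (G.subset_of_mem_facets hF).trans hP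
  have h2 := (G.subset_of_mem_facets hF').trans hP
  have key : ∀ S : Set (EuclideanSpace ℝ (Fin n)), S ⊆ G.domain n →
      G.flatInv '' (G.flatMap '' S) = S := by
    intro S hS
    rw [Set.image_image]
    exact (Set.image_congr fun x hx ↦ G.flatInv_flatMap (hS hx)).trans (Set.image_id' S)
  rw [← key F h1, ← key F' h2]
  exact congrArg _ h

end ModelGeometry

end FlatPolyhedron

/-! ### Chord length and entry point in the projective model. -/

noncomputable section Chord

namespace ModelGeometry

variable (G : ModelGeometry) {k : ℕ} {P F : Set (EuclideanSpace ℝ (Fin (k + 1)))} {ι : Type*}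
  {a : ι → ℝ} {b : ι → EuclideanSpace ℝ (Fin (k + 1))}

/-- The Riemannian length of the part in `K` of a line in the projective model. -/
def flatLength {n : ℕ} (K : Set (EuclideanSpace ℝ (Fin n))) (y u : EuclideanSpace ℝ (Fin n)) :
    ENNReal :=
  ∫⁻ s in lineTimes K y u, ENNReal.ofReal (G.flatSpeed (y + s • u) u)

theorem mem_of_flatMap_mem (hP : P ⊆ G.domain (k + 1)) {S : Set (EuclideanSpace ℝ (Fin (k + 1)))}
    (hS : S ⊆ P) {x : EuclideanSpace ℝ (Fin (k + 1))} (hx : x ∈ G.domain (k + 1)) :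
    G.flatMap x ∈ G.flatMap '' S ↔ x ∈ S :=
  G.injOn_flatMap.mem_image_iff (hS.trans hP) hx

/-- Chords in the projective model. -/
theorem chord_eq (h : IsPolytope (G.flatMap '' P) a b) (hP : P ⊆ G.domain (k + 1))
    {x : EuclideanSpace ℝ (Fin (k + 1))} (hx : x ∈ P)
    (w : Metric.sphere (0 : EuclideanSpace ℝ (Fin (k + 1))) 1) :
    0 ≤ G.chordLength P (x, w) ∧
    G.flatLength (G.flatMap '' P) (G.flatMap x) (G.flatDir x w) =
      ENNReal.ofReal (G.chordLength P (x, w)) ∧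
    ∀ S ⊆ P, G.entryPoint P (x, w) ∈ S ↔
      EntersAt (G.flatMap '' P) (G.flatMap '' S) (G.flatMap x)
        (G.flatDir x w : EuclideanSpace ℝ (Fin (k + 1))) := by
  obtain ⟨σ, hgd, hgσ, hσ, hsurj⟩ := G.exists_flat_param (hP hx) w
  set y := G.flatMap x with hy
  set u : EuclideanSpace ℝ (Fin (k + 1)) := (G.flatDir x w).1 with hu
  have hu1 : ‖u‖ = 1 := norm_eq_of_mem_sphere _
  have hu0 : u ≠ 0 := norm_ne_zero_iff.1 (by rw [hu1]; exact one_ne_zero)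
  have hspeed : ∀ t, 0 < G.flatSpeed (y + σ t • u) u := fun t ↦
    G.flatSpeed_pos (by rw [← hgσ]; exact G.flatMap_mem_domain (hgd t)) hu0
  have hmono : StrictMono σ := strictMono_of_deriv_pos fun t ↦ by
    rw [(hσ t).deriv]
    exact inv_pos.2 (hspeed t)
  have hKd : G.flatMap '' P ⊆ G.domain (k + 1) := by
    rintro _ ⟨z, hz, rfl⟩
    exact G.flatMap_mem_domain (hP hz)
  set T := lineTimes (G.flatMap '' P) y u with hT
  have hTc : IsCompact T := isCompact_lineTimes h.isCompact y hu1
  have h0T : (0 : ℝ) ∈ T := by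
    simp only [hT, lineTimes, Set.mem_ofPred_eq, zero_smul, add_zero]
    exact ⟨x, hx, rfl⟩
  have hTo : T.OrdConnected := by
    refine ⟨fun s hs s' hs' r hr ↦ ?_⟩
    simp only [hT, lineTimes, Set.mem_ofPred_eq, h.mem_iff] at hs hs' ⊢
    intro i
    have h1 := hs i
    have h2 := hs' i
    rw [inner_add_right, inner_smul_right] at h1 h2 ⊢
    rcases le_total 0 ⟪b i, u⟫ with hb | hb
    · nlinarith [hr.1, hr.2]
    · nlinarith [hr.1, hr.2]
  have hTI : T = Set.Icc (sInf T) (sSup T) :=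
    eq_Icc_of_connected_compact ⟨⟨0, h0T⟩, isPreconnected_iff_ordConnected.2 hTo⟩ hTc
  obtain ⟨t₁, ht₁⟩ := hsurj (sInf T) (hKd (hTc.sInf_mem ⟨0, h0T⟩))
  obtain ⟨t₂, ht₂⟩ := hsurj (sSup T) (hKd (hTc.sSup_mem ⟨0, h0T⟩))
  have hle : t₁ ≤ t₂ := by
    rw [← hmono.le_iff_le, ht₁, ht₂]
    exact Real.sInf_le_sSup _ hTc.bddBelow hTc.bddAbove
  have hC : G.chordTimes P (x, w) = Set.Icc t₁ t₂ := by
    ext t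
    have : t ∈ G.chordTimes P (x, w) ↔ σ t ∈ T := by
      rw [chordTimes, Set.mem_ofPred_eq, ← G.mem_of_flatMap_mem hP subset_rfl (hgd t), hgσ]
      rfl
    rw [this, hTI, Set.mem_Icc, Set.mem_Icc, ← ht₁, ← ht₂, hmono.le_iff_le, hmono.le_iff_le]
  have himg : σ '' Set.Icc t₁ t₂ = T := by
    refine Set.Subset.antisymm ?_ fun s hs ↦ ?_
    · rintro _ ⟨t, ht, rfl⟩
      rw [hTI, ← ht₁, ← ht₂]
      exact ⟨hmono.monotone ht.1, hmono.monotone ht.2⟩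
    · obtain ⟨t, rfl⟩ := hsurj s (hKd hs)
      rw [hTI, ← ht₁, ← ht₂] at hs
      exact ⟨t, ⟨hmono.le_iff_le.1 hs.1, hmono.le_iff_le.1 hs.2⟩, rfl⟩
  have hlen : G.chordLength P (x, w) = t₂ - t₁ := by
    rw [chordLength, hC, csSup_Icc hle, csInf_Icc hle]
  refine ⟨by rw [hlen]; linarith, ?_, fun S hS ↦ ?_⟩
  -- Substituting `s = σ t` multiplies the speed by its inverse, and the integral becomes the length
  -- of the time interval.
  · rw [hlen, flatLength, ← hT, ← himg, lintegral_image_eq_lintegral_abs_deriv_mul measurableSet_Icc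
      (fun t _ ↦ (hσ t).hasDerivWithinAt) hmono.injective.injOn]
    rw [← Real.volume_Icc, ← setLIntegral_one]
    refine setLIntegral_congr_fun measurableSet_Icc fun t _ ↦ ?_
    rw [← ENNReal.ofReal_mul (abs_nonneg _), abs_of_pos (inv_pos.2 (hspeed t)),
      inv_mul_cancel₀ (hspeed t).ne', ENNReal.ofReal_one]
  · rw [entryPoint, hC, csInf_Icc hle, ← G.mem_of_flatMap_mem hP hS (hgd t₁), hgσ, ht₁]
    rfl

end ModelGeometry

end Chord

/-! ### The flux through a facet. -/

noncomputable section Flux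

namespace ModelGeometry

variable (G : ModelGeometry) {k : ℕ} {P F K : Set (EuclideanSpace ℝ (Fin (k + 1)))} {ι : Type*}
  {a : ι → ℝ} {b : ι → EuclideanSpace ℝ (Fin (k + 1))}

theorem measurable_flatSpeed {n : ℕ} : Measurable
    fun v : EuclideanSpace ℝ (Fin n) × EuclideanSpace ℝ (Fin n) ↦ G.flatSpeed v.1 v.2 := by
  have h1 := G.measurable_flatForm (n := n)
  have h2 := (G.continuous_flatFactor (n := n)).measurable
  exact h1.sqrt.div ((h2.comp measurable_fst).pow_const 2)

theorem measurable_flatLength (hK : MeasurableSet K) :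
    Measurable fun v : EuclideanSpace ℝ (Fin (k + 1)) ×
      Metric.sphere (0 : EuclideanSpace ℝ (Fin (k + 1))) 1 ↦ G.flatLength K v.1 v.2 := by
  have h1 : Measurable fun q : (EuclideanSpace ℝ (Fin (k + 1)) ×
      Metric.sphere (0 : EuclideanSpace ℝ (Fin (k + 1))) 1) × ℝ ↦
        (q.1.1 + q.2 • (q.1.2 : EuclideanSpace ℝ (Fin (k + 1))),
          (q.1.2 : EuclideanSpace ℝ (Fin (k + 1)))) := by fun_prop
  have h2 : Measurable (({v : EuclideanSpace ℝ (Fin (k + 1)) × EuclideanSpace ℝ (Fin (k + 1)) |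
      v.1 ∈ K}).indicator fun v ↦ ENNReal.ofReal (G.flatSpeed v.1 v.2)) :=
    G.measurable_flatSpeed.ennreal_ofReal.indicator (measurable_fst hK)
  have h3 := (h2.comp h1).lintegral_prod_right' (ν := (volume : Measure ℝ))
  convert h3 using 2 with v
  have hm : MeasurableSet (lineTimes K v.1 (v.2 : EuclideanSpace ℝ (Fin (k + 1)))) := by
    have : Measurable fun s : ℝ ↦ v.1 + s • (v.2 : EuclideanSpace ℝ (Fin (k + 1))) := by fun_prop
    exact this hK
  rw [flatLength, ← lintegral_indicator hm]
  rfl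

theorem continuousOn_flatSpeed {n : ℕ} (u : EuclideanSpace ℝ (Fin n)) :
    ContinuousOn (fun y ↦ G.flatSpeed y u) (G.domain n) := by
  have h1 : Continuous fun y ↦ G.flatForm y u := by
    unfold flatForm
    fun_prop
  exact h1.sqrt.continuousOn.div (G.continuous_flatFactor.pow 2).continuousOn
    fun y hy ↦ (pow_pos (G.flatFactor_pos hy) 2).ne'

/-- The unit vectors whose line enters `K` at `F`. -/
def enteringSet {n : ℕ} (K F : Set (EuclideanSpace ℝ (Fin n))) :
    Set (EuclideanSpace ℝ (Fin n) × Metric.sphere (0 : EuclideanSpace ℝ (Fin n)) 1) :=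
  {v | v.1 ∈ interior K ∧ EntersAt K F v.1 (v.2 : EuclideanSpace ℝ (Fin n))}

theorem lintegral_enteringSet [Finite ι] (h : IsPolytope K a b) (hK : K ⊆ G.domain (k + 1))
    {ν : EuclideanSpace ℝ (Fin (k + 1))} {p : ℝ} (hF : IsFacetOn K F ν p)
    {Φ : (ℝ × EuclideanSpace ℝ (Fin k)) ≃L[ℝ] EuclideanSpace ℝ (Fin (k + 1))}
    (hΦ : IsFrame ν Φ) (u : Metric.sphere (0 : EuclideanSpace ℝ (Fin (k + 1))) 1) :
    ∫⁻ y in K, ENNReal.ofReal (G.flatFactor y ^ 2)⁻¹ *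
        ((enteringSet K F).indicator (fun v ↦ (G.flatLength K v.1 v.2)⁻¹) (y, u) *
          ENNReal.ofReal (√(G.flatForm y u) ^ (k + 1))⁻¹) =
      ∫⁻ z in {z | Φ (p, z) ∈ F}, ENNReal.ofReal ⟪ν, (u : EuclideanSpace ℝ (Fin (k + 1)))⟫ *
        ENNReal.ofReal (√(G.flatForm (Φ (p, z)) u) ^ (k + 2))⁻¹ := by
  have hu : ‖(u : EuclideanSpace ℝ (Fin (k + 1)))‖ = 1 := norm_eq_of_mem_sphere u
  have hu0 : (u : EuclideanSpace ℝ (Fin (k + 1))) ≠ 0 :=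
    norm_ne_zero_iff.1 (by rw [hu]; exact one_ne_zero)
  set S : Set (EuclideanSpace ℝ (Fin (k + 1))) :=
    {y | y ∈ interior K ∧ EntersAt K F y (u : EuclideanSpace ℝ (Fin (k + 1)))} with hS
  have hSm : MeasurableSet S :=
    (measurable_prodMk_right (y := u)) (h.measurableSet_entersAt hF)
  have hSK : S ⊆ K := fun y hy ↦ interior_subset hy.1
  have hfm : Measurable fun y ↦ G.flatForm y (u : EuclideanSpace ℝ (Fin (k + 1))) := by
    have : Continuous fun y ↦ G.flatForm y (u : EuclideanSpace ℝ (Fin (k + 1))) := by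
      unfold flatForm
      fun_prop
    exact this.measurable
  have hgm : Measurable fun y ↦ G.flatSpeed y (u : EuclideanSpace ℝ (Fin (k + 1))) :=
    hfm.sqrt.div (G.continuous_flatFactor.measurable.pow_const 2)
  have hwm : Measurable fun y ↦ (√(G.flatForm y (u : EuclideanSpace ℝ (Fin (k + 1)))) ^ (k + 2))⁻¹ :=
    (hfm.sqrt.pow_const _).inv
  -- The density is regrouped as `s⁻² f^(-(k+1)/2) = f^(-(k+2)/2) · speed`, separating a weight
  -- constant along lines from the speed.
  have hpt : ∀ y ∈ K, ENNReal.ofReal (G.flatFactor y ^ 2)⁻¹ *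
        ((enteringSet K F).indicator (fun v ↦ (G.flatLength K v.1 v.2)⁻¹) (y, u) *
          ENNReal.ofReal (√(G.flatForm y u) ^ (k + 1))⁻¹) =
      S.indicator (fun y ↦ ENNReal.ofReal
        (√(G.flatForm y (u : EuclideanSpace ℝ (Fin (k + 1)))) ^ (k + 2))⁻¹ *
          (ENNReal.ofReal (G.flatSpeed y (u : EuclideanSpace ℝ (Fin (k + 1)))) /
            G.flatLength K y u)) y := by
    intro y hy
    by_cases hyS : y ∈ S
    · have hyE : (y, u) ∈ enteringSet K F := hyS
      rw [Set.indicator_of_mem hyS, Set.indicator_of_mem hyE, ENNReal.div_eq_inv_mul,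
        mul_left_comm, mul_left_comm (ENNReal.ofReal (√(G.flatForm y u) ^ (k + 2))⁻¹)]
      congr 1
      have h1 := Real.sqrt_pos.2 (G.flatForm_pos (hK hy) hu0)
      have h2 := G.flatFactor_pos (hK hy)
      rw [← ENNReal.ofReal_mul (by positivity), ← ENNReal.ofReal_mul (by positivity), flatSpeed]
      congr 1
      field_simp
      ring
    · have hyE : (y, u) ∉ enteringSet K F := hyS
      rw [Set.indicator_of_notMem hyS, Set.indicator_of_notMem hyE, zero_mul, mul_zero]
  rw [setLIntegral_congr_fun h.isCompact.isClosed.measurableSet hpt, setLIntegral_indicator hSm,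
    Set.inter_eq_left.2 hSK]
  have hFm : MeasurableSet {z | Φ (p, z) ∈ F} := by
    have : Continuous fun z ↦ Φ (p, z) := by fun_prop
    exact this.measurable (h.isClosed_facet hF).measurableSet
  -- No line directed out of the facet enters through it, and `ENNReal.ofReal` truncates the other
  -- side to 0.
  rcases le_or_gt ⟪ν, (u : EuclideanSpace ℝ (Fin (k + 1)))⟫ 0 with hνu | hνu
  · have : S = ∅ := Set.eq_empty_of_forall_notMem fun y hy ↦
      hνu.not_gt ((h.entersAt_iff hF hy.1 hu).1 hy.2).1
    rw [this, ENNReal.ofReal_of_nonpos hνu]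
    simp
  · rw [lintegral_const_mul' _ _ ENNReal.ofReal_ne_top]
    refine h.lintegral_entersAt hF hΦ hu hνu hgm hwm ((G.continuousOn_flatSpeed _).mono hK)
      (fun y hy ↦ G.flatSpeed_pos (hK hy) hu0) (fun y s ↦ ?_) hSm
    rw [G.flatForm_add_smul]

theorem measurable_flatForm_sphere (j : ℕ) : Measurable fun v : EuclideanSpace ℝ (Fin (k + 1)) ×
    Metric.sphere (0 : EuclideanSpace ℝ (Fin (k + 1))) 1 ↦
      ENNReal.ofReal (√(G.flatForm v.1 (v.2 : EuclideanSpace ℝ (Fin (k + 1)))) ^ j)⁻¹ := by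
  unfold flatForm
  fun_prop

theorem measurable_indicator_enteringSet (h : IsPolytope K a b)
    {ν : EuclideanSpace ℝ (Fin (k + 1))} {p : ℝ} (hF : IsFacetOn K F ν p) :
    Measurable ((enteringSet K F).indicator fun v ↦ (G.flatLength K v.1 v.2)⁻¹) :=
  ((G.measurable_flatLength h.isCompact.isClosed.measurableSet).inv).indicator
    (h.measurableSet_entersAt hF)

theorem flatMap_image_subset_domain (hP : P ⊆ G.domain (k + 1)) :
    G.flatMap '' P ⊆ G.domain (k + 1) := by
  rintro _ ⟨z, hz, rfl⟩
  exact G.flatMap_mem_domain (hP hz)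

theorem flatMap_image_mem_facets (hP : P ⊆ G.domain (k + 1)) (hF : F ∈ G.facets P) :
    G.flatMap '' F ∈ euclidean.facets (G.flatMap '' P) := by
  rw [← G.image_facets hP]
  exact ⟨F, hF, rfl⟩

theorem areaMeasure_of_flat {ν : EuclideanSpace ℝ (Fin (k + 1))} {p : ℝ}
    {Φ : (ℝ × EuclideanSpace ℝ (Fin k)) ≃L[ℝ] EuclideanSpace ℝ (Fin (k + 1))} (hΦ : IsFrame ν Φ) {S : Set (EuclideanSpace ℝ (Fin (k + 1)))}
    (hS : S ⊆ G.domain (k + 1)) (hm : MeasurableSet (G.flatMap '' S))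
    (hν : ∀ y ∈ G.flatMap '' S, ⟪ν, y⟫ = p) :
    G.areaMeasure (k + 1) S = ∫⁻ z in {z | Φ (p, z) ∈ G.flatMap '' S},
      ENNReal.ofReal (G.flatAreaDensity ν (Φ (p, z))) := by
  have hc : Continuous fun z ↦ Φ (p, z) := by fun_prop
  have hA : MeasurableSet {z | Φ (p, z) ∈ G.flatMap '' S} := hc.measurable hm
  rw [← G.areaMeasure_flatInv_image hΦ hA
    (fun z hz ↦ G.flatMap_image_subset_domain hS hz)]
  have : (fun z ↦ Φ (p, z)) '' {z | Φ (p, z) ∈ G.flatMap '' S} = G.flatMap '' S := by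
    refine Set.image_preimage_eq_of_subset fun y hy ↦ ?_
    obtain ⟨z, hz⟩ := hΦ.exists_eq y
    rw [hν y hy] at hz
    exact ⟨z, hz.symm⟩
  rw [this, Set.image_image]
  exact congrArg _ ((Set.image_congr fun x hx ↦ G.flatInv_flatMap (hS hx)).trans
    (Set.image_id' S)).symm

/-- The flux of unit vectors entering through a facet. -/
theorem lintegral_inv_flatLength [Finite ι] (h : IsPolytope (G.flatMap '' P) a b)
    (hP : P ⊆ G.domain (k + 1)) (hPm : MeasurableSet P) (hF : F ∈ G.facets P) :
    ∫⁻ v, (enteringSet (G.flatMap '' P) (G.flatMap '' F)).indicator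
        (fun v ↦ (G.flatLength (G.flatMap '' P) v.1 v.2)⁻¹)
          (G.flatMap v.1, G.flatDir v.1 v.2) ∂(G.liouville P) =
      volume (Metric.ball (0 : EuclideanSpace ℝ (Fin k)) 1) * G.areaMeasure (k + 1) F := by
  have hKd := G.flatMap_image_subset_domain hP
  have hFP := G.subset_of_mem_facets hF
  obtain ⟨ν, p, hFo⟩ := exists_isFacetOn (G.flatMap_image_mem_facets hP hF)
  obtain ⟨Φ, hΦ⟩ := exists_isFrame hFo.norm_eq_one
  have hΦc : Continuous fun z ↦ Φ (p, z) := by fun_prop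
  have hFm : MeasurableSet {z | Φ (p, z) ∈ G.flatMap '' F} :=
    hΦc.measurable (h.isClosed_facet hFo).measurableSet
  have hsub : ∀ z ∈ {z | Φ (p, z) ∈ G.flatMap '' F}, Φ (p, z) ∈ G.domain (k + 1) := fun z hz ↦
    hKd (Set.image_mono hFP hz)
  have hHm := G.measurable_indicator_enteringSet h hFo
  have hff := (G.continuous_flatFactor (n := k + 1)).measurable
  have hWp := G.measurable_flatForm_sphere (k := k)
  have hHW := hHm.mul (hWp (k + 1))
  have h1 : ∀ y, ENNReal.ofReal (G.flatFactor y ^ 2)⁻¹ *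
      ∫⁻ u : Metric.sphere (0 : EuclideanSpace ℝ (Fin (k + 1))) 1,
        (enteringSet (G.flatMap '' P) (G.flatMap '' F)).indicator
          (fun v ↦ (G.flatLength (G.flatMap '' P) v.1 v.2)⁻¹) (y, u) *
            ENNReal.ofReal (√(G.flatForm y u) ^ (k + 1))⁻¹
              ∂(volume : Measure (EuclideanSpace ℝ (Fin (k + 1)))).toSphere =
      ∫⁻ u : Metric.sphere (0 : EuclideanSpace ℝ (Fin (k + 1))) 1,
        ENNReal.ofReal (G.flatFactor y ^ 2)⁻¹ *
        ((enteringSet (G.flatMap '' P) (G.flatMap '' F)).indicator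
          (fun v ↦ (G.flatLength (G.flatMap '' P) v.1 v.2)⁻¹) (y, u) *
            ENNReal.ofReal (√(G.flatForm y u) ^ (k + 1))⁻¹)
              ∂(volume : Measure (EuclideanSpace ℝ (Fin (k + 1)))).toSphere := fun y ↦
    (lintegral_const_mul' _ _ ENNReal.ofReal_ne_top).symm
  have hz : Measurable fun q : Metric.sphere (0 : EuclideanSpace ℝ (Fin (k + 1))) 1 ×
      EuclideanSpace ℝ (Fin k) ↦
        ENNReal.ofReal ⟪ν, (q.1 : EuclideanSpace ℝ (Fin (k + 1)))⟫ *
        ENNReal.ofReal (√(G.flatForm (Φ (p, q.2)) q.1) ^ (k + 2))⁻¹ := by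
    have h2 : Measurable fun q : Metric.sphere (0 : EuclideanSpace ℝ (Fin (k + 1))) 1 ×
      EuclideanSpace ℝ (Fin k) ↦ Φ (p, q.2) := hΦc.measurable.comp measurable_snd
    have h3 : Measurable fun q : Metric.sphere (0 : EuclideanSpace ℝ (Fin (k + 1))) 1 ×
      EuclideanSpace ℝ (Fin k) ↦ ⟪ν, (q.1 : EuclideanSpace ℝ (Fin (k + 1)))⟫ := by fun_prop
    unfold flatForm
    fun_prop
  -- Fubini is used twice: first to fix the direction and collapse the chords onto the facet, then
  -- to fix the point of the facet and integrate over directions.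
  rw [G.lintegral_liouville hPm hP hHm, lintegral_congr h1, lintegral_lintegral_swap]
  · rw [lintegral_congr fun u ↦ G.lintegral_enteringSet h hKd hFo hΦ u,
      lintegral_lintegral_swap hz.aemeasurable,
      setLIntegral_congr_fun hFm fun z hz ↦ G.lintegral_flux (hsub z hz) hΦ.norm_eq_one,
      lintegral_const_mul' _ _ measure_ball_lt_top.ne, ← G.areaMeasure_of_flat hΦ (hFP.trans hP)
        (h.isClosed_facet hFo).measurableSet fun y hy ↦ ((hFo.mem_iff y).1 hy).2]
  · exact ((((hff.comp measurable_fst).pow_const 2).inv).ennreal_ofReal.mul hHW).aemeasurable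

end ModelGeometry

end Flux

/-! ### Area of the facets and of the boundary. -/

section Area

namespace ModelGeometry

variable (G : ModelGeometry) {k : ℕ} {P F F' : Set (EuclideanSpace ℝ (Fin (k + 1)))} {ι : Type*}
  {a : ι → ℝ} {b : ι → EuclideanSpace ℝ (Fin (k + 1))}

variable {ν : EuclideanSpace ℝ (Fin (k + 1))} {p : ℝ}
  {Φ : (ℝ × EuclideanSpace ℝ (Fin k)) ≃L[ℝ] EuclideanSpace ℝ (Fin (k + 1))}

theorem areaMeasure_lt_top_of_flat (hΦ : IsFrame ν Φ) {S : Set (EuclideanSpace ℝ (Fin (k + 1)))}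
    (hS : S ⊆ G.domain (k + 1)) (hc : IsCompact (G.flatMap '' S))
    (hν : ∀ y ∈ G.flatMap '' S, ⟪ν, y⟫ = p) : G.areaMeasure (k + 1) S < ⊤ := by
  rw [G.areaMeasure_of_flat hΦ hS hc.isClosed.measurableSet hν]
  have hK : IsCompact {z | Φ (p, z) ∈ G.flatMap '' S} :=
    (hΦ.isometry p).isClosedEmbedding.isCompact_preimage hc
  have hco : ContinuousOn (fun z ↦ G.flatAreaDensity ν (Φ (p, z)))
      {z | Φ (p, z) ∈ G.flatMap '' S} := by
    have h1 : Continuous fun z ↦ √(1 - G.curv * ⟪ν, Φ (p, z)⟫ ^ 2) := by fun_prop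
    have h2 : Continuous fun z ↦ G.flatFactor (Φ (p, z)) ^ (k + 1) :=
      (G.continuous_flatFactor.comp (by fun_prop)).pow _
    exact h1.continuousOn.div h2.continuousOn fun z hz ↦
      (pow_pos (G.flatFactor_pos (G.flatMap_image_subset_domain hS hz)) _).ne'
  exact (hco.integrableOn_compact hK).lintegral_lt_top

theorem areaMeasure_facet_lt_top (h : IsPolytope (G.flatMap '' P) a b) (hP : P ⊆ G.domain (k + 1))
    (hF : F ∈ G.facets P) : G.areaMeasure (k + 1) F < ⊤ := by
  obtain ⟨ν, p, hFo⟩ := exists_isFacetOn (G.flatMap_image_mem_facets hP hF)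
  obtain ⟨Φ, hΦ⟩ := exists_isFrame hFo.norm_eq_one
  have hFP := G.subset_of_mem_facets hF
  exact G.areaMeasure_lt_top_of_flat hΦ (hFP.trans hP)
    (h.isCompact.of_isClosed_subset (h.isClosed_facet hFo) (Set.image_mono hFP))
    fun y hy ↦ ((hFo.mem_iff y).1 hy).2

theorem measurableSet_facet (h : IsPolytope (G.flatMap '' P) a b) (hP : P ⊆ G.domain (k + 1))
    (hF : F ∈ G.facets P) : MeasurableSet F := by
  obtain ⟨ν, p, hFo⟩ := exists_isFacetOn (G.flatMap_image_mem_facets hP hF)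
  have hFd := (G.subset_of_mem_facets hF).trans hP
  have : F = G.domain (k + 1) ∩ G.flatMap ⁻¹' (G.flatMap '' F) := by
    ext x
    exact ⟨fun hx ↦ ⟨hFd hx, x, hx, rfl⟩, fun hx ↦ (G.mem_of_flatMap_mem hFd subset_rfl hx.1).1 hx.2⟩
  rw [this]
  exact G.isOpen_domain.measurableSet.inter
    (G.continuous_flatMap.measurable (h.isClosed_facet hFo).measurableSet)

theorem areaMeasure_inter_facets (h : IsPolytope (G.flatMap '' P) a b) (hP : P ⊆ G.domain (k + 1))
    (hF : F ∈ G.facets P) (hF' : F' ∈ G.facets P) (hne : F ≠ F') :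
    G.areaMeasure (k + 1) (F ∩ F') = 0 := by
  obtain ⟨ν, p, hFo⟩ := exists_isFacetOn (G.flatMap_image_mem_facets hP hF)
  obtain ⟨ν', p', hFo'⟩ := exists_isFacetOn (G.flatMap_image_mem_facets hP hF')
  obtain ⟨Φ, hΦ⟩ := exists_isFrame hFo.norm_eq_one
  have hFd := (G.subset_of_mem_facets hF).trans hP
  have hFd' := (G.subset_of_mem_facets hF').trans hP
  have himg := G.injOn_flatMap.image_inter hFd hFd'
  have hne' : G.flatMap '' F ≠ G.flatMap '' F' := fun he ↦ hne (G.injOn_image_facets hP hF hF' he)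
  rw [G.areaMeasure_of_flat hΦ (Set.inter_subset_left.trans hFd) _
    fun y hy ↦ ((hFo.mem_iff y).1 (Set.image_mono Set.inter_subset_left hy)).2]
  · exact setLIntegral_measure_zero _ _ (measure_mono_null
      (fun z hz ↦ (Set.image_mono Set.inter_subset_right :
        G.flatMap '' (F ∩ F') ⊆ G.flatMap '' F') hz)
        (IsPolytope.volume_inter_eq_zero hΦ hFo hFo' hne'))
  · rw [himg]
    exact (h.isClosed_facet hFo).measurableSet.inter (h.isClosed_facet hFo').measurableSet

theorem finite_facets [Finite ι] (h : IsPolytope (G.flatMap '' P) a b)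
    (hP : P ⊆ G.domain (k + 1)) : (G.facets P).Finite := by
  refine Set.Finite.of_finite_image ?_ (G.injOn_image_facets hP)
  rw [G.image_facets hP]
  exact h.finite_facets

/-- The boundary of a polyhedron is the union of its facets, up to a set without area. -/
theorem frontier_ae_eq [Finite ι] (h : IsPolytope (G.flatMap '' P) a b) (hc : IsClosed P)
    (hP : P ⊆ G.domain (k + 1)) :
    frontier P =ᵐ[G.areaMeasure (k + 1)] ⋃ F ∈ G.facets P, F := by
  have hn : ∀ i, 0 < ‖b i‖ := fun i ↦ norm_pos_iff.2 (h.ne_zero i)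
  have hν : ∀ i, ‖‖b i‖⁻¹ • b i‖ = 1 := fun i ↦ by
    rw [norm_smul, norm_inv, norm_norm, inv_mul_cancel₀ (hn i).ne']
  have key : ∀ i x, a i + ⟪b i, x⟫ = ‖b i‖ * (⟪‖b i‖⁻¹ • b i, x⟫ - -a i / ‖b i‖) := by
    intro i x
    have := (hn i).ne'
    rw [real_inner_smul_left]
    field_simp
    ring
  -- Walls that carry no facet contribute no area, so only facets are seen in the boundary.
  have hnull : ∀ i, {x | x ∈ P ∧ a i + ⟪b i, G.flatMap x⟫ = 0} ∉ G.facets P →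
      G.areaMeasure (k + 1) {x | x ∈ P ∧ a i + ⟪b i, G.flatMap x⟫ = 0} = 0 := by
    intro i hi
    set S := {x | x ∈ P ∧ a i + ⟪b i, G.flatMap x⟫ = 0} with hS
    have hSP : S ⊆ P := fun x hx ↦ hx.1
    obtain ⟨Φ, hΦ⟩ := exists_isFrame (hν i)
    have hSK : G.flatMap '' S =
        {y | y ∈ G.flatMap '' P ∧ ⟪‖b i‖⁻¹ • b i, y⟫ = -a i / ‖b i‖} := by
      ext y
      constructor
      · rintro ⟨x, hx, rfl⟩
        have := hx.2
        rw [key, mul_eq_zero, sub_eq_zero] at this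
        exact ⟨⟨x, hx.1, rfl⟩, this.resolve_left (hn i).ne'⟩
      · rintro ⟨⟨x, hx, rfl⟩, h0⟩
        exact ⟨x, ⟨hx, by rw [key, h0, sub_self, mul_zero]⟩, rfl⟩
    rw [G.areaMeasure_of_flat hΦ (p := -a i / ‖b i‖) (hSP.trans hP)]
    · refine setLIntegral_measure_zero _ _ (measure_mono_null
        (fun z hz ↦ (Set.image_mono hSP : G.flatMap '' S ⊆ G.flatMap '' P) hz) (h.volume_wall_eq_zero hΦ (hn i) (key i) ?_))
      rw [← hSK, ← G.image_facets hP]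
      rintro ⟨F, hF, he⟩
      refine hi ?_
      rwa [← (G.injOn_flatMap.image_eq_image_iff ((G.subset_of_mem_facets hF).trans hP)
        (hSP.trans hP)).1 he]
    · rw [hSK]
      exact (h.isCompact.isClosed.inter
        (isClosed_eq (by fun_prop) continuous_const)).measurableSet
    · rw [hSK]
      exact fun y hy ↦ hy.2
  refine Filter.EventuallyEq.symm (Filter.eventuallyEq_set.2 ?_)
  have hall : ∀ᵐ x ∂(G.areaMeasure (k + 1)), ∀ i,
      {x | x ∈ P ∧ a i + ⟪b i, G.flatMap x⟫ = 0} ∉ G.facets P →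
        ¬ (x ∈ P ∧ a i + ⟪b i, G.flatMap x⟫ = 0) := by
    refine ae_all_iff.2 fun i ↦ ?_
    by_cases hi : {x | x ∈ P ∧ a i + ⟪b i, G.flatMap x⟫ = 0} ∈ G.facets P
    · exact Filter.Eventually.of_forall fun x hx ↦ absurd hi hx
    · filter_upwards [measure_eq_zero_iff_ae_notMem.1 (hnull i hi)] with x hx _ using hx
  filter_upwards [hall] with x hx
  rw [hc.frontier_eq]
  simp only [Set.mem_iUnion, exists_prop]
  constructor
  · rintro ⟨F, hF, hxF⟩
    have hxP := G.subset_of_mem_facets hF hxF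
    refine ⟨hxP, fun hxi ↦ ?_⟩
    obtain ⟨ν, p, hFo⟩ := exists_isFacetOn (G.flatMap_image_mem_facets hP hF)
    have h1 := IsPolytope.lt_inner hFo ((G.flatMap_mem_interior_iff hP (hP hxP)).2 hxi)
    exact h1.ne' ((hFo.mem_iff _).1 ⟨x, hxF, rfl⟩).2
  · rintro ⟨hxP, hxi⟩
    rw [← G.flatMap_mem_interior_iff hP (hP hxP), h.mem_interior_iff] at hxi
    push Not at hxi
    obtain ⟨i, hi⟩ := hxi
    have h0 : a i + ⟪b i, G.flatMap x⟫ = 0 :=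
      le_antisymm hi ((h.mem_iff _).1 ⟨x, hxP, rfl⟩ i)
    by_contra hno
    exact hx i (fun hf ↦ hno ⟨_, hf, hxP, h0⟩) ⟨hxP, h0⟩

theorem areaMeasure_frontier [Finite ι] (h : IsPolytope (G.flatMap '' P) a b) (hc : IsClosed P)
    (hP : P ⊆ G.domain (k + 1)) :
    G.areaMeasure (k + 1) (frontier P) =
      ∑ F ∈ (G.finite_facets h hP).toFinset, G.areaMeasure (k + 1) F := by
  rw [measure_congr (G.frontier_ae_eq h hc hP), ← measure_biUnion_finset₀]
  · simp
  · intro F hF F' hF' hne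
    simp only [Set.Finite.coe_toFinset] at hF hF'
    exact G.areaMeasure_inter_facets h hP hF hF' hne
  · intro F hF
    exact (G.measurableSet_facet h hP ((Set.Finite.mem_toFinset _).1 hF)).nullMeasurableSet

end ModelGeometry

end Area

/-! ### Almost every vector enters through exactly one facet. -/

section Entering

theorem IsPolytope.convex {k : ℕ} {ι : Type*} {K : Set (EuclideanSpace ℝ (Fin (k + 1)))} {a : ι → ℝ}
    {b : ι → EuclideanSpace ℝ (Fin (k + 1))} (h : IsPolytope K a b) : Convex ℝ K := by
  intro x hx y hy s t hs ht hst
  rw [h.mem_iff] at hx hy ⊢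
  intro i
  have h1 := mul_nonneg hs (hx i)
  have h2 := mul_nonneg ht (hy i)
  have h3 : a i = (s + t) * a i := by rw [hst, one_mul]
  rw [inner_add_right, inner_smul_right, inner_smul_right]
  linarith

namespace ModelGeometry

variable (G : ModelGeometry) {k : ℕ} {P F K : Set (EuclideanSpace ℝ (Fin (k + 1)))} {ι : Type*}
  {a : ι → ℝ} {b : ι → EuclideanSpace ℝ (Fin (k + 1))}

/-- The unit vectors based in the interior of `K` whose line enters `K` at exactly one facet. -/
def regularSet (K : Set (EuclideanSpace ℝ (Fin (k + 1)))) :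
    Set (EuclideanSpace ℝ (Fin (k + 1)) × Metric.sphere (0 : EuclideanSpace ℝ (Fin (k + 1))) 1) :=
  ⋃ F ∈ euclidean.facets K, enteringSet K F ∩
    ⋂ F' ∈ euclidean.facets K, {v | v ∈ enteringSet K F' → F' = F}

theorem measurableSet_regularSet [Finite ι] (h : IsPolytope K a b) :
    MeasurableSet (regularSet K) := by
  have hm : ∀ F ∈ euclidean.facets K, MeasurableSet (enteringSet K F) := by
    intro F hF
    obtain ⟨ν, p, hFo⟩ := exists_isFacetOn hF
    exact h.measurableSet_entersAt hFo
  have hfin := h.finite_facets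
  refine hfin.measurableSet_biUnion fun F hF ↦ (hm F hF).inter
    (hfin.measurableSet_biInter fun F' hF' ↦ ?_)
  by_cases he : F' = F
  · simp [he]
  · have : {v | v ∈ enteringSet K F' → F' = F} = (enteringSet K F')ᶜ := by
      ext v
      simp [he]
    rw [this]
    exact (hm F' hF').compl

/-- The boundary of a convex set is null, and from the interior almost every line in a given
direction has a single entry facet. -/
theorem ae_mem_regularSet [Finite ι] (h : IsPolytope K a b)
    (u : Metric.sphere (0 : EuclideanSpace ℝ (Fin (k + 1))) 1) :
    ∀ᵐ y ∂(volume.restrict K), (y, u) ∈ regularSet K := by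
  have hfr := h.convex.addHaar_frontier volume
  rw [h.isCompact.isClosed.frontier_eq] at hfr
  rw [ae_restrict_iff' h.isCompact.isClosed.measurableSet]
  filter_upwards [h.ae_existsUnique_entersAt (norm_eq_of_mem_sphere u),
    measure_eq_zero_iff_ae_notMem.1 hfr] with y hy hyf hyK
  have hyi : y ∈ interior K := by
    by_contra hn
    exact hyf ⟨hyK, hn⟩
  obtain ⟨F, ⟨hF, hFe⟩, huniq⟩ := hy hyi
  simp only [regularSet, Set.mem_iUnion, Set.mem_inter_iff, Set.mem_iInter, exists_prop]
  exact ⟨F, hF, ⟨hyi, hFe⟩, fun F' hF' hE ↦ huniq F' ⟨hF', hE.2⟩⟩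

theorem ae_liouville_mem_regularSet [Finite ι] (h : IsPolytope (G.flatMap '' P) a b)
    (hP : P ⊆ G.domain (k + 1)) (hPm : MeasurableSet P) :
    ∀ᵐ v ∂(G.liouville P), (G.flatMap v.1, G.flatDir v.1 v.2) ∈ regularSet (G.flatMap '' P) := by
  have hm := measurableSet_regularSet h
  set R := regularSet (G.flatMap '' P) with hR
  have hae : ∀ᵐ y ∂(volume.restrict (G.flatMap '' P)),
      ∀ᵐ u ∂(volume : Measure (EuclideanSpace ℝ (Fin (k + 1)))).toSphere, (y, u) ∈ R :=
    -- Fubini: the statement for each direction and almost every point becomes one for almost every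
    -- point and almost every direction. The Liouville formula applied to the indicator of the
    -- complement then transfers it.
    (Measure.ae_ae_comm (p := fun y u ↦ (y, u) ∈ R) hm).2
      (Filter.Eventually.of_forall fun u ↦ ae_mem_regularSet h u)
  have hH : Measurable (Rᶜ.indicator (fun _ ↦ (1 : ENNReal))) := measurable_const.indicator hm.compl
  have h0 : ∫⁻ v, Rᶜ.indicator (fun _ ↦ (1 : ENNReal)) (G.flatMap v.1, G.flatDir v.1 v.2)
      ∂(G.liouville P) = 0 := by
    rw [G.lintegral_liouville hPm hP hH]
    refine (lintegral_congr_ae (g := 0) ?_).trans lintegral_zero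
    filter_upwards [hae] with y hy
    refine mul_eq_zero_of_right _ ((lintegral_congr_ae (g := 0) ?_).trans lintegral_zero)
    filter_upwards [hy] with u hu
    rw [Set.indicator_of_notMem (Set.notMem_compl_iff.2 hu), zero_mul]
    rfl
  have hdir := G.measurable_flatDir (k := k)
  have hfm := (G.continuous_flatMap (n := k + 1)).measurable
  rw [lintegral_eq_zero_iff (by fun_prop)] at h0
  filter_upwards [h0] with v hv
  by_contra hn
  rw [Set.indicator_of_mem (Set.mem_compl hn)] at hv
  exact one_ne_zero hv

theorem ae_liouville_mem (hPm : MeasurableSet P) : ∀ᵐ v ∂(G.liouville P), v.1 ∈ P := by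
  have hvm : MeasurableSet P → ∀ᵐ x ∂((G.volumeMeasure (k + 1)).restrict P), x ∈ P :=
    ae_restrict_mem
  exact Measure.quasiMeasurePreserving_fst.ae (hvm hPm)

/-- The inverse of the chord length, on the vectors which enter at `F`. -/
noncomputable def facetTerm (P F : Set (EuclideanSpace ℝ (Fin (k + 1))))
    (v : EuclideanSpace ℝ (Fin (k + 1)) × Metric.sphere (0 : EuclideanSpace ℝ (Fin (k + 1))) 1) :
    ENNReal :=
  (enteringSet (G.flatMap '' P) (G.flatMap '' F)).indicator
    (fun v ↦ (G.flatLength (G.flatMap '' P) v.1 v.2)⁻¹) (G.flatMap v.1, G.flatDir v.1 v.2)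

theorem measurable_facetTerm (h : IsPolytope (G.flatMap '' P) a b) (hP : P ⊆ G.domain (k + 1))
    (hF : F ∈ G.facets P) : Measurable (G.facetTerm P F) := by
  obtain ⟨ν, p, hFo⟩ := exists_isFacetOn (G.flatMap_image_mem_facets hP hF)
  have hHm := G.measurable_indicator_enteringSet h hFo
  have hdir := G.measurable_flatDir (k := k)
  have hfm := (G.continuous_flatMap (n := k + 1)).measurable
  unfold facetTerm
  fun_prop

theorem log_div_chordLength_ae_eq [Finite ι] (h : IsPolytope (G.flatMap '' P) a b)
    (hP : P ⊆ G.domain (k + 1)) (hPm : MeasurableSet P)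
    {q : Set (EuclideanSpace ℝ (Fin (k + 1))) → ℝ}
    {Q : EuclideanSpace ℝ (Fin (k + 1)) × Metric.sphere (0 : EuclideanSpace ℝ (Fin (k + 1))) 1 → ℝ}
    (hQ : G.IsFaceWeight P q Q) :
    (fun v ↦ Real.log (Q v) / G.chordLength P v) =ᵐ[G.liouville P] fun v ↦
      ∑ F ∈ (G.finite_facets h hP).toFinset, Real.log (q F) * (G.facetTerm P F v).toReal := by
  filter_upwards [G.ae_liouville_mem_regularSet h hP hPm, G.ae_liouville_mem hPm] with v hv hvP
  obtain ⟨hl0, hl, hent⟩ := G.chord_eq h hP hvP v.2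
  simp only [regularSet, Set.mem_iUnion, Set.mem_inter_iff, Set.mem_iInter, exists_prop] at hv
  obtain ⟨F₁, hF₁, hv₁, huniq⟩ := hv
  rw [← G.image_facets hP] at hF₁
  obtain ⟨F, hF, rfl⟩ := hF₁
  have hvi : v.1 ∈ interior P := (G.flatMap_mem_interior_iff hP (hP hvP)).1 hv₁.1
  have hmem : ∀ F' ∈ G.facets P, (G.flatMap v.1, G.flatDir v.1 v.2) ∈
      enteringSet (G.flatMap '' P) (G.flatMap '' F') → F' = F := fun F' hF' hE ↦
    G.injOn_image_facets hP hF' hF (huniq _ (G.flatMap_image_mem_facets hP hF') hE)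
  have hQv : Q v = q F := by
    refine hQ v hvi F hF ((hent F (G.subset_of_mem_facets hF)).2 hv₁.2) fun F' hF' hE ↦
      hmem F' hF' ⟨hv₁.1, (hent F' (G.subset_of_mem_facets hF')).1 hE⟩
  rw [Finset.sum_eq_single F]
  -- The conventions agree even at length 0: `ENNReal.toReal` sends the infinite inverse to 0, as
  -- does real division by 0.
  · rw [facetTerm, Set.indicator_of_mem hv₁, ENNReal.toReal_inv, hl, ENNReal.toReal_ofReal hl0, hQv]
    rfl
  · intro F' hF' hne
    rw [facetTerm, Set.indicator_of_notMem fun hE ↦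
      hne (hmem F' ((Set.Finite.mem_toFinset _).1 hF') hE), ENNReal.toReal_zero, mul_zero]
  · exact fun hn ↦ absurd ((Set.Finite.mem_toFinset _).2 hF) hn

theorem integral_max_inner {e : EuclideanSpace ℝ (Fin (k + 1))} (he : ‖e‖ = 1) :
    ∫ w : Metric.sphere (0 : EuclideanSpace ℝ (Fin (k + 1))) 1,
        max 0 ⟪(w : EuclideanSpace ℝ (Fin (k + 1))), e⟫
          ∂(volume : Measure (EuclideanSpace ℝ (Fin (k + 1)))).toSphere =
      (volume : Measure (EuclideanSpace ℝ (Fin k))).real (Metric.ball 0 1) := by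
  rw [integral_eq_lintegral_of_nonneg_ae (f := fun w : Metric.sphere (0 : EuclideanSpace ℝ
    (Fin (k + 1))) 1 ↦ max 0 ⟪(w : EuclideanSpace ℝ (Fin (k + 1))), e⟫)
    (Filter.Eventually.of_forall fun w ↦ le_max_left _ _)
    (Continuous.aestronglyMeasurable (by fun_prop)), Measure.real, ← lintegral_sphere_inner he]
  congr 1
  refine lintegral_congr fun w ↦ ?_
  rw [real_inner_comm]
  rcases le_total 0 ⟪e, (w : EuclideanSpace ℝ (Fin (k + 1)))⟫ with h | h
  · rw [max_eq_right h]
  · rw [max_eq_left h, ENNReal.ofReal_zero, ENNReal.ofReal_of_nonpos h]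

end ModelGeometry

end Entering

/-! ### The integral formula. -/

theorem proposition1p1 (G : ModelGeometry) (n : ℕ) (hn : 1 ≤ n)
    (P : Set (EuclideanSpace ℝ (Fin n))) (hP : G.IsConvexPolyhedron P)
    (q : Set (EuclideanSpace ℝ (Fin n)) → ℝ) (hq : ∀ F ∈ G.facets P, 0 < q F)
    (Q : EuclideanSpace ℝ (Fin n) × Metric.sphere (0 : EuclideanSpace ℝ (Fin n)) 1 → ℝ)
    (hQ : G.IsFaceWeight P q Q) :
    (∀ e : EuclideanSpace ℝ (Fin n), ‖e‖ = 1 →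
      ∫ w : Metric.sphere (0 : EuclideanSpace ℝ (Fin n)) 1, max 0 ⟪(w : EuclideanSpace ℝ (Fin n)), e⟫
          ∂(volume : Measure (EuclideanSpace ℝ (Fin n))).toSphere =
        (volume : Measure (EuclideanSpace ℝ (Fin (n - 1)))).real (Metric.ball 0 1)) ∧
    (G.facets P).Finite ∧
    (∀ F ∈ G.facets P, G.areaMeasure n F < ⊤) ∧
    G.areaMeasure n (frontier P) < ⊤ ∧
    Integrable (fun v => Real.log (Q v) / G.chordLength P v) (G.liouville P) ∧
    ∫ v, Real.log (Q v) / G.chordLength P v ∂(G.liouville P) =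
      (volume : Measure (EuclideanSpace ℝ (Fin (n - 1)))).real (Metric.ball 0 1) *
        ∑ᶠ F ∈ G.facets P, Real.log (q F) * (G.areaMeasure n).real F ∧
    ∀ c : ℝ, (∀ F ∈ G.facets P, q F = c) →
      ∫ v, Real.log (Q v) / G.chordLength P v ∂(G.liouville P) =
        (volume : Measure (EuclideanSpace ℝ (Fin (n - 1)))).real (Metric.ball 0 1) *
          Real.log c * (G.areaMeasure n).real (frontier P) := by
  obtain ⟨k, rfl⟩ : ∃ k, n = k + 1 := ⟨n - 1, by omega⟩
  rw [Nat.add_sub_cancel]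
  obtain ⟨m, a, b, h⟩ := G.exists_isPolytope hP
  have hPd := hP.subset_domain
  have hPc := hP.1.isClosed
  have hPm := hPc.measurableSet
  have hfin := G.finite_facets h hPd
  have harea := fun F (hF : F ∈ G.facets P) ↦ G.areaMeasure_facet_lt_top h hPd hF
  have hae := G.log_div_chordLength_ae_eq h hPd hPm hQ
  have hflux : ∀ F ∈ G.facets P, ∫⁻ v, G.facetTerm P F v ∂(G.liouville P) =
      volume (Metric.ball (0 : EuclideanSpace ℝ (Fin k)) 1) * G.areaMeasure (k + 1) F :=
    fun F hF ↦ G.lintegral_inv_flatLength h hPd hPm hF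
  have hfront := G.areaMeasure_frontier h hPc hPd
  have hne : ∀ F ∈ G.facets P, ∫⁻ v, G.facetTerm P F v ∂(G.liouville P) ≠ ⊤ := fun F hF ↦ by
    rw [hflux F hF]
    exact ENNReal.mul_ne_top measure_ball_lt_top.ne (harea F hF).ne
  have hint : ∀ F ∈ hfin.toFinset, Integrable
      (fun v ↦ Real.log (q F) * (G.facetTerm P F v).toReal) (G.liouville P) := fun F hF ↦ by
    rw [Set.Finite.mem_toFinset] at hF
    exact (integrable_toReal_of_lintegral_ne_top
      (G.measurable_facetTerm h hPd hF).aemeasurable (hne F hF)).const_mul _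
  have hmain : ∫ v, Real.log (Q v) / G.chordLength P v ∂(G.liouville P) =
      (volume : Measure (EuclideanSpace ℝ (Fin k))).real (Metric.ball 0 1) *
        ∑ F ∈ hfin.toFinset, Real.log (q F) * (G.areaMeasure (k + 1)).real F := by
    rw [integral_congr_ae hae, integral_finsetSum _ hint, Finset.mul_sum]
    refine Finset.sum_congr rfl fun F hF ↦ ?_
    rw [Set.Finite.mem_toFinset] at hF
    have hFm := G.measurable_facetTerm h hPd hF
    rw [integral_const_mul, integral_toReal hFm.aemeasurable
      (ae_lt_top' hFm.aemeasurable (hne F hF)), hflux F hF, ENNReal.toReal_mul]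
    simp only [Measure.real]
    ring
  refine ⟨fun e he ↦ ModelGeometry.integral_max_inner he, hfin, harea, ?_, ?_, ?_, fun c hc ↦ ?_⟩
  · rw [hfront]
    exact ENNReal.sum_lt_top.2 fun F hF ↦ harea F ((Set.Finite.mem_toFinset _).1 hF)
  -- The values of `Q` on exceptional vectors are arbitrary, so even measurability is obtained from
  -- the almost everywhere equal finite sum.
  · exact (integrable_finsetSum _ hint).congr hae.symm
  · rw [hmain]
    exact congrArg _ (finsum_mem_eq_finite_toFinset_sum _ hfin).symm
  · rw [hmain, Measure.real, Measure.real, hfront, ENNReal.toReal_sum fun F hF ↦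
      (harea F ((Set.Finite.mem_toFinset _).1 hF)).ne, mul_assoc]
    congr 1
    rw [Finset.mul_sum]
    refine Finset.sum_congr rfl fun F hF ↦ ?_
    rw [hc F ((Set.Finite.mem_toFinset _).1 hF), Measure.real]
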